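/- Let $\overline M$ be the elliptic curve $y^2=x(x-1)(x+1)$, let $M=\overline M\setminus\{\infty\}$ be its affine part, and put $$\rho=\frac{\sqrt6\,\Gamma(3/4)}{\Gamma(1/4)},\qquad G=\frac{1}{\rho}\cdot\frac{x}{y},\qquad dh=dx .$$ These are the Gauss map and the height differential of the Chen–Gackstatter surface. For $\zeta\in\mathbb C$ with $\operatorname{Re}\zeta\neq0$, its Lorentz deformation with parameter $\zeta$ is the surface $\widetilde X_\zeta:M\to\mathbb R^4_1$ (unique up to translation) $$\widetilde X_\zeta=2\operatorname{Re}\int\bigl(\phi+\psi,\,-i(\phi-\psi),\,1-\phi\psi,\,1+\phi\psi\bigr)\,\zeta\,dh,\qquad \phi=\frac G\zeta,\quad \psi=\frac{-1}{\zeta G},$$ where $\mathbb R^4_1$ carries the inner product $v_1w_1+v_2w_2+v_3w_3-v_4w_4$; $\widetilde X_1$ is the Chen–Gackstatter surface itself, in $\mathbb R^3=\{X_4=0\}$. Then the following hold. The surface $M$ is a torus punctured at one point: it is biholomorphic to $\mathbb C/(\mathbb Z+\mathbb Z i)$ minus the point $0$, with the puncture corresponding to the end of $M$. The integral defining $\widetilde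 X_\zeta$ has no real periods, so that $\widetilde X_\zeta$ is well defined on $M$, and after suitable translations it depends smoothly on $(\zeta,p)$; different parameters $\zeta$ give different maps, even up to translation. Thus the $\widetilde X_\zeta$ form a real $2$-parameter family through a surface in $\mathbb R^3=\{X_4=0\}$ (at $\zeta=1$). For each $\zeta$ with $\operatorname{Re}\zeta\ne0$: - $\widetilde X_\zeta$ is a conformal spacelike immersion with zero mean curvature (a stationary surface), and its induced metric is complete; - its end is regular, i.e. $\phi$ and $\overline\psi$ have different limits in $\mathbb C\cup\{\infty\}$ at the end; - the Gauss curvature is integrable and the total curvature is $-\int_M K\,dM=8\pi$; - (1) if $\zeta$ is not real, there are exactly two points of $\mathbb R^4_1$ through which $\widetilde X_\zeta$ passes more than once (self-intersection points); - (2) $\widetilde X_\zeta$ has the $8$-element dihedral symmetry group $D_4$, as the original surface $\widetilde X_1$ does: the group of transformations of $\widetilde X_\zeta(M)$ induced by the isometries of $\mathbb R^4_1$ that map $\widetilde X_\zeta(M)$ onto itself is isomorphic to $D_4$; and if $\zeta$ is not real, the group of these isometries is itself isomorphic to $D_4$. -/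

import Mathlib

open Filter Topology MeasureTheory
open scoped ContDiff ComplexConjugate Laplacian

noncomputable section

/-- The Lorentz space `ℝ⁴₁`. -/
abbrev R41 : Type := Fin 4 → ℝ

/-- The Lorentz inner product `v₁w₁ + v₂w₂ + v₃w₃ - v₄w₄`. -/
def lor (v w : R41) : ℝ := v 0 * w 0 + v 1 * w 1 + v 2 * w 2 - v 3 * w 3

/-! ### The underlying Riemann surface -/

/-- The affine part of the elliptic curve `y² = x (x - 1) (x + 1)`, i.e. the projective curve
punctured at its point at infinity (which is the end of the surfaces below). -/
abbrev CGCurve : Type := {p : ℂ × ℂ // p.2 ^ 2 = p.1 * (p.1 - 1) * (p.1 + 1)}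

/-- `γ`, restricted to the open set `U ⊆ ℂ`, is a local holomorphic parametrization of the curve
(the inverse of a holomorphic chart): it is holomorphic, injective, with nonzero derivative. -/
structure IsParam (γ : ℂ → CGCurve) (U : Set ℂ) : Prop where
  isOpen : IsOpen U
  holo : DifferentiableOn ℂ (fun w => (γ w : ℂ × ℂ)) U
  regular : ∀ w ∈ U, deriv (fun w => (γ w : ℂ × ℂ)) w ≠ 0
  inj : Set.InjOn γ U

/-- `z` lies in the square lattice `ℤ + ℤ i`. -/
def InSquareLattice (z : ℂ) : Prop := ∃ m n : ℤ, z = m + n * Complex.I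

/-- The curve is a torus punctured at one point: there is a biholomorphic map from
`ℂ / (ℤ + ℤ i)` minus the point `0` onto it, written as a lattice-periodic map `q` on `ℂ`, and the
puncture `0` corresponds to the end of the curve. The value of `q` on the lattice is irrelevant. -/
def CurveIsPuncturedTorus : Prop :=
  ∃ q : ℂ → CGCurve,
    DifferentiableOn ℂ (fun z => (q z : ℂ × ℂ)) {z | ¬ InSquareLattice z} ∧
    (∀ z w, ¬ InSquareLattice z → ¬ InSquareLattice w →
      (q z = q w ↔ InSquareLattice (z - w))) ∧
    (∀ p, ∃ z, ¬ InSquareLattice z ∧ q z = p) ∧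
    Tendsto q (𝓝[≠] 0) (cocompact CGCurve)

/-! ### Surfaces in `ℝ⁴₁` parametrized by the curve -/

/-- Second derivative of `f` at `w`, first in direction `a`, then in direction `b`. -/
def secondDeriv (f : ℂ → R41) (w a b : ℂ) : R41 :=
  fderiv ℝ (fun w' => fderiv ℝ f w' a) w b

/-- Coefficients of the first fundamental form of `f` in the coordinates `w = u + i v`:
`firstFF f w 1 1 = E`, `firstFF f w 1 I = F`, `firstFF f w I I = G`. -/
def firstFF (f : ℂ → R41) (w a b : ℂ) : ℝ := lor (fderiv ℝ f w a) (fderiv ℝ f w b)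

/-- `X` is a smooth spacelike immersion: the induced metric is positive definite. -/
def IsSpacelikeImmersion (X : CGCurve → R41) : Prop :=
  ∀ γ U, IsParam γ U → ContDiffOn ℝ ∞ (X ∘ γ) U ∧
    ∀ w ∈ U, ∀ v : ℂ, v ≠ 0 → 0 < firstFF (X ∘ γ) w v v

/-- `X` is conformal with respect to the complex structure of the curve. -/
def IsConformalSurface (X : CGCurve → R41) : Prop :=
  ∀ γ U, IsParam γ U → ∀ w ∈ U,
    firstFF (X ∘ γ) w 1 1 = firstFF (X ∘ γ) w Complex.I Complex.I ∧
    firstFF (X ∘ γ) w 1 Complex.I = 0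

/-- The mean curvature vector `H = ½ ∑ gⁱʲ (∂ᵢ∂ⱼX)^⊥` vanishes, i.e. (after multiplication with
`2 det g`) the vector `G X_uu - 2 F X_uv + E X_vv` is tangent to the surface. -/
def HasZeroMeanCurvature (X : CGCurve → R41) : Prop :=
  ∀ γ U, IsParam γ U → ∀ w ∈ U,
    firstFF (X ∘ γ) w Complex.I Complex.I • secondDeriv (X ∘ γ) w 1 1
      - (2 * firstFF (X ∘ γ) w 1 Complex.I) • secondDeriv (X ∘ γ) w 1 Complex.I
      + firstFF (X ∘ γ) w 1 1 • secondDeriv (X ∘ γ) w Complex.I Complex.I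
      ∈ Submodule.span ℝ {fderiv ℝ (X ∘ γ) w 1, fderiv ℝ (X ∘ γ) w Complex.I}

/-- `X` is a (conformally parametrized) stationary surface: a conformal spacelike immersion with
zero mean curvature. -/
def IsStationarySurface (X : CGCurve → R41) : Prop :=
  IsSpacelikeImmersion X ∧ IsConformalSurface X ∧ HasZeroMeanCurvature X

/-- The induced metric is complete: every divergent `C¹` curve has infinite length. -/
def IsCompleteSurface (X : CGCurve → R41) : Prop :=
  ∀ c : ℝ → CGCurve, ContDiffOn ℝ 1 (fun t => (c t : ℂ × ℂ)) (Set.Ici 0) →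
    Tendsto c atTop (cocompact CGCurve) →
    ∫⁻ t in Set.Ioi (0 : ℝ),
      ENNReal.ofReal (Real.sqrt (lor (deriv (X ∘ c) t) (deriv (X ∘ c) t))) = ⊤

/-- `K` is the Gauss curvature of the metric induced by the conformal immersion `X`: if the metric
is `E |dw|²` in the conformal coordinate `w`, then `K = - (Δ log E) / (2 E)`. -/
def IsGaussCurvature (X : CGCurve → R41) (K : CGCurve → ℝ) : Prop :=
  ∀ γ U, IsParam γ U → ∀ w ∈ U,
    K (γ w) = - (Δ (fun w' => Real.log (firstFF (X ∘ γ) w' 1 1))) w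
      / (2 * firstFF (X ∘ γ) w 1 1)

/-- `μ` is the area measure of the metric induced by `X`: it has density `√(EG - F²)` in local
coordinates. -/
def IsAreaMeasure (X : CGCurve → R41) (μ : Measure CGCurve) : Prop :=
  ∀ γ U, IsParam γ U → ∀ A : Set ℂ, MeasurableSet A → A ⊆ U →
    μ (γ '' A) = ∫⁻ w in A, ENNReal.ofReal (Real.sqrt
      (firstFF (X ∘ γ) w 1 1 * firstFF (X ∘ γ) w Complex.I Complex.I
        - firstFF (X ∘ γ) w 1 Complex.I ^ 2))

/-- The total curvature `-∫ K dM` exists (absolutely) and equals `c`. The curvature function and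
the area measure are uniquely determined by `X`. -/
def HasTotalCurvature (X : CGCurve → R41) (c : ℝ) : Prop :=
  ∃ (K : CGCurve → ℝ) (μ : Measure CGCurve), IsGaussCurvature X K ∧ IsAreaMeasure X μ ∧
    Integrable K μ ∧ -∫ p, K p ∂μ = c

/-- The points of `ℝ⁴₁` through which the surface passes more than once. -/
def selfIntersectionPoints (X : CGCurve → R41) : Set R41 :=
  {P | ∃ p q : CGCurve, p ≠ q ∧ X p = P ∧ X q = P}

/-! ### Symmetries -/

/-- The isometry group of `ℝ⁴₁`. -/
def isometryGroup : Subgroup (R41 ≃ᵃ[ℝ] R41) where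
  carrier := {T | ∀ P Q, lor (T P - T Q) (T P - T Q) = lor (P - Q) (P - Q)}
  one_mem' := fun _ _ => rfl
  mul_mem' := fun {S T} hS hT P Q => (hS (T P) (T Q)).trans (hT P Q)
  inv_mem' := fun {T} hT P Q => by
    have h := hT (T⁻¹ P) (T⁻¹ Q)
    have e : ∀ R : R41, T (T⁻¹ R) = R := fun R => T.apply_symm_apply R
    rw [e, e] at h
    exact h.symm

/-- The symmetry group: all isometries `T` of `ℝ⁴₁` with `T (X(M)) = X(M)`. -/
def symmetryGroup (X : CGCurve → R41) : Subgroup (R41 ≃ᵃ[ℝ] R41) where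
  carrier := {T | T ∈ isometryGroup ∧ T '' Set.range X = Set.range X}
  one_mem' := ⟨isometryGroup.one_mem, Set.image_id _⟩
  mul_mem' := fun {S T} hS hT => ⟨isometryGroup.mul_mem hS.1 hT.1, by
    have e : ((S * T : R41 ≃ᵃ[ℝ] R41) : R41 → R41) = S ∘ T := rfl
    rw [e, Set.image_comp, hT.2, hS.2]⟩
  inv_mem' := fun {T} hT => ⟨isometryGroup.inv_mem hT.1, by
    have e : ((T⁻¹ : R41 ≃ᵃ[ℝ] R41) : R41 → R41) ∘ T = id :=
      funext fun P => T.symm_apply_apply P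
    conv_lhs => rw [← hT.2]
    rw [← Set.image_comp, e, Set.image_id]⟩

/-- The symmetries as transformations of the surface `X(M)` itself: the permutations of `X(M)`
that are restrictions of elements of the symmetry group. (This differs from the symmetry group
only if `X(M)` lies in a hyperplane, where the reflection in that hyperplane acts trivially.) -/
def surfaceSymmetryGroup (X : CGCurve → R41) : Subgroup (Equiv.Perm (Set.range X)) where
  carrier := {σ | ∃ T ∈ symmetryGroup X, ∀ P, (σ P : R41) = T P}
  one_mem' := ⟨1, (symmetryGroup X).one_mem, fun _ => rfl⟩
  mul_mem' := by
    rintro σ τ ⟨S, hS, h⟩ ⟨T, hT, h'⟩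
    refine ⟨S * T, (symmetryGroup X).mul_mem hS hT, fun P => ?_⟩
    rw [Equiv.Perm.mul_apply, h, h']
    rfl
  inv_mem' := by
    rintro σ ⟨T, hT, h⟩
    refine ⟨T⁻¹, (symmetryGroup X).inv_mem hT, fun P => ?_⟩
    have h1 := h (σ⁻¹ P)
    have e : σ (σ⁻¹ P) = P := σ.apply_symm_apply P
    rw [e] at h1
    rw [h1]
    exact (T.symm_apply_apply _).symm

/-! ### Weierstrass representation and the Lorentz deformation -/

/-- The components of `(φ + ψ, -i (φ - ψ), 1 - φψ, 1 + φψ)`. -/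
def weierstrassVector (φ ψ : ℂ) : Fin 4 → ℂ :=
  ![φ + ψ, -Complex.I * (φ - ψ), 1 - φ * ψ, 1 + φ * ψ]

/-- `X = 2 Re ∫ (φ + ψ, -i (φ - ψ), 1 - φψ, 1 + φψ) dh`, i.e. `X` is continuous on the curve and
`dX = 2 Re ((φ + ψ, -i (φ - ψ), 1 - φψ, 1 + φψ) dh)` at every point with `y ≠ 0`. The Gauss maps
used below are holomorphic at these points; at the three exceptional points one of them has a
pole. The height differential is the differential of the function `h`. -/
def IsWeierstrassSurface (φ ψ h : CGCurve → ℂ) (X : CGCurve → R41) : Prop :=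
  Continuous X ∧
  ∀ γ U, IsParam γ U → ∀ w ∈ U, (γ w : ℂ × ℂ).2 ≠ 0 →
    DifferentiableAt ℝ (X ∘ γ) w ∧
    ∀ (v : ℂ) (k : Fin 4), fderiv ℝ (X ∘ γ) w v k =
      2 * (weierstrassVector (φ (γ w)) (ψ (γ w)) k * (deriv (h ∘ γ) w * v)).re

/-- The constant `ρ = √6 Γ(3/4) / Γ(1/4)`. -/
def rhoCG : ℝ := Real.sqrt 6 * Real.Gamma (3 / 4) / Real.Gamma (1 / 4)

/-- The Gauss map `G = x / (ρ y)` of the Chen–Gackstatter surface (used where `y ≠ 0`; there it is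
finite and nonzero). -/
def gaussCG (p : CGCurve) : ℂ := (p : ℂ × ℂ).1 / (rhoCG * (p : ℂ × ℂ).2)

/-- The height function `x` of the Chen–Gackstatter surface, so that `dh = dx`. -/
def heightCG (p : CGCurve) : ℂ := (p : ℂ × ℂ).1

/-- The Gauss map `φ = G / ζ` of the Lorentz deformation. -/
def phiCG (ζ : ℂ) (p : CGCurve) : ℂ := gaussCG p / ζ

/-- The Gauss map `ψ = -1 / (ζ G)` of the Lorentz deformation. -/
def psiCG (ζ : ℂ) (p : CGCurve) : ℂ := -1 / (ζ * gaussCG p)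

/-- `X` is (up to translation, the only freedom left) the Lorentz deformation of the
Chen–Gackstatter surface with parameter `ζ`: its Weierstrass data are `φ = G / ζ`,
`ψ = -1 / (ζ G)` and the height differential `ζ dx`. For `ζ = 1` this is the Chen–Gackstatter
surface itself, in `ℝ³ = {X₄ = const}`. -/
def IsLorentzDeformationCG (ζ : ℂ) (X : CGCurve → R41) : Prop :=
  IsWeierstrassSurface (phiCG ζ) (psiCG ζ) (fun p => ζ * heightCG p) X

/-- The end is regular for the surface with Gauss maps `φ, ψ`: at the end, `φ` and `conj ψ` have
limits in the Riemann sphere, and these are different. -/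
def HasRegularEnd (φ ψ : CGCurve → ℂ) : Prop :=
  ∃ a b : OnePoint ℂ,
    Tendsto (fun p => (φ p : OnePoint ℂ)) (cocompact CGCurve) (𝓝 a) ∧
    Tendsto (fun p => ((conj (ψ p) : ℂ) : OnePoint ℂ)) (cocompact CGCurve) (𝓝 b) ∧
    a ≠ b

end

/-!
# The Lorentz deformations of the Chen–Gackstatter surface

**Uniformization and periods.** The curve `y² = x (x - 1) (x + 1)` is parametrized by the Weierstrass
function of the square lattice (`qC`, `curveIsPuncturedTorus`), which satisfies
`℘ (i z) = -℘ z`, so that `g₃ = 0`. In the coordinate `z` the forms `G dx` and `dx / G` are constant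
multiples of `℘ dz` and, up to an exact form, of `dz`; their integrals are multiples of the Weierstrass
zeta function and of `z`. The combination `Φ = 2 (∫ G dx - conj ∫ dx / G)`, which is `X₁ + i X₂`, has no
periods for exactly one value of `ρ²`. Integrating along a real arc of the curve on which the integrals
are beta integrals (`beta_relation`) identifies this value with `(√6 Γ(3/4) / Γ(1/4))²` (`lamC_eq`). As
`φ ψ = -1 / ζ²`, the other two coordinates are `2 Re ((ζ ± 1 / ζ) x)`. Hence all surfaces have the
explicit form `Xstd ζ`, up to translation, in which `Φ` does not depend on `ζ`.

**Local geometry.** The surface is the real part of a null curve, with conformal factor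
`4 (‖G‖² + ‖1 / G‖²) + 8 κ` with respect to `|dx|²`, where `κ = Re (ζ / conj ζ) > -1`
(`isStationarySurface`, `isCompleteSurface`). The Gauss map `G` has degree two. It is inverted
explicitly on the two sheets `|x| > 1` and `|x| < 1`, which cover the curve up to a null set; in the
coordinate `g = G` the form `-K dA` becomes a radial density on the plane with integral `4 π`
(`integral_curvDens`), so the two sheets contribute `8 π` (`hasTotalCurvature`).

**Zeros of `Φ`.** The curve has a section `branch` over the closed quadrant `Re x, Im x ≥ 0`, and the
automorphisms of the curve carry the quadrant to the whole `x`-plane. Monotonicity and concavity of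
`Φ` along the boundary of the quadrant, and along vertical half lines inside it, show that `Φ` vanishes
exactly over `x = 0, ±1, ±s` for some `s > 1` (`exists_zeros_PhiC`), and that it maps the curve
`Re x = 0` onto the two lines `ℝ e^{± iπ/4}`. If `ζ` is not real, the last two coordinates determine
`x`; since `Φ` is odd under `(x, y) ↦ (x, -y)`, a double point lies over a zero of `Φ` with `y ≠ 0`, so
over `x = ± s` (`ncard_selfIntersectionPoints`).

**Symmetries.** At the end `Φ` has a pole of order three and `x` one of order two, so the plane of the
first two coordinates is the asymptotic plane of the surface. A Lorentz transformation preserving the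
surface therefore preserves this plane and its orthogonal complement (`block_structure`). For nonreal
`ζ` it acts affinely on the `x`-plane, preserving the quadratic form of the complement and the set of
zeros of `Φ`; for real `ζ` it acts on `Re x`, and the lines `ℝ e^{± iπ/4}` together with a point over
`x = 1 / 2` determine the action on `Φ`. In both cases the action on the surface is one of the eight
maps generated by `(x, y) ↦ (-x, i y)` and complex conjugation (`classify`), and these are realized by
Lorentz transformations satisfying the dihedral relations.
-/


noncomputable section

namespace ChenGackstatter

open Complex PeriodPair

/-! ### The Weierstrass function of the square lattice -/

/-- The square lattice `ℤ + ℤ i`, as a pair of periods. -/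
def sqL : PeriodPair where
  ω₁ := 1
  ω₂ := I
  indep := by
    rw [LinearIndependent.pair_iff]
    intro s t h
    have h1 := congrArg Complex.re h
    have h2 := congrArg Complex.im h
    simp at h1 h2
    exact ⟨h1, h2⟩

lemma mem_sqL {z : ℂ} : z ∈ sqL.lattice ↔ InSquareLattice z := by
  rw [mem_lattice]
  simp only [sqL, InSquareLattice, mul_one]
  exact ⟨fun ⟨m, n, h⟩ => ⟨m, n, h.symm⟩, fun ⟨m, n, h⟩ => ⟨m, n, h.symm⟩⟩

lemma one_mem_sqL : (1 : ℂ) ∈ sqL.lattice := sqL.ω₁_mem_lattice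

lemma I_mem_sqL : I ∈ sqL.lattice := sqL.ω₂_mem_lattice

lemma I_mul_mem {z : ℂ} (h : z ∈ sqL.lattice) : I * z ∈ sqL.lattice := by
  rw [mem_sqL] at *
  obtain ⟨m, n, rfl⟩ := h
  refine ⟨-n, m, ?_⟩
  push_cast
  linear_combination (n : ℂ) * I_mul_I

lemma I_mul_mem_iff {z : ℂ} : I * z ∈ sqL.lattice ↔ z ∈ sqL.lattice := by
  refine ⟨fun h => ?_, I_mul_mem⟩
  have := neg_mem (I_mul_mem h)
  rwa [← mul_assoc, I_mul_I, neg_one_mul, neg_neg] at this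

/-- Multiplication by `i` as a permutation of the lattice. -/
def rotL : sqL.lattice ≃ sqL.lattice where
  toFun l := ⟨I * l, I_mul_mem l.2⟩
  invFun l := ⟨-(I * l), neg_mem (I_mul_mem l.2)⟩
  left_inv l := by
    ext
    simp only
    linear_combination (-(l : ℂ)) * I_mul_I
  right_inv l := by
    ext
    simp only
    linear_combination (-(l : ℂ)) * I_mul_I

@[simp] lemma coe_rotL (l : sqL.lattice) : (rotL l : ℂ) = I * l := rfl

lemma wp_I_mul (z : ℂ) : sqL.weierstrassP (I * z) = -sqL.weierstrassP z := by
  rw [weierstrassP, weierstrassP, ← rotL.tsum_eq, ← tsum_neg]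
  congr with l
  simp only [coe_rotL, ← mul_sub, mul_pow, I_sq, neg_one_mul, div_neg, neg_sub_neg, neg_sub]

lemma dwp_I_mul (z : ℂ) : sqL.derivWeierstrassP (I * z) = I * sqL.derivWeierstrassP z := by
  rw [derivWeierstrassP, derivWeierstrassP, ← rotL.tsum_eq, mul_neg, ← tsum_mul_left]
  congr with l
  simp only [coe_rotL, ← mul_sub, mul_pow, I_pow_three]
  rw [neg_mul, div_neg, div_mul_eq_div_div, ← neg_div, ← mul_div_assoc]
  congr 1
  rw [div_I]
  ring

lemma g₃_sqL : sqL.g₃ = 0 := by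
  have h : sqL.G 6 = -sqL.G 6 := by
    conv_lhs => rw [PeriodPair.G, ← rotL.tsum_eq]
    rw [PeriodPair.G, ← tsum_neg]
    congr with l
    have h6 : I ^ 6 = -1 := by
      rw [show (6 : ℕ) = 4 + 2 from rfl, pow_add, I_pow_four, I_sq, one_mul]
    simp only [coe_rotL, mul_pow, h6, neg_one_mul, inv_neg]
  have : sqL.G 6 = 0 := by
    rwa [CharZero.eq_neg_self_iff] at h
  rw [PeriodPair.g₃, this, mul_zero]

lemma countable_lattice : (sqL.lattice : Set ℂ).Countable := by
  have : Countable sqL.lattice := sqL.latticeEquivProd.toEquiv.countable_iff.2 inferInstance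
  exact Set.to_countable _

lemma isPreconnected_compl_countable {s : Set ℂ} (hs : s.Countable) : IsPreconnected sᶜ :=
  (hs.isPathConnected_compl_of_one_lt_rank (by simp)).isConnected.isPreconnected

lemma isOpen_compl_lattice : IsOpen (sqL.lattice : Set ℂ)ᶜ := sqL.isClosed_lattice.isOpen_compl

lemma hasDerivAt_wp {z : ℂ} (hz : z ∉ sqL.lattice) :
    HasDerivAt sqL.weierstrassP (sqL.derivWeierstrassP z) z := by
  rw [← sqL.deriv_weierstrassP]
  exact (sqL.analyticOnNhd_weierstrassP z hz).differentiableAt.hasDerivAt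

lemma wp_sq {z : ℂ} (hz : z ∉ sqL.lattice) : sqL.derivWeierstrassP z ^ 2 =
    4 * sqL.weierstrassP z ^ 3 - sqL.g₂ * sqL.weierstrassP z := by
  rw [sqL.derivWeierstrassP_sq z hz, g₃_sqL, sub_zero]

lemma tendsto_sq_mul_wp : Tendsto (fun z => z ^ 2 * sqL.weierstrassP z) (𝓝[≠] 0) (𝓝 1) := by
  have h1 : ContinuousAt (sqL.weierstrassPExcept 0) 0 :=
    (sqL.analyticAt_weierstrassPExcept 0).continuousAt
  have h2 : Tendsto (fun z : ℂ => z ^ 2 * sqL.weierstrassPExcept 0 z + 1) (𝓝 0) (𝓝 1) := by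
    have : ContinuousAt (fun z : ℂ => z ^ 2 * sqL.weierstrassPExcept 0 z + 1) 0 := by fun_prop
    simpa [ContinuousAt] using this
  refine (h2.mono_left nhdsWithin_le_nhds).congr' ?_
  filter_upwards [self_mem_nhdsWithin] with z hz
  have := sqL.ite_eq_one_sub_sq_mul_weierstrassP 0 (zero_mem _) z
  have hz' : z ≠ 0 := hz
  rw [if_neg hz'] at this
  simpa using this.symm

lemma tendsto_cube_mul_dwp :
    Tendsto (fun z => z ^ 3 * sqL.derivWeierstrassP z) (𝓝[≠] 0) (𝓝 (-2)) := by
  have h1 : ContinuousAt (sqL.derivWeierstrassPExcept 0) 0 :=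
    (sqL.analyticAt_derivWeierstrassPExcept 0).continuousAt
  have h2 : Tendsto (fun z : ℂ => z ^ 3 * sqL.derivWeierstrassPExcept 0 z - 2) (𝓝 0) (𝓝 (-2)) := by
    have : ContinuousAt (fun z : ℂ => z ^ 3 * sqL.derivWeierstrassPExcept 0 z - 2) 0 := by fun_prop
    simpa [ContinuousAt] using this
  refine (h2.mono_left nhdsWithin_le_nhds).congr' ?_
  filter_upwards [self_mem_nhdsWithin] with z hz
  have hz' : z ≠ 0 := hz
  have := sqL.derivWeierstrassPExcept_def 0 z
  simp only [ZeroMemClass.coe_zero, sub_zero] at this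
  rw [this]
  field_simp
  ring

lemma tendsto_norm_wp : Tendsto (fun z => ‖sqL.weierstrassP z‖) (𝓝[≠] 0) atTop := by
  have h1 : Tendsto (fun z : ℂ => ‖z ^ 2‖⁻¹) (𝓝[≠] 0) atTop := by
    have h0 : Tendsto (fun z : ℂ => ‖z ^ 2‖) (𝓝[≠] 0) (𝓝[>] 0) := by
      refine tendsto_nhdsWithin_iff.2 ⟨?_, ?_⟩
      · have : ContinuousAt (fun z : ℂ => ‖z ^ 2‖) 0 := by fun_prop
        simpa [ContinuousAt] using this.tendsto.mono_left (nhdsWithin_le_nhds (s := {0}ᶜ))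
      · filter_upwards [self_mem_nhdsWithin] with z hz
        have hz' : z ≠ 0 := hz
        have : 0 < ‖z ^ 2‖ := norm_pos_iff.2 (pow_ne_zero 2 hz')
        exact this
    exact h0.inv_tendsto_nhdsGT_zero
  have h2 := h1.atTop_mul_pos (C := 1) one_pos (by simpa using tendsto_sq_mul_wp.norm)
  refine h2.congr' ?_
  filter_upwards [self_mem_nhdsWithin] with z hz
  have hz' : ‖z‖ ≠ 0 := norm_ne_zero_iff.2 hz
  simp only [norm_pow]
  field_simp

lemma eventually_notMem_lattice : ∀ᶠ z in 𝓝[≠] (0 : ℂ), z ∉ sqL.lattice := by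
  filter_upwards [nhdsWithin_le_nhds (sqL.compl_lattice_sdiff_singleton_mem_nhds 0), self_mem_nhdsWithin] with z h1 h2 h3
  exact h1 ⟨h3, h2⟩

lemma half_notMem : (1 / 2 : ℂ) ∉ sqL.lattice := by
  simpa [sqL] using sqL.ω₁_div_two_notMem_lattice

lemma dwp_not_identically_zero : ¬ ∀ z ∈ (sqL.lattice : Set ℂ)ᶜ, sqL.derivWeierstrassP z = 0 := by
  intro h
  have : ∀ z ∉ sqL.lattice, sqL.weierstrassP z = sqL.weierstrassP (1 / 2) := by
    intro z hz
    refine isOpen_compl_lattice.is_const_of_deriv_eq_zero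
      (isPreconnected_compl_countable countable_lattice) sqL.differentiableOn_weierstrassP
      ?_ hz half_notMem
    intro w hw
    rw [sqL.deriv_weierstrassP]
    exact h w hw
  have h3 : ∀ᶠ z in 𝓝[≠] (0 : ℂ), ‖sqL.weierstrassP (1 / 2)‖ < ‖sqL.weierstrassP z‖ :=
    tendsto_norm_wp.eventually_gt_atTop _
  obtain ⟨z, h4, h5⟩ := (h3.and eventually_notMem_lattice).exists
  rw [this z h5] at h4
  exact lt_irrefl _ h4

/-- The second order equation `℘'' = 6 ℘² - g₂ / 2`. -/
lemma hasDerivAt_dwp {z : ℂ} (hz : z ∉ sqL.lattice) :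
    HasDerivAt sqL.derivWeierstrassP (6 * sqL.weierstrassP z ^ 2 - sqL.g₂ / 2) z := by
  have han := sqL.analyticOnNhd_derivWeierstrassP
  have hP := sqL.analyticOnNhd_weierstrassP
  have key := AnalyticOnNhd.eq_zero_or_eq_zero_of_mul_eq_zero (f := sqL.derivWeierstrassP)
    (g := fun z => deriv sqL.derivWeierstrassP z - (6 * sqL.weierstrassP z ^ 2 - sqL.g₂ / 2))
    han ?_ ?_ (isPreconnected_compl_countable countable_lattice)
  · rcases key with h | h
    · exact absurd h dwp_not_identically_zero
    · rw [← sub_eq_zero.1 (h z hz)]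
      exact (han z hz).differentiableAt.hasDerivAt
  · intro w hw
    have := hP w hw
    have := (han w hw).deriv
    fun_prop
  · intro w hw
    have h1 := (han w hw).differentiableAt.hasDerivAt.pow 2
    have h2 := (((hasDerivAt_wp hw).pow 3).const_mul 4).sub ((hasDerivAt_wp hw).const_mul sqL.g₂)
    have h3 := h1.unique (h2.congr_of_eventuallyEq ?_)
    · simp only [Nat.cast_ofNat, Nat.reduceSub, pow_one] at h3
      linear_combination (1 / 2 : ℂ) * h3
    · filter_upwards [isOpen_compl_lattice.mem_nhds hw] with u hu
      simpa using wp_sq hu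

/-- `(℘, ℘')` separates points modulo the lattice. Both `t ↦ (℘, ℘') (z + t)` and
`t ↦ (℘, ℘') (w + t)` solve the same differential equation, so that `℘` has the period `z - w` as
soon as they agree at `t = 0`; and periods of `℘` are poles. -/
lemma wp_injective {z w : ℂ} (hz : z ∉ sqL.lattice) (hw : w ∉ sqL.lattice)
    (h1 : sqL.weierstrassP z = sqL.weierstrassP w)
    (h2 : sqL.derivWeierstrassP z = sqL.derivWeierstrassP w) : z - w ∈ sqL.lattice := by
  by_contra hd
  set v : ℂ × ℂ → ℂ × ℂ := fun p => (p.2, 6 * p.1 ^ 2 - sqL.g₂ / 2) with hv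
  have hsol : ∀ u : ℂ, u ∉ sqL.lattice → ∀ᶠ t : ℝ in 𝓝 0,
      HasDerivAt (fun t : ℝ => (sqL.weierstrassP (u + t), sqL.derivWeierstrassP (u + t)))
        (v (sqL.weierstrassP (u + t), sqL.derivWeierstrassP (u + t))) t := by
    intro u hu
    have hc : ContinuousAt (fun t : ℝ => u + (t : ℂ)) 0 := by fun_prop
    have : ∀ᶠ t : ℝ in 𝓝 0, u + (t : ℂ) ∉ sqL.lattice :=
      hc.preimage_mem_nhds (isOpen_compl_lattice.mem_nhds (by simpa using hu))
    filter_upwards [this] with t ht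
    have hlin : HasDerivAt (fun t : ℝ => u + (t : ℂ)) 1 t := by
      simpa using (ofRealCLM.hasDerivAt (x := t)).const_add u
    have e1 := (hasDerivAt_wp ht).comp_of_eq t hlin rfl
    have e2 := (hasDerivAt_dwp ht).comp_of_eq t hlin rfl
    simp only [mul_one] at e1 e2
    exact e1.prodMk e2
  have hvC : ContDiffAt ℝ 1 v (sqL.weierstrassP w, sqL.derivWeierstrassP w) := by
    fun_prop
  obtain ⟨K, s, hs, hK⟩ := hvC.exists_lipschitzOnWith
  have hmem : ∀ u : ℂ, u ∉ sqL.lattice → sqL.weierstrassP u = sqL.weierstrassP w →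
      sqL.derivWeierstrassP u = sqL.derivWeierstrassP w → ∀ᶠ t : ℝ in 𝓝 0,
      (sqL.weierstrassP (u + t), sqL.derivWeierstrassP (u + t)) ∈ s := by
    intro u hu e1 e2
    have := (hsol u hu).self_of_nhds.continuousAt
    refine this.preimage_mem_nhds ?_
    simpa [e1, e2] using hs
  have huniq := ODE_solution_unique_of_eventually (v := fun _ => v) (s := fun _ => s) (t₀ := 0)
    (Eventually.of_forall fun _ => hK) ((hsol z hz).and (hmem z hz h1 h2))
    ((hsol w hw).and (hmem w hw rfl rfl)) (by simp [h1, h2])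
  set d := z - w with hd'
  set U : Set ℂ := ((sqL.lattice : Set ℂ) ∪ (fun u => u + d) ⁻¹' (sqL.lattice : Set ℂ))ᶜ with hU
  have hcount : ((sqL.lattice : Set ℂ) ∪ (fun u => u + d) ⁻¹' (sqL.lattice : Set ℂ)).Countable :=
    countable_lattice.union (countable_lattice.preimage (add_left_injective d))
  have hwU : w ∈ U := by
    simp only [hU, Set.mem_compl_iff, Set.mem_union, Set.mem_preimage, not_or]
    refine ⟨hw, ?_⟩
    simpa [hd'] using hz
  have heq : Set.EqOn (fun u => sqL.weierstrassP (u + d)) sqL.weierstrassP U := by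
    refine AnalyticOnNhd.eqOn_of_preconnected_of_frequently_eq ?_ ?_
      (isPreconnected_compl_countable hcount) hwU ?_
    · intro u hu
      simp only [hU, Set.mem_compl_iff, Set.mem_union, Set.mem_preimage, not_or] at hu
      exact (sqL.analyticOnNhd_weierstrassP (u + d) hu.2).comp_of_eq
        (g := sqL.weierstrassP) (f := fun u => u + d) (by fun_prop) rfl
    · intro u hu
      simp only [hU, Set.mem_compl_iff, Set.mem_union, Set.mem_preimage, not_or] at hu
      exact sqL.analyticOnNhd_weierstrassP u hu.1
    · have htend : Tendsto (fun t : ℝ => w + (t : ℂ)) (𝓝[≠] 0) (𝓝[≠] w) := by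
        refine tendsto_nhdsWithin_iff.2 ⟨?_, ?_⟩
        · have : ContinuousAt (fun t : ℝ => w + (t : ℂ)) 0 := by fun_prop
          simpa [ContinuousAt] using this.tendsto.mono_left (nhdsWithin_le_nhds (s := {0}ᶜ))
        · filter_upwards [self_mem_nhdsWithin] with t ht
          have : t ≠ 0 := ht
          simpa using this
      refine htend.frequently ?_
      refine Eventually.frequently ?_
      filter_upwards [mem_nhdsWithin_of_mem_nhds huniq] with t ht
      have := congrArg Prod.fst ht
      simp only at this
      rw [← this, hd']
      congr 1
      ring
  have hbd : ContinuousAt (fun u => ‖sqL.weierstrassP (u + d)‖) 0 := by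
    have : ContinuousAt sqL.weierstrassP (0 + d) :=
      (hasDerivAt_wp (by simpa using hd)).continuousAt
    exact (ContinuousAt.comp (f := fun u => u + d) this (by fun_prop)).norm
  have hbd' : ∀ᶠ u in 𝓝[≠] (0 : ℂ), ‖sqL.weierstrassP (u + d)‖ < ‖sqL.weierstrassP (0 + d)‖ + 1 :=
    nhdsWithin_le_nhds (hbd.eventually_lt continuousAt_const (lt_add_one _))
  have hnear : ∀ᶠ u in 𝓝[≠] (0 : ℂ), u + d ∉ sqL.lattice := by
    refine nhdsWithin_le_nhds ?_
    have hc : ContinuousAt (fun u : ℂ => u + d) 0 := by fun_prop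
    exact hc.preimage_mem_nhds (isOpen_compl_lattice.mem_nhds (by simpa using hd))
  obtain ⟨u, hu1, hu2, hu3, hu4⟩ := (hbd'.and (hnear.and (eventually_notMem_lattice.and
    (tendsto_norm_wp.eventually_gt_atTop (‖sqL.weierstrassP (0 + d)‖ + 1))))).exists
  have : u ∈ U := by
    simp only [hU, Set.mem_compl_iff, Set.mem_union, Set.mem_preimage, not_or]
    exact ⟨hu3, hu2⟩
  have := heq this
  simp only at this
  rw [this] at hu1
  linarith

/-- `℘` takes every value: otherwise `1 / (℘ - a)` would be a bounded entire function that vanishes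
at the lattice points. -/
lemma wp_surjective (a : ℂ) : ∃ z, z ∉ sqL.lattice ∧ sqL.weierstrassP z = a := by
  classical
  by_contra! hne
  set h : ℂ → ℂ := fun z => if z ∈ sqL.lattice then 0 else (sqL.weierstrassP z - a)⁻¹ with hh
  have hper : ∀ z w, w ∈ sqL.lattice → h (z + w) = h z := by
    intro z w hw
    have e1 : z + w ∈ sqL.lattice ↔ z ∈ sqL.lattice :=
      ⟨fun h => by simpa using sub_mem h hw, fun h => add_mem h hw⟩
    have e2 : sqL.weierstrassP (z + w) = sqL.weierstrassP z := sqL.weierstrassP_add_coe z ⟨w, hw⟩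
    simp only [hh, e1, e2]
  have hout : ∀ z, z ∉ sqL.lattice → DifferentiableAt ℂ h z := by
    intro z hz
    have : DifferentiableAt ℂ (fun z => (sqL.weierstrassP z - a)⁻¹) z :=
      ((hasDerivAt_wp hz).differentiableAt.sub_const a).inv (sub_ne_zero.2 (hne z hz))
    refine this.congr_of_eventuallyEq ?_
    filter_upwards [isOpen_compl_lattice.mem_nhds hz] with u hu
    simp only [hh]
    exact if_neg hu
  have h0 : DifferentiableAt ℂ h 0 := by
    have hn : (sqL.lattice : Set ℂ)ᶜ ∪ {0} ∈ 𝓝 (0 : ℂ) := by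
      filter_upwards [sqL.compl_lattice_sdiff_singleton_mem_nhds 0] with u hu
      by_cases h : u = 0
      · right; exact h
      · left; exact fun h' => hu ⟨h', h⟩
    have hcont : ContinuousAt h 0 := by
      rw [continuousAt_iff_punctured_nhds]
      have e0 : h 0 = 0 := by simp [hh]
      rw [e0]
      have t1 : Tendsto (fun z => ‖sqL.weierstrassP z - a‖) (𝓝[≠] 0) atTop := by
        refine tendsto_atTop_mono (fun z => norm_sub_norm_le _ _) ?_
        exact tendsto_atTop_add_const_right _ _ tendsto_norm_wp
      have t2 := tendsto_inv_atTop_zero.comp t1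
      rw [tendsto_zero_iff_norm_tendsto_zero]
      refine t2.congr' ?_
      filter_upwards [eventually_notMem_lattice] with z hz
      simp [hh, hz]
    have hdiff : DifferentiableOn ℂ h (((sqL.lattice : Set ℂ)ᶜ ∪ {0}) \ {0}) := by
      intro z hz
      refine (hout z ?_).differentiableWithinAt
      rcases hz with ⟨h1 | h1, h2⟩
      · exact h1
      · exact absurd h1 h2
    exact ((Complex.differentiableOn_compl_singleton_and_continuousAt_iff hn).1
      ⟨hdiff, hcont⟩).differentiableAt hn
  have hall : Differentiable ℂ h := by
    intro z
    by_cases hz : z ∈ sqL.lattice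
    · have : h = fun u => h (u - z) := by
        ext u
        have := hper (u - z) z hz
        rw [sub_add_cancel] at this
        exact this
      rw [this]
      have hs : DifferentiableAt ℂ (fun u : ℂ => u - z) z := by fun_prop
      exact DifferentiableAt.comp z (g := h) (f := fun u => u - z) (by simpa using h0) hs
    · exact hout z hz
  have hb := (IsZLattice.isCompact_range_of_periodic sqL.lattice h hall.continuous hper).isBounded
  have := hall.apply_eq_apply_of_bounded hb (1 / 2) 0
  simp only [hh, half_notMem, if_false, zero_mem, if_true, inv_eq_zero] at this
  exact hne _ half_notMem (sub_eq_zero.1 this)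

lemma I_half_notMem : (I / 2 : ℂ) ∉ sqL.lattice := by
  simpa [sqL] using sqL.ω₂_div_two_notMem_lattice

lemma mid_notMem : ((1 + I) / 2 : ℂ) ∉ sqL.lattice := by
  intro h
  have h2 := I_mul_mem h
  rw [mem_sqL] at h
  obtain ⟨m, n, h⟩ := h
  have := congrArg Complex.re h
  simp at this
  have h3 : (1 : ℝ) = ((2 * m : ℤ) : ℝ) := by push_cast; linarith
  have h4 : (1 : ℤ) = 2 * m := by exact_mod_cast h3
  omega

lemma dwp_half {z : ℂ} (hz : 2 * z ∈ sqL.lattice) : sqL.derivWeierstrassP z = 0 := by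
  have h1 := sqL.derivWeierstrassP_add_coe (-z) ⟨2 * z, hz⟩
  rw [sqL.derivWeierstrassP_neg, show -z + ((⟨2 * z, hz⟩ : sqL.lattice) : ℂ) = z by simp; ring] at h1
  exact CharZero.eq_neg_self_iff.1 h1

lemma wp_mid : sqL.weierstrassP ((1 + I) / 2) = 0 := by
  have h1 := wp_I_mul ((1 + I) / 2)
  have h2 := sqL.weierstrassP_sub_coe ((1 + I) / 2) ⟨1, one_mem_sqL⟩
  have e : I * ((1 + I) / 2) = (1 + I) / 2 - 1 := by
    linear_combination (1 / 2 : ℂ) * I_mul_I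
  rw [e, h2] at h1
  exact CharZero.eq_neg_self_iff.1 h1

/-- The value `e₁ = ℘ (1 / 2)`. -/
def eOne : ℂ := sqL.weierstrassP (1 / 2)

/-- If `e₁` vanished, the half periods `1 / 2` and `(1 + i) / 2` would not be separated by
`(℘, ℘')`. -/
lemma eOne_ne_zero : eOne ≠ 0 := by
  intro h
  have h1 : (1 / 2 : ℂ) - (1 + I) / 2 ∈ sqL.lattice := by
    refine wp_injective half_notMem mid_notMem ?_ ?_
    · rw [wp_mid]; exact h
    · rw [dwp_half, dwp_half]
      · simpa [mul_div_cancel₀] using add_mem one_mem_sqL I_mem_sqL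
      · simp [one_mem_sqL]
  refine I_half_notMem ?_
  have := neg_mem h1
  convert this using 1
  ring

lemma g₂_eq : sqL.g₂ = 4 * eOne ^ 2 := by
  have h := wp_sq half_notMem
  rw [dwp_half (by simpa using one_mem_sqL)] at h
  change _ = 4 * eOne ^ 3 - sqL.g₂ * eOne at h
  have h2 : eOne * (4 * eOne ^ 2 - sqL.g₂) = 0 := by linear_combination -h
  rcases mul_eq_zero.1 h2 with h3 | h3
  · exact absurd h3 eOne_ne_zero
  · linear_combination -h3

/-! ### The uniformization of the curve -/

/-- The scaling factor `k = 2 √e₁`, so that `dx = k y dz`. -/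
def kC : ℂ := 2 * eOne ^ (1 / 2 : ℂ)

lemma kC_sq : kC ^ 2 = 4 * eOne := by
  have : (eOne ^ (1 / 2 : ℂ)) ^ 2 = eOne := by
    simp
  rw [kC, mul_pow, this]
  norm_num

lemma kC_ne_zero : kC ≠ 0 := by
  intro h
  have := kC_sq
  rw [h] at this
  have h2 : eOne = 0 := by linear_combination -(1 / 4 : ℂ) * this
  exact eOne_ne_zero h2

/-- The function `x` on the universal cover of the curve. -/
def xq (z : ℂ) : ℂ := 4 * sqL.weierstrassP z / kC ^ 2

/-- The function `y` on the universal cover of the curve. -/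
def yq (z : ℂ) : ℂ := 4 * sqL.derivWeierstrassP z / kC ^ 3

lemma curve_eq (z : ℂ) : yq z ^ 2 = xq z * (xq z - 1) * (xq z + 1) := by
  by_cases hz : z ∈ sqL.lattice
  · have h1 : sqL.weierstrassP z = 0 := sqL.weierstrassP_coe ⟨z, hz⟩
    have h2 : sqL.derivWeierstrassP z = 0 := sqL.derivWeierstrassP_coe ⟨z, hz⟩
    simp [xq, yq, h1, h2]
  · have h := wp_sq hz
    have hk := kC_ne_zero
    have h4 : sqL.g₂ = kC ^ 4 / 4 := by
      rw [g₂_eq]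
      linear_combination (-(1 / 4 : ℂ) * (kC ^ 2 + 4 * eOne)) * kC_sq
    rw [h4] at h
    rw [xq, yq]
    field_simp
    linear_combination 4 * h

/-- The uniformization `z ↦ (x, y)` of the curve by `ℂ` minus the square lattice. Its value at
lattice points is the junk value `(0, 0)`. -/
def qC (z : ℂ) : CGCurve := ⟨(xq z, yq z), curve_eq z⟩

lemma hasDerivAt_xq {z : ℂ} (hz : z ∉ sqL.lattice) : HasDerivAt xq (kC * yq z) z := by
  have : HasDerivAt xq _ z := ((hasDerivAt_wp hz).const_mul 4).div_const (kC ^ 2)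
  convert this using 1
  have hk := kC_ne_zero
  simp only [yq]
  field_simp

lemma hasDerivAt_yq {z : ℂ} (hz : z ∉ sqL.lattice) :
    HasDerivAt yq (kC / 2 * (3 * xq z ^ 2 - 1)) z := by
  have : HasDerivAt yq _ z := ((hasDerivAt_dwp hz).const_mul 4).div_const (kC ^ 3)
  convert this using 1
  have hk := kC_ne_zero
  have h4 : sqL.g₂ = kC ^ 4 / 4 := by
    rw [g₂_eq]
    linear_combination (-(1 / 4 : ℂ) * (kC ^ 2 + 4 * eOne)) * kC_sq
  simp only [xq, h4]
  field_simp
  ring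

lemma hasDerivAt_qC {z : ℂ} (hz : z ∉ sqL.lattice) : HasDerivAt (fun z => (qC z : ℂ × ℂ))
    (kC * yq z, kC / 2 * (3 * xq z ^ 2 - 1)) z :=
  (hasDerivAt_xq hz).prodMk (hasDerivAt_yq hz)

lemma continuousAt_qC {z : ℂ} (hz : z ∉ sqL.lattice) : ContinuousAt qC z :=
  Topology.IsInducing.subtypeVal.continuousAt_iff.2 (hasDerivAt_qC hz).continuousAt

lemma qC_add {z l : ℂ} (hl : l ∈ sqL.lattice) : qC (z + l) = qC z := by
  have h1 : sqL.weierstrassP (z + l) = _ := sqL.weierstrassP_add_coe z ⟨l, hl⟩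
  have h2 : sqL.derivWeierstrassP (z + l) = _ := sqL.derivWeierstrassP_add_coe z ⟨l, hl⟩
  refine Subtype.ext ?_
  simp only [qC, xq, yq, h1, h2]

lemma qC_eq_iff {z w : ℂ} (hz : z ∉ sqL.lattice) (hw : w ∉ sqL.lattice) :
    qC z = qC w ↔ z - w ∈ sqL.lattice := by
  refine ⟨fun h => ?_, fun h => ?_⟩
  · have h1 := congrArg (fun p : CGCurve => (p : ℂ × ℂ).1) h
    have h2 := congrArg (fun p : CGCurve => (p : ℂ × ℂ).2) h
    have hk := kC_ne_zero
    simp only [qC, xq, yq] at h1 h2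
    refine wp_injective hz hw ?_ ?_
    · field_simp at h1
      exact h1
    · field_simp at h2
      exact h2
  · rw [← qC_add (z := w) h, add_sub_cancel]

lemma qC_surjective (p : CGCurve) : ∃ z, z ∉ sqL.lattice ∧ qC z = p := by
  obtain ⟨z, hz, h⟩ := wp_surjective (kC ^ 2 * (p : ℂ × ℂ).1 / 4)
  have hk := kC_ne_zero
  have hx : xq z = (p : ℂ × ℂ).1 := by
    rw [xq, h]
    field_simp
  have hy : yq z ^ 2 = (p : ℂ × ℂ).2 ^ 2 := by
    rw [curve_eq, hx, p.2]
  rcases sq_eq_sq_iff_eq_or_eq_neg.1 hy with h1 | h1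
  · exact ⟨z, hz, Subtype.ext (Prod.ext hx h1)⟩
  · refine ⟨-z, fun h => hz (by simpa using neg_mem h), Subtype.ext (Prod.ext ?_ ?_)⟩
    · change xq (-z) = _
      rw [← hx, xq, xq, sqL.weierstrassP_neg]
    · change yq (-z) = _
      rw [← neg_eq_iff_eq_neg] at h1
      rw [← h1, yq, yq, sqL.derivWeierstrassP_neg]
      ring

/-! ### The end of the curve -/

lemma isClosed_curve : IsClosed {p : ℂ × ℂ | p.2 ^ 2 = p.1 * (p.1 - 1) * (p.1 + 1)} :=
  isClosed_eq (by fun_prop) (by fun_prop)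

/-- The end of the curve is where `x` becomes infinite. -/
lemma cocompact_curve :
    cocompact CGCurve = comap (fun p : CGCurve => ‖(p : ℂ × ℂ).1‖) atTop := by
  have hcl : IsClosedEmbedding (Subtype.val : CGCurve → ℂ × ℂ) :=
    isClosed_curve.isClosedEmbedding_subtypeVal
  apply le_antisymm
  · rw [← tendsto_iff_comap, tendsto_atTop]
    intro R
    have hK : IsCompact {p : CGCurve | ‖(p : ℂ × ℂ).1‖ ≤ R} := by
      have hb : {p : CGCurve | ‖(p : ℂ × ℂ).1‖ ≤ R} ⊆ Subtype.val ⁻¹'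
          (Metric.closedBall (0 : ℂ) R ×ˢ Metric.closedBall (0 : ℂ) (R * (R + 1) * (R + 1) + 1)) := by
        intro p hp
        have hp' : ‖(p : ℂ × ℂ).1‖ ≤ R := hp
        have h0 : 0 ≤ R := (norm_nonneg _).trans hp'
        have h1 : ‖(p : ℂ × ℂ).2‖ ^ 2 ≤ R * (R + 1) * (R + 1) := by
          rw [← norm_pow, p.2, norm_mul, norm_mul]
          gcongr
          · exact (norm_sub_le _ _).trans (by simpa using hp')
          · exact (norm_add_le _ _).trans (by simpa using hp')
        refine ⟨by simpa using hp', ?_⟩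
        simp only [mem_closedBall_zero_iff]
        nlinarith [norm_nonneg (p : ℂ × ℂ).2]
      refine IsCompact.of_isClosed_subset (hcl.isCompact_preimage
        ((isCompact_closedBall _ _).prod (isCompact_closedBall _ _))) ?_ hb
      exact isClosed_le (by fun_prop) continuous_const
    filter_upwards [hK.compl_mem_cocompact] with p hp
    simp only [Set.mem_compl_iff, Set.mem_ofPred_eq, not_le] at hp
    exact hp.le
  · intro s hs
    obtain ⟨K, hK, hKs⟩ := mem_cocompact.1 hs
    obtain ⟨R, hR⟩ := (hK.image (f := fun p : CGCurve => ‖(p : ℂ × ℂ).1‖) (by fun_prop)).bddAbove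
    refine ⟨Set.Ioi R, Ioi_mem_atTop R, fun p hp => hKs fun hpK => ?_⟩
    exact not_lt.2 (hR ⟨p, hpK, rfl⟩) hp

lemma tendsto_norm_xq : Tendsto (fun z => ‖xq z‖) (𝓝[≠] 0) atTop := by
  have hk : 0 < ‖kC‖ := norm_pos_iff.2 kC_ne_zero
  have := tendsto_norm_wp.const_mul_atTop (r := 4 / ‖kC‖ ^ 2) (by positivity)
  refine this.congr fun z => ?_
  rw [xq]
  simp only [norm_div, norm_mul, norm_pow, Complex.norm_ofNat]
  ring

theorem curveIsPuncturedTorus : CurveIsPuncturedTorus := by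
  refine ⟨qC, ?_, ?_, ?_, ?_⟩
  · intro z hz
    rw [Set.mem_ofPred_eq, ← mem_sqL] at hz
    exact (hasDerivAt_qC hz).differentiableAt.differentiableWithinAt
  · intro z w hz hw
    rw [← mem_sqL] at *
    exact qC_eq_iff hz hw
  · intro p
    obtain ⟨z, hz, h⟩ := qC_surjective p
    exact ⟨z, fun h' => hz (mem_sqL.2 h'), h⟩
  · rw [cocompact_curve, tendsto_comap_iff]
    exact tendsto_norm_xq

end ChenGackstatter

end

noncomputable section

namespace ChenGackstatter

open Complex PeriodPair

/-! ### The Weierstrass zeta function of the square lattice -/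

/-- The summand of the Weierstrass zeta function. The summand for `l = 0` is `1 / z`, by the
convention `1 / 0 = 0`. -/
def wzTerm (z l : ℂ) : ℂ := 1 / (z - l) + 1 / l + z / l ^ 2

/-- The Weierstrass zeta function of the square lattice. -/
def wz (z : ℂ) : ℂ := ∑' l : sqL.lattice, wzTerm z l

lemma norm_wzTerm_le {r : ℝ} {z l : ℂ} (hl : l ≠ 0) (hz : ‖z‖ ≤ r) (h : 2 * r ≤ ‖l‖) :
    ‖wzTerm z l‖ ≤ 2 * r ^ 2 * ‖l‖ ^ (-3 : ℝ) := by
  have hl' : 0 < ‖l‖ := norm_pos_iff.2 hl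
  have h1 : ‖l‖ / 2 ≤ ‖z - l‖ := by
    rw [norm_sub_rev]
    exact le_trans (by linarith) (norm_sub_norm_le l z)
  have h0 : z - l ≠ 0 := by
    intro h0
    rw [h0, norm_zero] at h1
    linarith
  have h2 : wzTerm z l = z ^ 2 / (l ^ 2 * (z - l)) := by
    rw [wzTerm]
    field_simp
    ring
  rw [h2, norm_div, norm_mul, norm_pow, norm_pow]
  have h3 : ‖l‖ ^ (-3 : ℝ) = (‖l‖ ^ 3)⁻¹ := by
    rw [Real.rpow_neg hl'.le]
    norm_cast
  rw [h3]
  calc ‖z‖ ^ 2 / (‖l‖ ^ 2 * ‖z - l‖) ≤ r ^ 2 / (‖l‖ ^ 2 * (‖l‖ / 2)) := by gcongr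
    _ = _ := by field_simp

lemma summable_norm_lattice : Summable fun l : sqL.lattice => ‖(l : ℂ)‖ ^ (-3 : ℝ) :=
  ZLattice.summable_norm_rpow _ _ (by simp; norm_num)

lemma summable_wzTerm (z : ℂ) : Summable fun l : sqL.lattice => wzTerm z l := by
  refine (summable_norm_lattice.mul_left (2 * ‖z‖ ^ 2)).of_norm_bounded_eventually ?_
  refine (isCompact_iff_finite.mp (isCompact_closedBall (0 : sqL.lattice) (2 * ‖z‖))).subset ?_
  intro l hl
  simp only [Set.mem_compl_iff, Set.mem_ofPred_eq, not_le, mem_closedBall_zero_iff] at hl ⊢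
  contrapose! hl
  refine norm_wzTerm_le ?_ le_rfl (by simpa using hl.le)
  intro h0
  have : ‖l‖ = 0 := by simpa using h0
  linarith [norm_nonneg z]

lemma hasDerivAt_wz {z : ℂ} (hz : z ∉ sqL.lattice) :
    HasDerivAt wz (-sqL.weierstrassP z) z := by
  have hu : TendstoLocallyUniformlyOn
      (fun (s : Finset sqL.lattice) (z : ℂ) => -∑ l ∈ s, (1 / (z - l) ^ 2 - 1 / (l : ℂ) ^ 2))
      (fun z => -sqL.weierstrassP z) atTop (sqL.lattice : Set ℂ)ᶜ := by
    have h0 := sqL.hasSumLocallyUniformly_weierstrassP.tendstoLocallyUniformlyOn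
      (s := (sqL.lattice : Set ℂ)ᶜ)
    exact h0.neg
  refine hasDerivAt_of_tendstoLocallyUniformlyOn (𝕜 := ℂ) (l := atTop)
    (f := fun (s : Finset sqL.lattice) z => ∑ l ∈ s, wzTerm z l)
    (f' := fun (s : Finset sqL.lattice) (z : ℂ) => -∑ l ∈ s, (1 / (z - l) ^ 2 - 1 / (l : ℂ) ^ 2))
    (g' := fun z => -sqL.weierstrassP z) isOpen_compl_lattice hu ?_ ?_ hz
  · refine Eventually.of_forall fun s w hw => ?_
    rw [← Finset.sum_neg_distrib]
    refine HasDerivAt.fun_sum fun l _ => ?_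
    have hne : w - l ≠ 0 := fun h => hw (by rw [sub_eq_zero.1 h]; exact l.2)
    have h1 := ((((hasDerivAt_id w).sub_const (l : ℂ)).inv hne).add_const (1 / (l : ℂ))).add
      ((hasDerivAt_id w).div_const ((l : ℂ) ^ 2))
    have h2 : (fun z => wzTerm z l) = fun z => ((z - (l : ℂ))⁻¹ + 1 / l + z / l ^ 2) := by
      ext z
      rw [wzTerm, one_div (z - (l : ℂ))]
    rw [h2]
    refine HasDerivAt.congr_deriv (f := fun z => ((z - (l : ℂ))⁻¹ + 1 / l + z / l ^ 2)) h1 ?_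
    simp only [id]
    ring
  · intro w _
    exact (summable_wzTerm w).hasSum

lemma wz_neg (z : ℂ) : wz (-z) = -wz z := by
  rw [wz, wz, ← (Equiv.neg sqL.lattice).tsum_eq, ← tsum_neg]
  congr with l
  simp only [wzTerm, Equiv.neg_apply, NegMemClass.coe_neg, sub_neg_eq_add, neg_sq]
  rw [show -z + (l : ℂ) = -(z - l) by ring, div_neg, div_neg, neg_div]
  ring

lemma wz_I_mul (z : ℂ) : wz (I * z) = -I * wz z := by
  rw [wz, wz, ← rotL.tsum_eq, ← tsum_mul_left]
  congr with l
  simp only [wzTerm, coe_rotL, ← mul_sub, mul_pow, I_sq, neg_one_mul, div_neg]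
  rw [div_mul_eq_div_div, div_mul_eq_div_div, one_div I, inv_I, neg_div, neg_div]
  ring

/-- Nonzero lattice points have norm at least `1`. -/
lemma one_le_norm_of_mem {l : ℂ} (hl : l ∈ sqL.lattice) (h0 : l ≠ 0) : 1 ≤ ‖l‖ := by
  rw [mem_sqL] at hl
  obtain ⟨m, n, rfl⟩ := hl
  have h1 : ‖(m + n * I : ℂ)‖ ^ 2 = ((m ^ 2 + n ^ 2 : ℤ) : ℝ) := by
    rw [Complex.sq_norm, Complex.normSq_apply]
    simp
    ring
  have h2 : (1 : ℤ) ≤ m ^ 2 + n ^ 2 := by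
    by_contra! h
    have hm : m = 0 := by nlinarith [sq_nonneg m, sq_nonneg n]
    have hn : n = 0 := by nlinarith [sq_nonneg m, sq_nonneg n]
    simp [hm, hn] at h0
  have h3 : (1 : ℝ) ≤ ‖(m + n * I : ℂ)‖ ^ 2 := by
    rw [h1]
    exact_mod_cast h2
  nlinarith [norm_nonneg (m + n * I : ℂ)]

/-- Near the pole at `0` the zeta function differs from `1 / z` by a bounded function. -/
lemma exists_norm_wz_sub_le : ∃ C : ℝ, ∀ z : ℂ, ‖z‖ ≤ 1 / 2 → ‖wz z - 1 / z‖ ≤ C := by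
  classical
  refine ⟨∑' l : sqL.lattice, 2 * (1 / 2) ^ 2 * ‖(l : ℂ)‖ ^ (-3 : ℝ), fun z hz => ?_⟩
  rw [wz, (summable_wzTerm z).tsum_eq_add_tsum_ite 0]
  have : wzTerm z (0 : sqL.lattice) = 1 / z := by simp [wzTerm]
  rw [this, add_sub_cancel_left]
  refine tsum_of_norm_bounded (summable_norm_lattice.mul_left _).hasSum fun l => ?_
  split_ifs with h
  · rw [norm_zero]
    positivity
  · have hl : (l : ℂ) ≠ 0 := by simpa using h
    exact norm_wzTerm_le hl hz (by linarith [one_le_norm_of_mem l.2 hl])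

lemma tendsto_cube_mul_wz : Tendsto (fun z => z ^ 3 * wz z) (𝓝[≠] 0) (𝓝 0) := by
  obtain ⟨C, hC⟩ := exists_norm_wz_sub_le
  have h1 : Tendsto (fun z : ℂ => ‖z‖ ^ 2 + ‖z‖ ^ 3 * C) (𝓝[≠] 0) (𝓝 0) := by
    have : ContinuousAt (fun z : ℂ => ‖z‖ ^ 2 + ‖z‖ ^ 3 * C) 0 := by fun_prop
    simpa [ContinuousAt] using this.tendsto.mono_left (nhdsWithin_le_nhds (s := {0}ᶜ))
  refine squeeze_zero_norm' ?_ h1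
  have h2 : ∀ᶠ z : ℂ in 𝓝[≠] 0, ‖z‖ ≤ 1 / 2 := by
    refine nhdsWithin_le_nhds ?_
    filter_upwards [Metric.closedBall_mem_nhds (0 : ℂ) (by norm_num : (0 : ℝ) < 1 / 2)] with z hz
    simpa using hz
  filter_upwards [h2, self_mem_nhdsWithin] with z hz hz0
  have hz0' : z ≠ 0 := hz0
  have e : z ^ 3 * wz z = z ^ 2 + z ^ 3 * (wz z - 1 / z) := by
    field_simp
    ring
  rw [e]
  refine (norm_add_le _ _).trans ?_
  rw [norm_mul, norm_pow, norm_pow]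
  gcongr
  exact hC z hz

/-- The zeta function changes by a constant under a period. -/
lemma exists_wz_add {l : ℂ} (hl : l ∈ sqL.lattice) :
    ∃ c, ∀ z, z ∉ sqL.lattice → wz (z + l) = wz z + c := by
  have hadd : ∀ z, z ∉ sqL.lattice → z + l ∉ sqL.lattice := fun z hz h =>
    hz (by simpa using sub_mem h hl)
  refine ⟨wz (1 / 2 + l) - wz (1 / 2), fun z hz => ?_⟩
  have hd : ∀ z, z ∉ sqL.lattice → HasDerivAt (fun z => wz (z + l) - wz z) 0 z := by
    intro z hz
    have h1 := (hasDerivAt_wz (hadd z hz)).comp_add_const z l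
    have h2 := h1.sub (hasDerivAt_wz hz)
    have h3 : sqL.weierstrassP (z + l) = sqL.weierstrassP z := sqL.weierstrassP_add_coe z ⟨l, hl⟩
    rw [h3, sub_self] at h2
    exact h2
  have := isOpen_compl_lattice.is_const_of_deriv_eq_zero
    (isPreconnected_compl_countable countable_lattice)
    (fun w hw => (hd w hw).differentiableAt.differentiableWithinAt)
    (fun w hw => (hd w hw).deriv) (x := z) (y := 1 / 2) hz half_notMem
  linear_combination this

/-- The quasi-period of the zeta function for the period `1`. -/
def etaC : ℂ := (exists_wz_add one_mem_sqL).choose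

/-- By the symmetry `wz (i z) = -i wz z`, the quasi-period for the period `l` is `η conj l`. -/
lemma wz_add {z l : ℂ} (hz : z ∉ sqL.lattice) (hl : l ∈ sqL.lattice) :
    wz (z + l) = wz z + etaC * conj l := by
  let S : AddSubgroup ℂ :=
    { carrier := {l | l ∈ sqL.lattice ∧ ∀ z, z ∉ sqL.lattice → wz (z + l) = wz z + etaC * conj l}
      zero_mem' := ⟨zero_mem _, fun z _ => by simp⟩
      add_mem' := by
        rintro a b ⟨ha, ha'⟩ ⟨hb, hb'⟩
        refine ⟨add_mem ha hb, fun z hz => ?_⟩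
        rw [← add_assoc, hb' _ fun h => hz (by simpa using sub_mem h ha), ha' z hz, map_add]
        ring
      neg_mem' := by
        rintro a ⟨ha, ha'⟩
        refine ⟨neg_mem ha, fun z hz => ?_⟩
        have := ha' (z + -a) fun h => hz (by simpa using add_mem h ha)
        rw [neg_add_cancel_right] at this
        rw [this, map_neg]
        ring }
  have h1 : (1 : ℂ) ∈ S :=
    ⟨one_mem_sqL, fun z hz => by
      rw [map_one, mul_one]
      exact (exists_wz_add one_mem_sqL).choose_spec z hz⟩
  have hI : I ∈ S := by
    refine ⟨I_mem_sqL, fun z hz => ?_⟩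
    have hz' : I * (-z) ∉ sqL.lattice := fun h => hz (by simpa using I_mul_mem_iff.1 h)
    have h2 := h1.2 (-(I * z)) (by rwa [← mul_neg])
    have e1 : z + I = I * (-(I * z) + 1) := by linear_combination z * I_mul_I
    have e2 : z = I * (-(I * z)) := by linear_combination z * I_mul_I
    rw [e1, wz_I_mul, h2]
    conv_rhs => rw [e2, wz_I_mul]
    simp only [map_one, conj_I]
    ring
  have : l ∈ S := by
    rw [mem_sqL] at hl
    obtain ⟨m, n, rfl⟩ := hl
    have := add_mem (zsmul_mem h1 m) (zsmul_mem hI n)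
    simpa using this
  exact this.2 z hz

/-! ### Functions on the curve -/

/-- Local sections of the uniformization. They are restrictions of analytic functions of `(x, y)`,
because `x` or `y` is a local coordinate. -/
lemma exists_local_section {z₀ : ℂ} (h0 : z₀ ∉ sqL.lattice) :
    ∃ s : ℂ × ℂ → ℂ, AnalyticAt ℂ s (qC z₀) ∧ s (qC z₀) = z₀ ∧
      ∀ᶠ p : CGCurve in 𝓝 (qC z₀), s p ∉ sqL.lattice ∧ qC (s p) = p := by
  have hk := kC_ne_zero
  have hax : AnalyticAt ℂ xq z₀ := by
    have := sqL.analyticOnNhd_weierstrassP z₀ h0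
    unfold xq
    fun_prop (disch := simp [hk])
  have hay : AnalyticAt ℂ yq z₀ := by
    have := sqL.analyticOnNhd_derivWeierstrassP z₀ h0
    unfold yq
    fun_prop (disch := simp [hk])
  have hnear : ∀ s : ℂ × ℂ → ℂ, ContinuousAt s (qC z₀) → s (qC z₀) = z₀ →
      ∀ᶠ p : CGCurve in 𝓝 (qC z₀), s p ∉ sqL.lattice := by
    intro s hs hs0
    have : ContinuousAt (fun p : CGCurve => s p) (qC z₀) :=
      hs.comp (f := Subtype.val) continuous_subtype_val.continuousAt
    exact this.preimage_mem_nhds (isOpen_compl_lattice.mem_nhds (by simpa [hs0] using h0))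
  -- `y` is a local coordinate at its zeros, `x` elsewhere
  by_cases hy : yq z₀ = 0
  · have hd : deriv yq z₀ ≠ 0 := by
      rw [(hasDerivAt_yq h0).deriv]
      have h1 := curve_eq z₀
      rw [hy] at h1
      have h2 : xq z₀ = 0 ∨ xq z₀ = 1 ∨ xq z₀ = -1 := by
        have : xq z₀ * (xq z₀ - 1) * (xq z₀ + 1) = 0 := by rw [← h1]; ring
        rcases mul_eq_zero.1 this with h | h
        · rcases mul_eq_zero.1 h with h | h
          · exact Or.inl h
          · exact Or.inr (Or.inl (sub_eq_zero.1 h))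
        · exact Or.inr (Or.inr (eq_neg_of_add_eq_zero_left h))
      have h3 : 3 * xq z₀ ^ 2 - 1 ≠ 0 := by
        rcases h2 with h | h | h <;> rw [h] <;> norm_num
      exact mul_ne_zero (div_ne_zero hk two_ne_zero) h3
    set g := hay.hasStrictDerivAt.localInverse _ _ _ hd with hg
    have hga : AnalyticAt ℂ g (yq z₀) := hay.analyticAt_localInverse hd
    have hg0 : g (yq z₀) = z₀ := HasStrictFDerivAt.localInverse_apply_image ..
    have hs : AnalyticAt ℂ (fun p : ℂ × ℂ => g p.2) (qC z₀) :=
      hga.comp_of_eq (f := Prod.snd) analyticAt_snd rfl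
    refine ⟨fun p => g p.2, hs, hg0, (hnear _ hs.continuousAt hg0).and ?_⟩
    have c2 : ContinuousAt (fun p : CGCurve => (p : ℂ × ℂ).2) (qC z₀) := by fun_prop
    have c1 : ContinuousAt (fun p : CGCurve => (p : ℂ × ℂ).1) (qC z₀) := by fun_prop
    have e1 : ∀ᶠ p : CGCurve in 𝓝 (qC z₀), yq (g (p : ℂ × ℂ).2) = (p : ℂ × ℂ).2 :=
      c2.eventually (hay.hasStrictDerivAt.eventually_right_inverse hd)
    have hc : ContinuousAt (fun p : CGCurve => xq (g (p : ℂ × ℂ).2)) (qC z₀) := by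
      have h1 : ContinuousAt (fun p : CGCurve => g (p : ℂ × ℂ).2) (qC z₀) :=
        ContinuousAt.comp_of_eq (g := g) hga.continuousAt c2 rfl
      exact ContinuousAt.comp_of_eq (g := xq) hax.continuousAt h1 hg0
    -- `X ^ 3 - X = Y ^ 3 - Y` forces `X = Y` or `X ^ 2 + X Y + Y ^ 2 = 1`; the latter fails near
    -- a zero of `y`, where `3 x ^ 2 ≠ 1`
    have e2 : ∀ᶠ p : CGCurve in 𝓝 (qC z₀), xq (g (p : ℂ × ℂ).2) ^ 2 +
        xq (g (p : ℂ × ℂ).2) * (p : ℂ × ℂ).1 + (p : ℂ × ℂ).1 ^ 2 - 1 ≠ 0 := by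
      have hc' : ContinuousAt (fun p : CGCurve => xq (g (p : ℂ × ℂ).2) ^ 2 +
        xq (g (p : ℂ × ℂ).2) * (p : ℂ × ℂ).1 + (p : ℂ × ℂ).1 ^ 2 - 1) (qC z₀) := by fun_prop
      refine hc'.eventually_ne ?_
      have ex : xq (g ((qC z₀ : CGCurve) : ℂ × ℂ).2) = xq z₀ := congrArg xq hg0
      rw [ex]
      change xq z₀ ^ 2 + xq z₀ * xq z₀ + xq z₀ ^ 2 - 1 ≠ 0
      rw [(hasDerivAt_yq h0).deriv] at hd
      intro h
      exact hd (by linear_combination (kC / 2) * h)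
    filter_upwards [e1, e2] with p h1 h2
    refine Subtype.ext (Prod.ext ?_ h1)
    change xq (g (p : ℂ × ℂ).2) = _
    have h3 := curve_eq (g (p : ℂ × ℂ).2)
    rw [h1, p.2] at h3
    have h4 : (xq (g (p : ℂ × ℂ).2) - (p : ℂ × ℂ).1) * (xq (g (p : ℂ × ℂ).2) ^ 2 +
        xq (g (p : ℂ × ℂ).2) * (p : ℂ × ℂ).1 + (p : ℂ × ℂ).1 ^ 2 - 1) = 0 := by
      linear_combination -h3
    exact sub_eq_zero.1 ((mul_eq_zero.1 h4).resolve_right h2)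
  · have hd : deriv xq z₀ ≠ 0 := by
      rw [(hasDerivAt_xq h0).deriv]
      exact mul_ne_zero hk hy
    set g := hax.hasStrictDerivAt.localInverse _ _ _ hd with hg
    have hga : AnalyticAt ℂ g (xq z₀) := hax.analyticAt_localInverse hd
    have hg0 : g (xq z₀) = z₀ := HasStrictFDerivAt.localInverse_apply_image ..
    have hs : AnalyticAt ℂ (fun p : ℂ × ℂ => g p.1) (qC z₀) :=
      hga.comp_of_eq (f := Prod.fst) analyticAt_fst rfl
    refine ⟨fun p => g p.1, hs, hg0, (hnear _ hs.continuousAt hg0).and ?_⟩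
    have c2 : ContinuousAt (fun p : CGCurve => (p : ℂ × ℂ).2) (qC z₀) := by fun_prop
    have c1 : ContinuousAt (fun p : CGCurve => (p : ℂ × ℂ).1) (qC z₀) := by fun_prop
    have e1 : ∀ᶠ p : CGCurve in 𝓝 (qC z₀), xq (g (p : ℂ × ℂ).1) = (p : ℂ × ℂ).1 :=
      c1.eventually (hax.hasStrictDerivAt.eventually_right_inverse hd)
    have hc : ContinuousAt (fun p : CGCurve => yq (g (p : ℂ × ℂ).1)) (qC z₀) := by
      have h1 : ContinuousAt (fun p : CGCurve => g (p : ℂ × ℂ).1) (qC z₀) :=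
        ContinuousAt.comp_of_eq (g := g) hga.continuousAt c1 rfl
      exact ContinuousAt.comp_of_eq (g := yq) hay.continuousAt h1 hg0
    have e2 : ∀ᶠ p : CGCurve in 𝓝 (qC z₀), yq (g (p : ℂ × ℂ).1) + (p : ℂ × ℂ).2 ≠ 0 := by
      refine (hc.add c2).eventually_ne ?_
      have ey : yq (g ((qC z₀ : CGCurve) : ℂ × ℂ).1) = yq z₀ := congrArg yq hg0
      change yq (g ((qC z₀ : CGCurve) : ℂ × ℂ).1) + yq z₀ ≠ 0
      rw [ey]
      rw [← two_mul]
      exact mul_ne_zero two_ne_zero hy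
    filter_upwards [e1, e2] with p h1 h2
    refine Subtype.ext (Prod.ext h1 ?_)
    change yq (g (p : ℂ × ℂ).1) = _
    have h3 := curve_eq (g (p : ℂ × ℂ).1)
    rw [h1, ← p.2] at h3
    have h4 : (yq (g (p : ℂ × ℂ).1) - (p : ℂ × ℂ).2) * (yq (g (p : ℂ × ℂ).1) + (p : ℂ × ℂ).2) = 0 := by
      linear_combination h3
    exact sub_eq_zero.1 ((mul_eq_zero.1 h4).resolve_right h2)

/-- The function on the curve induced by a lattice-periodic function. -/
def descend {E : Type*} (f : ℂ → E) (p : CGCurve) : E := f (qC_surjective p).choose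

/-- `f` is lattice-periodic away from the lattice. -/
def IsPeriodic {E : Type*} (f : ℂ → E) : Prop :=
  ∀ z l, z ∉ sqL.lattice → l ∈ sqL.lattice → f (z + l) = f z

lemma descend_qC {E : Type*} {f : ℂ → E} (hf : IsPeriodic f) {z : ℂ} (hz : z ∉ sqL.lattice) :
    descend f (qC z) = f z := by
  obtain ⟨h1, h2⟩ := (qC_surjective (qC z)).choose_spec
  rw [qC_eq_iff h1 hz] at h2
  have := hf z _ hz h2
  rw [add_sub_cancel] at this
  exact this

lemma continuous_descend {E : Type*} [TopologicalSpace E] {f : ℂ → E} (hf : IsPeriodic f)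
    (hc : ∀ z, z ∉ sqL.lattice → ContinuousAt f z) : Continuous (descend f) := by
  rw [continuous_iff_continuousAt]
  intro p
  obtain ⟨z, hz, rfl⟩ := qC_surjective p
  obtain ⟨s, hs, hs0, hs1⟩ := exists_local_section hz
  have h1 : ContinuousAt (fun p : CGCurve => s p) (qC z) :=
    hs.continuousAt.comp (f := Subtype.val) continuous_subtype_val.continuousAt
  have h2 : ContinuousAt (fun p : CGCurve => f (s p)) (qC z) :=
    ContinuousAt.comp_of_eq (g := f) (hc z hz) h1 hs0
  refine h2.congr ?_
  filter_upwards [hs1] with p hp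
  rw [← descend_qC hf hp.1, hp.2]

/-- A differentiable map `c` into the curve lifts locally to `ℂ`; the derivative of the lift is
`dx / (k y)`. -/
lemma exists_lift {V : Type*} [NormedAddCommGroup V] [NormedSpace ℝ V] {c : V → CGCurve} {t : V}
    {c' : V →L[ℝ] ℂ × ℂ} (hc : HasFDerivAt (fun t => (c t : ℂ × ℂ)) c' t)
    (hy : (c t : ℂ × ℂ).2 ≠ 0) {z : ℂ} (hz : z ∉ sqL.lattice) (hzt : qC z = c t) :
    ∃ σ : V → ℂ, σ t = z ∧ (∀ᶠ u in 𝓝 t, σ u ∉ sqL.lattice ∧ qC (σ u) = c u) ∧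
      HasFDerivAt σ ((kC * (c t : ℂ × ℂ).2)⁻¹ • (ContinuousLinearMap.fst ℝ ℂ ℂ).comp c') t := by
  obtain ⟨s, hs, hs0, hs1⟩ := exists_local_section hz
  rw [hzt] at hs hs0 hs1
  have hcc : ContinuousAt c t := Topology.IsInducing.subtypeVal.continuousAt_iff.2 hc.continuousAt
  have hev := hcc.eventually hs1
  have hd : DifferentiableAt ℝ (fun u => s (c u)) t :=
    DifferentiableAt.comp t (g := s) (f := fun u => (c u : ℂ × ℂ))
      (hs.differentiableAt.restrictScalars ℝ) hc.differentiableAt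
  refine ⟨fun u => s (c u), hs0, hev, ?_⟩
  have hx : HasFDerivAt xq ((ContinuousLinearMap.toSpanSingleton ℂ (kC * yq z)).restrictScalars ℝ)
      (s (c t)) := by
    rw [hs0]
    exact (hasDerivAt_xq hz).hasFDerivAt.restrictScalars ℝ
  have h1 := hx.comp t hd.hasFDerivAt
  have h2 : HasFDerivAt (fun u => (c u : ℂ × ℂ).1) ((ContinuousLinearMap.fst ℝ ℂ ℂ).comp c') t :=
    (ContinuousLinearMap.fst ℝ ℂ ℂ).hasFDerivAt.comp t hc
  have h3 := h1.unique (h2.congr_of_eventuallyEq (by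
    filter_upwards [hev] with u hu
    have := congrArg (fun p : CGCurve => (p : ℂ × ℂ).1) hu.2
    exact this))
  have hy' : yq z = (c t : ℂ × ℂ).2 := congrArg (fun p : CGCurve => (p : ℂ × ℂ).2) hzt
  have h4 : fderiv ℝ (fun u => s (c u)) t =
      (kC * (c t : ℂ × ℂ).2)⁻¹ • (ContinuousLinearMap.fst ℝ ℂ ℂ).comp c' := by
    ext v
    have := congrArg (fun L : V →L[ℝ] ℂ => L v) h3
    simp only [ContinuousLinearMap.comp_apply, ContinuousLinearMap.coe_restrictScalars',
      ContinuousLinearMap.toSpanSingleton_apply, smul_eq_mul, smul_apply] at this ⊢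
    rw [← this, ← hy']
    have hk := kC_ne_zero
    rw [← hy'] at hy
    field_simp
  rw [← h4]
  exact hd.hasFDerivAt

lemma hasFDerivAt_descend {V E : Type*} [NormedAddCommGroup V] [NormedSpace ℝ V]
    [NormedAddCommGroup E] [NormedSpace ℝ E] {f : ℂ → E} (hf : IsPeriodic f) {c : V → CGCurve}
    {t : V} {c' : V →L[ℝ] ℂ × ℂ} (hc : HasFDerivAt (fun t => (c t : ℂ × ℂ)) c' t)
    (hy : (c t : ℂ × ℂ).2 ≠ 0) {z : ℂ} (hz : z ∉ sqL.lattice) (hzt : qC z = c t)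
    {f' : ℂ →L[ℝ] E} (hf' : HasFDerivAt f f' z) :
    HasFDerivAt (fun u => descend f (c u))
      (f'.comp ((kC * (c t : ℂ × ℂ).2)⁻¹ • (ContinuousLinearMap.fst ℝ ℂ ℂ).comp c')) t := by
  obtain ⟨σ, h1, h2, h3⟩ := exists_lift hc hy hz hzt
  have h4 : HasFDerivAt (fun u => f (σ u)) _ t := HasFDerivAt.comp t (by rwa [h1]) h3
  refine h4.congr_of_eventuallyEq ?_
  filter_upwards [h2] with u hu
  rw [← hu.2, descend_qC hf hu.1]

end ChenGackstatter

end

noncomputable section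

namespace ChenGackstatter

open Complex PeriodPair

/-! ### The period condition -/

lemma rhoCG_pos : 0 < rhoCG := by
  have h1 := Real.Gamma_pos_of_pos (by norm_num : (0 : ℝ) < 3 / 4)
  have h2 := Real.Gamma_pos_of_pos (by norm_num : (0 : ℝ) < 1 / 4)
  unfold rhoCG
  positivity

lemma rhoCG_ne_zero : (rhoCG : ℂ) ≠ 0 := ofReal_ne_zero.2 rhoCG_pos.ne'

lemma hasDerivAt_descend {E : Type*} [NormedAddCommGroup E] [NormedSpace ℝ E] {f : ℂ → E}
    (hf : IsPeriodic f) {c : ℝ → CGCurve} {t : ℝ} {c' : ℂ × ℂ}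
    (hc : HasDerivAt (fun t => (c t : ℂ × ℂ)) c' t)
    (hy : (c t : ℂ × ℂ).2 ≠ 0) {z : ℂ} (hz : z ∉ sqL.lattice) (hzt : qC z = c t)
    {f' : ℂ →L[ℝ] E} (hf' : HasFDerivAt f f' z) :
    HasDerivAt (fun u => descend f (c u)) (f' (c'.1 / (kC * (c t : ℂ × ℂ).2))) t := by
  have h := hasFDerivAt_descend hf hc.hasFDerivAt hy hz hzt hf'
  have h2 := h.hasDerivAt
  convert h2 using 1
  simp [div_eq_inv_mul]

/-- A multiple of the periodic function `-ζ(z) + η conj z`. -/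
def psiq (z : ℂ) : ℂ := kC / eOne * (-wz z + etaC * conj z)

lemma psiq_periodic : IsPeriodic psiq := by
  intro z l hz hl
  rw [psiq, psiq, wz_add hz hl, map_add]
  ring

lemma hasFDerivAt_wz {z : ℂ} (hz : z ∉ sqL.lattice) :
    HasFDerivAt wz ((-sqL.weierstrassP z) • (1 : ℂ →L[ℝ] ℂ)) z := by
  refine ((hasDerivAt_wz hz).hasFDerivAt.restrictScalars ℝ).congr_fderiv ?_
  ext v
  simp [mul_comm]

lemma hasFDerivAt_psiq {z : ℂ} (hz : z ∉ sqL.lattice) :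
    HasFDerivAt psiq ((kC / eOne) • (-((-sqL.weierstrassP z) • (1 : ℂ →L[ℝ] ℂ)) +
      etaC • (conjCLE : ℂ →L[ℝ] ℂ))) z := by
  have h1 : HasFDerivAt (fun z : ℂ => conj z) (conjCLE : ℂ →L[ℝ] ℂ) z := conjCLE.hasFDerivAt
  exact ((hasFDerivAt_wz hz).neg.add (h1.const_mul etaC)).const_mul (kC / eOne)

lemma psiq_neg (z : ℂ) : psiq (-z) = -psiq z := by
  rw [psiq, psiq, wz_neg, map_neg]
  ring

/-- The path `(-√s, √(√s - √s ^ 3))`, `0 ≤ s ≤ 1`, on the curve, extended by constants. -/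
def betaPath (s : ℝ) : CGCurve :=
  ⟨(-((min √s 1 : ℝ) : ℂ), ((√((min √s 1) - (min √s 1) ^ 3) : ℝ) : ℂ)), by
    have h0 : 0 ≤ min √s 1 := le_min (Real.sqrt_nonneg _) zero_le_one
    have h1 : min √s 1 ≤ 1 := min_le_right _ _
    have h2 : 0 ≤ (min √s 1) - (min √s 1) ^ 3 := by
      have : (min √s 1) - (min √s 1) ^ 3 = min √s 1 * (1 - min √s 1) * (1 + min √s 1) := by ring
      rw [this]
      have : 0 ≤ 1 - min √s 1 := by linarith
      positivity
    simp only
    rw [← ofReal_pow, Real.sq_sqrt h2]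
    push_cast
    ring⟩

lemma continuous_betaPath : Continuous betaPath := by
  unfold betaPath
  refine Continuous.subtype_mk ?_ _
  fun_prop

lemma descend_psiq_zero {p : CGCurve} (hp : (p : ℂ × ℂ).2 = 0) : descend psiq p = 0 := by
  obtain ⟨z, hz, rfl⟩ := qC_surjective p
  have hz' : -z ∉ sqL.lattice := fun h => hz (by simpa using neg_mem h)
  have h0 : yq z = 0 := hp
  have h1 : qC (-z) = qC z := by
    refine Subtype.ext (Prod.ext ?_ ?_)
    · change xq (-z) = xq z
      rw [xq, xq, sqL.weierstrassP_neg]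
    · change yq (-z) = yq z
      rw [h0]
      rw [yq] at h0 ⊢
      rw [sqL.derivWeierstrassP_neg, mul_neg, neg_div, h0, neg_zero]
  have h2 := descend_qC psiq_periodic hz'
  rw [h1, descend_qC psiq_periodic hz, psiq_neg] at h2
  rw [descend_qC psiq_periodic hz]
  exact CharZero.eq_neg_self_iff.1 h2

lemma continuous_descend_psiq : Continuous (descend psiq) :=
  continuous_descend psiq_periodic fun _ hz => (hasFDerivAt_psiq hz).continuousAt

/-- The ratio between the periods of `x dx / y` and (minus the conjugates of) those of `dx / y`. -/
def lamC : ℂ := kC * etaC / (eOne * conj kC)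

lemma hasDerivAt_betaPath {s : ℝ} (h0 : 0 < s) (h1 : s < 1) :
    HasDerivAt (fun s => descend psiq (betaPath s))
      (1 / 2 * ((s : ℂ) ^ ((3 / 4 : ℂ) - 1) * (1 - (s : ℂ)) ^ ((1 / 2 : ℂ) - 1)
        - lamC * ((s : ℂ) ^ ((1 / 4 : ℂ) - 1) * (1 - (s : ℂ)) ^ ((1 / 2 : ℂ) - 1)))) s := by
  have hs0 : 0 < √s := Real.sqrt_pos.2 h0
  have hs1 : √s < 1 := by
    rw [← Real.sqrt_one]
    exact Real.sqrt_lt_sqrt h0.le h1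
  have hmin : min √s 1 = √s := min_eq_left hs1.le
  have hpos : 0 < √s - √s ^ 3 := by
    have : √s - √s ^ 3 = √s * (1 - √s) * (1 + √s) := by ring
    rw [this]
    have : 0 < 1 - √s := by linarith
    positivity
  have hd1 : HasDerivAt (fun s : ℝ => √s) (1 / (2 * √s)) s := Real.hasDerivAt_sqrt h0.ne'
  obtain ⟨d, hd2⟩ : ∃ d, HasDerivAt (fun s : ℝ => √(√s - √s ^ 3)) d s :=
    ⟨_, (hd1.sub (hd1.pow 3)).sqrt hpos.ne'⟩
  have hd : HasDerivAt (fun s => (betaPath s : ℂ × ℂ)) (-((1 / (2 * √s) : ℝ) : ℂ), (d : ℂ)) s := by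
    have := hd1.ofReal_comp.neg.prodMk hd2.ofReal_comp
    refine this.congr_of_eventuallyEq ?_
    have : ∀ᶠ u in 𝓝 s, √u < 1 := Real.continuous_sqrt.continuousAt.eventually_lt_const hs1
    filter_upwards [this] with u hu
    simp only [betaPath, min_eq_left hu.le]
    rfl
  obtain ⟨z, hz, hzs⟩ := qC_surjective (betaPath s)
  set Y : ℝ := √(√s - √s ^ 3) with hY
  have hYpos : 0 < Y := Real.sqrt_pos.2 hpos
  have hy : (betaPath s : ℂ × ℂ).2 = (Y : ℂ) := by simp [betaPath, hmin, hY]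
  have hx : (betaPath s : ℂ × ℂ).1 = (-√s : ℂ) := by simp [betaPath, hmin]
  have hYc : (Y : ℂ) ≠ 0 := ofReal_ne_zero.2 hYpos.ne'
  have key := hasDerivAt_descend psiq_periodic hd (by rw [hy]; exact hYc) hz hzs
    (hasFDerivAt_psiq hz)
  refine key.congr_deriv ?_
  have hY' : Y = s ^ (1 / 4 : ℝ) * (1 - s) ^ (1 / 2 : ℝ) := by
    have e : √s - √s ^ 3 = √s * (1 - s) := by
      have := Real.sq_sqrt h0.le
      linear_combination (-√s) * this
    rw [hY, e, Real.sqrt_mul hs0.le, Real.sqrt_eq_rpow, Real.sqrt_eq_rpow, Real.sqrt_eq_rpow,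
      ← Real.rpow_mul h0.le]
    norm_num
  have h1s : 0 < 1 - s := by linarith
  have e1 : (s : ℂ) ^ ((3 / 4 : ℂ) - 1) * (1 - (s : ℂ)) ^ ((1 / 2 : ℂ) - 1) = ((1 / Y : ℝ) : ℂ) := by
    have a1 : (s : ℂ) ^ ((3 / 4 : ℂ) - 1) = ((s ^ (-(1 / 4) : ℝ) : ℝ) : ℂ) := by
      rw [ofReal_cpow h0.le]
      congr 1
      push_cast
      norm_num
    have a2 : (1 - (s : ℂ)) ^ ((1 / 2 : ℂ) - 1) = (((1 - s) ^ (-(1 / 2) : ℝ) : ℝ) : ℂ) := by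
      rw [ofReal_cpow h1s.le]
      push_cast
      congr 1
      norm_num
    rw [a1, a2, ← ofReal_mul, hY', Real.rpow_neg h0.le, Real.rpow_neg h1s.le, one_div (_ * _),
      mul_inv]
  have e2 : (s : ℂ) ^ ((1 / 4 : ℂ) - 1) * (1 - (s : ℂ)) ^ ((1 / 2 : ℂ) - 1)
      = ((1 / (√s * Y) : ℝ) : ℂ) := by
    have a1 : (s : ℂ) ^ ((1 / 4 : ℂ) - 1) = (s : ℂ) ^ ((3 / 4 : ℂ) - 1) * ((1 / √s : ℝ) : ℂ) := by
      have : (1 / √s : ℝ) = s ^ (-(1 / 2) : ℝ) := by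
        rw [Real.rpow_neg h0.le, Real.sqrt_eq_rpow, one_div]
      rw [this, ofReal_cpow h0.le, ← cpow_add _ _ (ofReal_ne_zero.2 h0.ne')]
      congr 1
      push_cast
      norm_num
    rw [a1, mul_right_comm, e1, ← ofReal_mul]
    congr 1
    field_simp
  rw [e1, e2]
  have hsc : (√s : ℂ) ≠ 0 := ofReal_ne_zero.2 hs0.ne'
  have hk := kC_ne_zero
  have he := eOne_ne_zero
  have hkb : conj kC ≠ 0 := (map_ne_zero _).2 hk
  have hxq : xq z = -√s := by
    rw [← hx, ← hzs]
    rfl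
  have hw : sqL.weierstrassP z = eOne * (-√s) := by
    rw [← hxq, xq, kC_sq]
    field_simp
  simp only [hy, hw, lamC, smul_apply, add_apply, neg_apply,
    one_apply_eq_self, smul_eq_mul, ContinuousLinearEquiv.coe_coe, conjCLE_apply,
    map_div₀, map_neg, map_mul, conj_ofReal]
  push_cast
  field_simp
  ring

/-- The period condition. The odd function `descend psiq` vanishes at both ends of `betaPath`, and
its derivative along the path is a combination of two integrands of beta integrals. -/
lemma beta_relation :
    betaIntegral (3 / 4) (1 / 2) = lamC * betaIntegral (1 / 4) (1 / 2) := by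
  have c1 := betaIntegral_convergent (u := 3 / 4) (v := 1 / 2) (by norm_num) (by norm_num)
  have c2 := betaIntegral_convergent (u := 1 / 4) (v := 1 / 2) (by norm_num) (by norm_num)
  have h := intervalIntegral.integral_eq_sub_of_hasDerivAt_of_le (a := 0) (b := 1) zero_le_one
    (continuous_descend_psiq.comp continuous_betaPath).continuousOn
    (fun s hs => hasDerivAt_betaPath hs.1 hs.2) ((c1.sub (c2.const_mul lamC)).const_mul (1 / 2))
  rw [intervalIntegral.integral_const_mul, intervalIntegral.integral_sub c1 (c2.const_mul lamC),
    intervalIntegral.integral_const_mul] at h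
  have e0 : descend psiq (betaPath 0) = 0 := descend_psiq_zero (by simp [betaPath])
  have e1 : descend psiq (betaPath 1) = 0 := descend_psiq_zero (by simp [betaPath])
  simp only [Function.comp_apply, e0, e1, sub_zero] at h
  change 1 / 2 * (betaIntegral (3 / 4) (1 / 2) - lamC * betaIntegral (1 / 4) (1 / 2)) = 0 at h
  linear_combination 2 * h

lemma lamC_eq : lamC = 2 / 3 * (rhoCG : ℂ) ^ 2 := by
  have g1 := Complex.Gamma_mul_Gamma_eq_betaIntegral (s := 3 / 4) (t := 1 / 2) (by norm_num)
    (by norm_num)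
  have g2 := Complex.Gamma_mul_Gamma_eq_betaIntegral (s := 1 / 4) (t := 1 / 2) (by norm_num)
    (by norm_num)
  have n1 : Complex.Gamma (1 / 2) ≠ 0 := Complex.Gamma_ne_zero_of_re_pos (by norm_num)
  have n2 : Complex.Gamma (1 / 4) ≠ 0 := Complex.Gamma_ne_zero_of_re_pos (by norm_num)
  have n3 : Complex.Gamma (3 / 4) ≠ 0 := Complex.Gamma_ne_zero_of_re_pos (by norm_num)
  have e1 : (3 / 4 + 1 / 2 : ℂ) = 1 / 4 + 1 := by norm_num
  have e2 : (1 / 4 + 1 / 2 : ℂ) = 3 / 4 := by norm_num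
  rw [e1, Complex.Gamma_add_one _ (by norm_num), beta_relation] at g1
  rw [e2] at g2
  have hrho : (rhoCG : ℂ) ^ 2 = 6 * Complex.Gamma (3 / 4) ^ 2 / Complex.Gamma (1 / 4) ^ 2 := by
    have : rhoCG ^ 2 = 6 * Real.Gamma (3 / 4) ^ 2 / Real.Gamma (1 / 4) ^ 2 := by
      rw [rhoCG, div_pow, mul_pow, Real.sq_sqrt (by norm_num)]
    rw [← ofReal_pow, this]
    push_cast
    rw [← Complex.Gamma_ofReal, ← Complex.Gamma_ofReal]
    push_cast
    rfl
  rw [hrho]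
  have h3 : Complex.Gamma (1 / 2) * (4 * Complex.Gamma (3 / 4) ^ 2) =
      Complex.Gamma (1 / 2) * (lamC * Complex.Gamma (1 / 4) ^ 2) := by
    linear_combination (4 * Complex.Gamma (3 / 4)) * g1 - (lamC * Complex.Gamma (1 / 4)) * g2
  have h4 := mul_left_cancel₀ n1 h3
  field_simp
  linear_combination -3 * h4

/-! ### The planar part of the surfaces -/

/-- The holomorphic function `∫ G dx` on the universal cover. -/
def aq (z : ℂ) : ℂ := -(kC / (rhoCG * eOne)) * wz z

/-- The holomorphic function `∫ dx / G` on the universal cover. -/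
def bq (z : ℂ) : ℂ := 2 * rhoCG / 3 * (yq z - kC * z)

/-- The function `X₁ + i X₂ = 2 (∫ G dx - conj ∫ dx / G)` on the universal cover. -/
def phiq (z : ℂ) : ℂ := 2 * (aq z - conj (bq z))

lemma hasDerivAt_aq {z : ℂ} (hz : z ∉ sqL.lattice) : HasDerivAt aq (kC * xq z / rhoCG) z := by
  refine ((hasDerivAt_wz hz).const_mul (-(kC / (rhoCG * eOne)))).congr_deriv ?_
  have hr := rhoCG_ne_zero
  have he := eOne_ne_zero
  rw [xq, kC_sq]
  field_simp

lemma hasDerivAt_bq {z : ℂ} (hz : z ∉ sqL.lattice) :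
    HasDerivAt bq (rhoCG * kC * (xq z ^ 2 - 1)) z := by
  refine (((hasDerivAt_yq hz).sub ((hasDerivAt_id z).const_mul kC)).const_mul
    (2 * (rhoCG : ℂ) / 3)).congr_deriv ?_
  ring

lemma yq_add {z l : ℂ} (hl : l ∈ sqL.lattice) : yq (z + l) = yq z :=
  congrArg (fun p : CGCurve => (p : ℂ × ℂ).2) (qC_add hl)

lemma phiq_periodic : IsPeriodic phiq := by
  intro z l hz hl
  have h := lamC_eq
  have hr := rhoCG_ne_zero
  have he := eOne_ne_zero
  have hkb : conj kC ≠ 0 := (map_ne_zero _).2 kC_ne_zero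
  have h2 : kC * etaC = 2 / 3 * (rhoCG : ℂ) ^ 2 * (eOne * conj kC) := by
    rw [← h, lamC]
    field_simp
  have h3 : kC / (rhoCG * eOne) * etaC = 2 * rhoCG / 3 * conj kC := by
    field_simp
    linear_combination 3 * h2
  simp only [phiq, aq, bq, wz_add hz hl, yq_add hl, map_mul, map_sub, map_add, map_div₀,
    conj_ofReal]
  simp only [map_ofNat]
  linear_combination (-2 * conj l) * h3

/-- The real differential of `X₁ + i X₂` in terms of `dx`, where `g` is the value of `G`. -/
def phiDer (g : ℂ) : ℂ →L[ℝ] ℂ :=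
  (2 * g) • (1 : ℂ →L[ℝ] ℂ) - (2 * conj g⁻¹) • (conjCLE : ℂ →L[ℝ] ℂ)

lemma phiDer_apply (g v : ℂ) : phiDer g v = 2 * (g * v - conj (v / g)) := by
  simp [phiDer, div_eq_mul_inv]
  ring

lemma hasFDerivAt_phiq {z : ℂ} (hz : z ∉ sqL.lattice) :
    HasFDerivAt phiq ((2 * (kC * xq z / rhoCG)) • (1 : ℂ →L[ℝ] ℂ)
      - (2 * conj (rhoCG * kC * (xq z ^ 2 - 1))) • (conjCLE : ℂ →L[ℝ] ℂ)) z := by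
  have ha := (hasDerivAt_aq hz).hasFDerivAt.restrictScalars ℝ
  have hb := (hasDerivAt_bq hz).hasFDerivAt.restrictScalars ℝ
  have hb' : HasFDerivAt (fun z => conj (bq z)) _ z := conjCLE.hasFDerivAt.comp z hb
  refine ((ha.sub hb').const_mul 2).congr_fderiv ?_
  ext v
  simp
  ring

/-- The function `X₁ + i X₂` on the curve. -/
def PhiC : CGCurve → ℂ := descend phiq

lemma PhiC_qC {z : ℂ} (hz : z ∉ sqL.lattice) : PhiC (qC z) = phiq z := descend_qC phiq_periodic hz

lemma continuous_PhiC : Continuous PhiC :=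
  continuous_descend phiq_periodic fun _ hz => (hasFDerivAt_phiq hz).continuousAt

lemma x_ne_zero_of_y {p : CGCurve} (hy : (p : ℂ × ℂ).2 ≠ 0) : (p : ℂ × ℂ).1 ≠ 0 := by
  intro h
  have := p.2
  rw [h, zero_mul, zero_mul] at this
  exact hy (pow_eq_zero_iff two_ne_zero |>.1 this)

lemma gaussCG_ne_zero {p : CGCurve} (hy : (p : ℂ × ℂ).2 ≠ 0) : gaussCG p ≠ 0 :=
  div_ne_zero (x_ne_zero_of_y hy) (mul_ne_zero rhoCG_ne_zero hy)

lemma inv_gaussCG {p : CGCurve} (hy : (p : ℂ × ℂ).2 ≠ 0) :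
    (gaussCG p)⁻¹ = rhoCG * ((p : ℂ × ℂ).1 ^ 2 - 1) / (p : ℂ × ℂ).2 := by
  have hx := x_ne_zero_of_y hy
  have h := p.2
  have hr := rhoCG_ne_zero
  rw [gaussCG, inv_div, div_eq_div_iff hx hy]
  linear_combination rhoCG * h

lemma hasFDerivAt_PhiC {V : Type*} [NormedAddCommGroup V] [NormedSpace ℝ V] {c : V → CGCurve}
    {t : V} {c' : V →L[ℝ] ℂ × ℂ} (hc : HasFDerivAt (fun t => (c t : ℂ × ℂ)) c' t)
    (hy : (c t : ℂ × ℂ).2 ≠ 0) :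
    HasFDerivAt (fun u => PhiC (c u))
      ((phiDer (gaussCG (c t))).comp ((ContinuousLinearMap.fst ℝ ℂ ℂ).comp c')) t := by
  obtain ⟨z, hz, hzt⟩ := qC_surjective (c t)
  refine (hasFDerivAt_descend phiq_periodic hc hy hz hzt (hasFDerivAt_phiq hz)).congr_fderiv ?_
  have hx : xq z = (c t : ℂ × ℂ).1 := congrArg (fun p : CGCurve => (p : ℂ × ℂ).1) hzt
  ext v
  simp only [ContinuousLinearMap.comp_apply, phiDer_apply, div_eq_mul_inv (_ : ℂ) (gaussCG (c t)),
    inv_gaussCG hy]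
  have hk := kC_ne_zero
  have hkb : conj kC ≠ 0 := (map_ne_zero _).2 kC_ne_zero
  have hr := rhoCG_ne_zero
  simp only [hx, gaussCG, sub_apply, smul_apply, ContinuousLinearMap.comp_apply,
    one_apply_eq_self, smul_eq_mul, ContinuousLinearEquiv.coe_coe, conjCLE_apply,
    map_mul, map_inv₀, map_div₀, conj_ofReal]
  have hyb : conj (c t : ℂ × ℂ).2 ≠ 0 := (map_ne_zero _).2 hy
  field_simp

lemma hasDerivAt_PhiC {c : ℝ → CGCurve} {t : ℝ} {c' : ℂ × ℂ}
    (hc : HasDerivAt (fun t => (c t : ℂ × ℂ)) c' t) (hy : (c t : ℂ × ℂ).2 ≠ 0) :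
    HasDerivAt (fun u => PhiC (c u))
      (2 * (gaussCG (c t) * c'.1 - conj (c'.1 / gaussCG (c t)))) t := by
  have := (hasFDerivAt_PhiC hc.hasFDerivAt hy).hasDerivAt
  convert this using 1
  simp [phiDer_apply]

/-! ### Uniqueness up to constants -/

lemma two_mul_mem_of_yq {z : ℂ} (hz : z ∉ sqL.lattice) (h0 : yq z = 0) : 2 * z ∈ sqL.lattice := by
  have hz' : -z ∉ sqL.lattice := fun h => hz (by simpa using neg_mem h)
  have h1 : qC z = qC (-z) := by
    refine Subtype.ext (Prod.ext ?_ ?_)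
    · change xq z = xq (-z)
      rw [xq, xq, sqL.weierstrassP_neg]
    · change yq z = yq (-z)
      rw [h0]
      rw [yq] at h0 ⊢
      rw [sqL.derivWeierstrassP_neg, mul_neg, neg_div, h0, neg_zero]
  rw [qC_eq_iff hz hz'] at h1
  convert h1 using 1
  ring

/-- The uniformization is a local parametrization of the curve near every point. -/
lemma isParam_qC (z : ℂ) :
    IsParam qC (Metric.ball z (1 / 2) ∩ (sqL.lattice : Set ℂ)ᶜ) where
  isOpen := Metric.isOpen_ball.inter isOpen_compl_lattice
  holo := fun w hw => (hasDerivAt_qC hw.2).differentiableAt.differentiableWithinAt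
  regular := by
    intro w hw
    rw [(hasDerivAt_qC hw.2).deriv]
    intro h
    have hk := kC_ne_zero
    have h1 : yq w = 0 := (mul_eq_zero.1 (congrArg Prod.fst h)).resolve_left hk
    have h2 : 3 * xq w ^ 2 - 1 = 0 :=
      (mul_eq_zero.1 (congrArg Prod.snd h)).resolve_left (div_ne_zero hk two_ne_zero)
    have h3 := curve_eq w
    rw [h1] at h3
    have h5 : (xq w ^ 3 - xq w) = 0 := by linear_combination -h3
    have h6 : (3 : ℂ) * xq w ^ 2 = 1 := by linear_combination h2
    have h7 : xq w = 0 := by linear_combination (1 / 2 : ℂ) * xq w * h6 - (3 / 2 : ℂ) * h5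
    rw [h7] at h6
    norm_num at h6
  inj := by
    intro u hu w hw h
    rw [qC_eq_iff hu.2 hw.2] at h
    by_contra hne
    have h1 := one_le_norm_of_mem h (sub_ne_zero.2 hne)
    have h2 : dist u w < 1 := by
      have a := Metric.mem_ball.1 hu.1
      have b := Metric.mem_ball'.1 hw.1
      linarith [dist_triangle u z w]
    rw [Complex.dist_eq] at h2
    linarith

/-- A continuous function on the curve whose differential vanishes where `y ≠ 0` is constant. -/
lemma eq_of_hasFDerivAt_zero {E : Type*} [NormedAddCommGroup E] [NormedSpace ℝ E]
    {f : CGCurve → E} (hf : Continuous f)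
    (h : ∀ γ U, IsParam γ U → ∀ w ∈ U, (γ w : ℂ × ℂ).2 ≠ 0 →
      HasFDerivAt (f ∘ γ) (0 : ℂ →L[ℝ] E) w) (p p' : CGCurve) : f p = f p' := by
  set N : Set ℂ := {z | 2 * z ∈ sqL.lattice} with hN
  have hNc : N.Countable := countable_lattice.preimage (mul_right_injective₀ two_ne_zero)
  have hNl : ∀ z ∈ Nᶜ, z ∉ sqL.lattice := fun z hz hz' => hz (by
    have := add_mem hz' hz'
    rwa [← two_mul] at this)
  have hNcl : IsClosed N := sqL.isClosed_lattice.preimage (by fun_prop : Continuous fun z : ℂ => 2 * z)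
  have hd : ∀ z ∈ Nᶜ, HasFDerivAt (f ∘ qC) (0 : ℂ →L[ℝ] E) z := by
    intro z hz
    refine h qC _ (isParam_qC z) z ⟨Metric.mem_ball_self (by norm_num), hNl z hz⟩ ?_
    exact fun h0 => hz (two_mul_mem_of_yq (hNl z hz) h0)
  have hconst : ∀ z ∈ Nᶜ, ∀ w ∈ Nᶜ, (f ∘ qC) z = (f ∘ qC) w := fun z hz w hw =>
    hNcl.isOpen_compl.is_const_of_fderiv_eq_zero (𝕜 := ℝ) (isPreconnected_compl_countable hNc)
      (fun u hu => (hd u hu).differentiableAt.differentiableWithinAt)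
      (fun u hu => (hd u hu).fderiv) hz hw
  have hdense : Dense Nᶜ := hNc.dense_compl ℝ
  obtain ⟨w, hw⟩ := hdense.nonempty
  have key : ∀ p, f p = (f ∘ qC) w := by
    intro p
    obtain ⟨z, hz, rfl⟩ := qC_surjective p
    have hc : ContinuousAt (f ∘ qC) z := hf.continuousAt.comp (continuousAt_qC hz)
    have hne : (𝓝[Nᶜ] z).NeBot := mem_closure_iff_nhdsWithin_neBot.1 (hdense z)
    refine tendsto_nhds_unique (hc.mono_left (nhdsWithin_le_nhds (s := Nᶜ))) ?_
    refine tendsto_const_nhds.congr' ?_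
    filter_upwards [self_mem_nhdsWithin] with u hu
    exact hconst w hw u hu
  rw [key p, key p']

/-! ### Symmetries of the curve -/

/-- The involution `(x, y) ↦ (x, -y)`. -/
def negC (p : CGCurve) : CGCurve :=
  ⟨((p : ℂ × ℂ).1, -(p : ℂ × ℂ).2), by simpa using p.2⟩

/-- The automorphism `(x, y) ↦ (-x, i y)` of order four. -/
def rotC (p : CGCurve) : CGCurve :=
  ⟨(-(p : ℂ × ℂ).1, I * (p : ℂ × ℂ).2), by
    have := p.2
    simp only [mul_pow, I_sq]
    linear_combination -this⟩

/-- Complex conjugation on the curve. -/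
def conjC (p : CGCurve) : CGCurve :=
  ⟨(conj (p : ℂ × ℂ).1, conj (p : ℂ × ℂ).2), by
    simp only
    rw [← map_pow, p.2]
    simp⟩

@[simp] lemma negC_fst (p : CGCurve) : (negC p : ℂ × ℂ).1 = (p : ℂ × ℂ).1 := rfl
@[simp] lemma negC_snd (p : CGCurve) : (negC p : ℂ × ℂ).2 = -(p : ℂ × ℂ).2 := rfl
@[simp] lemma rotC_fst (p : CGCurve) : (rotC p : ℂ × ℂ).1 = -(p : ℂ × ℂ).1 := rfl
@[simp] lemma rotC_snd (p : CGCurve) : (rotC p : ℂ × ℂ).2 = I * (p : ℂ × ℂ).2 := rfl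
@[simp] lemma conjC_fst (p : CGCurve) : (conjC p : ℂ × ℂ).1 = conj (p : ℂ × ℂ).1 := rfl
@[simp] lemma conjC_snd (p : CGCurve) : (conjC p : ℂ × ℂ).2 = conj (p : ℂ × ℂ).2 := rfl

lemma conjC_conjC (p : CGCurve) : conjC (conjC p) = p := by
  refine Subtype.ext (Prod.ext ?_ ?_) <;> simp

lemma PhiC_rotC (p : CGCurve) : PhiC (rotC p) = -I * PhiC p := by
  obtain ⟨z, hz, rfl⟩ := qC_surjective p
  have hz' : I * z ∉ sqL.lattice := fun h => hz (I_mul_mem_iff.1 h)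
  have h1 : rotC (qC z) = qC (I * z) := by
    refine Subtype.ext (Prod.ext ?_ ?_)
    · change -xq z = xq (I * z)
      rw [xq, xq, wp_I_mul]
      ring
    · change I * yq z = yq (I * z)
      rw [yq, yq, dwp_I_mul]
      ring
  have h2 : yq (I * z) = I * yq z := by
    rw [yq, yq, dwp_I_mul]
    ring
  rw [h1, PhiC_qC hz, PhiC_qC hz']
  simp only [phiq, aq, bq, wz_I_mul, h2, map_mul, map_sub, conj_I]
  ring

lemma PhiC_negC (p : CGCurve) : PhiC (negC p) = -PhiC p := by
  have h : negC p = rotC (rotC p) := by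
    refine Subtype.ext (Prod.ext ?_ ?_)
    · simp
    · simp [← mul_assoc]
  rw [h, PhiC_rotC, PhiC_rotC]
  linear_combination PhiC p * I_mul_I

lemma PhiC_eq_zero_of_y {p : CGCurve} (hp : (p : ℂ × ℂ).2 = 0) : PhiC p = 0 := by
  have h : negC p = p := Subtype.ext (Prod.ext rfl (by simp [hp]))
  have := PhiC_negC p
  rw [h] at this
  exact CharZero.eq_neg_self_iff.1 this

lemma gaussCG_conjC (p : CGCurve) : gaussCG (conjC p) = conj (gaussCG p) := by
  simp [gaussCG]

lemma PhiC_conjC (p : CGCurve) : PhiC (conjC p) = conj (PhiC p) := by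
  have hconj : Continuous conjC := by
    unfold conjC
    exact Continuous.subtype_mk (by fun_prop) _
  have hcont : Continuous fun p => PhiC (conjC p) - conj (PhiC p) :=
    (continuous_PhiC.comp hconj).sub (continuous_conj.comp continuous_PhiC)
  let o : CGCurve := ⟨(0, 0), by simp⟩
  have ho : PhiC o = 0 := PhiC_eq_zero_of_y rfl
  have hoc : conjC o = o := Subtype.ext (Prod.ext (by simp [o]) (by simp [o]))
  have key := eq_of_hasFDerivAt_zero hcont ?_ p o
  · simp only [ho, hoc, map_zero, sub_zero] at key
    exact sub_eq_zero.1 key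
  · intro γ U hγ w hw hy
    have hγ' : HasFDerivAt (fun w => (γ w : ℂ × ℂ))
        (fderiv ℝ (fun w => (γ w : ℂ × ℂ)) w) w :=
      ((hγ.holo.differentiableAt (hγ.isOpen.mem_nhds hw)).restrictScalars ℝ).hasFDerivAt
    set D := fderiv ℝ (fun w => (γ w : ℂ × ℂ)) w
    have hc : HasFDerivAt (fun w => (conjC (γ w) : ℂ × ℂ))
        (((conjCLE : ℂ →L[ℝ] ℂ).prodMap (conjCLE : ℂ →L[ℝ] ℂ)).comp D) w :=
      ((conjCLE : ℂ →L[ℝ] ℂ).prodMap (conjCLE : ℂ →L[ℝ] ℂ)).hasFDerivAt.comp w hγ'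
    have h1 := hasFDerivAt_PhiC hc (by simpa using hy)
    have h2 := hasFDerivAt_PhiC hγ' hy
    have h3 : HasFDerivAt (fun u => conj (PhiC (γ u))) _ w := conjCLE.hasFDerivAt.comp w h2
    refine (h1.sub h3).congr_fderiv ?_
    ext v
    simp only [sub_apply, ContinuousLinearMap.comp_apply, phiDer_apply, gaussCG_conjC,
      ContinuousLinearMap.coe_fst', ContinuousLinearMap.coe_prodMap', Prod.map_fst,
      ContinuousLinearEquiv.coe_coe, conjCLE_apply, map_mul, map_sub, map_div₀, conj_conj, map_ofNat]
    simp

/-! ### Growth at the end -/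

/-- A property that holds near the puncture `0` of the torus holds near the end of the curve. -/
lemma eventually_cocompact {P : CGCurve → Prop} (h : ∀ᶠ z in 𝓝[≠] (0 : ℂ), P (qC z)) :
    ∀ᶠ p in cocompact CGCurve, P p := by
  rw [eventually_nhdsWithin_iff, Metric.eventually_nhds_iff_ball] at h
  obtain ⟨r, hr, h⟩ := h
  set K : Set ℂ := {z | |z.re| ≤ 1 / 2 ∧ |z.im| ≤ 1 / 2 ∧ r ≤ ‖z‖} with hK
  have hKl : ∀ z ∈ K, z ∉ sqL.lattice := by
    rintro z ⟨h1, h2, h3⟩ hz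
    have h4 := one_le_norm_of_mem hz (norm_pos_iff.1 (hr.trans_le h3))
    have h5 : ‖z‖ ^ 2 = z.re ^ 2 + z.im ^ 2 := by
      rw [Complex.sq_norm, Complex.normSq_apply]
      ring
    have h6 := sq_abs z.re
    have h7 := sq_abs z.im
    nlinarith [abs_nonneg z.re, abs_nonneg z.im]
  have hKc : IsCompact K := by
    refine Metric.isCompact_of_isClosed_isBounded ?_ ?_
    · have h1 : IsClosed {z : ℂ | |z.re| ≤ 1 / 2} := isClosed_le (by fun_prop) continuous_const
      have h2 : IsClosed {z : ℂ | |z.im| ≤ 1 / 2} := isClosed_le (by fun_prop) continuous_const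
      have h3 : IsClosed {z : ℂ | r ≤ ‖z‖} := isClosed_le continuous_const (by fun_prop)
      exact h1.inter (h2.inter h3)
    · refine (Metric.isBounded_closedBall (x := (0 : ℂ)) (r := 1)).subset ?_
      rintro z ⟨h1, h2, -⟩
      rw [mem_closedBall_zero_iff]
      linarith [Complex.norm_le_abs_re_add_abs_im z]
  have hcomp : IsCompact (qC '' K) :=
    hKc.image_of_continuousOn fun z hz => (continuousAt_qC (hKl z hz)).continuousWithinAt
  filter_upwards [hcomp.compl_mem_cocompact] with p hp
  obtain ⟨z, hz, rfl⟩ := qC_surjective p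
  have hm : ((round z.re : ℂ) + round z.im * I) ∈ sqL.lattice := mem_sqL.2 ⟨_, _, rfl⟩
  set w := z - ((round z.re : ℂ) + round z.im * I) with hw
  have hwl : w ∉ sqL.lattice := fun h => hz (by simpa [hw] using add_mem h hm)
  have hqw : qC w = qC z := by
    rw [← qC_add (z := w) hm, hw, sub_add_cancel]
  have hre : w.re = z.re - round z.re := by simp [hw]
  have him : w.im = z.im - round z.im := by simp [hw]
  rw [← hqw] at hp ⊢
  have hlt : ‖w‖ < r := by
    by_contra! hge
    refine hp ⟨w, ⟨?_, ?_, hge⟩, rfl⟩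
    · rw [hre]
      exact abs_sub_round _
    · rw [him]
      exact abs_sub_round _
  refine h w (by simpa using hlt) ?_
  intro h0
  have : w = 0 := h0
  exact hwl (this ▸ zero_mem _)

/-- The height grows slower than the planar part: `Φ` has a pole of order three at the puncture, `x`
one of order two. -/
lemma exists_norm_x_le {δ : ℝ} (hδ : 0 < δ) :
    ∃ C, 0 ≤ C ∧ ∀ p : CGCurve, ‖(p : ℂ × ℂ).1‖ ≤ δ * ‖PhiC p‖ + C := by
  have hk : 0 < ‖kC‖ := norm_pos_iff.2 kC_ne_zero
  have hr := rhoCG_pos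
  have t1 : Tendsto (fun z => ‖z ^ 3 * xq z‖) (𝓝[≠] 0) (𝓝 0) := by
    have h1 : Tendsto (fun z : ℂ => z) (𝓝[≠] 0) (𝓝 0) := nhdsWithin_le_nhds
    have := ((h1.mul tendsto_sq_mul_wp).const_mul (4 / kC ^ 2)).norm
    simp only [zero_mul, mul_zero, norm_zero] at this
    refine this.congr fun z => ?_
    rw [xq]
    congr 1
    ring
  have t2 : Tendsto (fun z => ‖z ^ 3 * (yq z - kC * z)‖) (𝓝[≠] 0) (𝓝 (8 / ‖kC‖ ^ 3)) := by
    have h1 : Tendsto (fun z : ℂ => kC * z ^ 4) (𝓝[≠] 0) (𝓝 0) := by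
      have : ContinuousAt (fun z : ℂ => kC * z ^ 4) 0 := by fun_prop
      simpa [ContinuousAt] using this.tendsto.mono_left (nhdsWithin_le_nhds (s := {0}ᶜ))
    have := ((tendsto_cube_mul_dwp.const_mul (4 / kC ^ 3)).sub h1).norm
    have e : ‖4 / kC ^ 3 * -2 - 0‖ = 8 / ‖kC‖ ^ 3 := by
      rw [sub_zero, norm_mul, norm_div, norm_pow]
      norm_num
      ring
    rw [e] at this
    refine this.congr fun z => ?_
    rw [yq]
    congr 1
    ring
  have t3 : Tendsto (fun z => ‖z ^ 3 * wz z‖) (𝓝[≠] 0) (𝓝 0) := by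
    simpa using tendsto_cube_mul_wz.norm
  have t4 := ((t2.const_mul (2 * rhoCG / 3)).sub
    (t3.const_mul ‖kC / (rhoCG * eOne)‖)).const_mul (2 * δ)
  have hev : ∀ᶠ p : CGCurve in cocompact CGCurve, ‖(p : ℂ × ℂ).1‖ ≤ δ * ‖PhiC p‖ := by
    refine eventually_cocompact ?_
    have hlt : (0 : ℝ) < 2 * δ * (2 * rhoCG / 3 * (8 / ‖kC‖ ^ 3) - ‖kC / (rhoCG * eOne)‖ * 0) := by
      rw [mul_zero, sub_zero]
      positivity
    filter_upwards [t1.eventually_lt t4 hlt, self_mem_nhdsWithin, eventually_notMem_lattice]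
      with z h1 h2 h3
    have hz : 0 < ‖z ^ 3‖ := norm_pos_iff.2 (pow_ne_zero 3 h2)
    rw [PhiC_qC h3]
    change ‖xq z‖ ≤ _
    have h5 : ‖bq z‖ = 2 * rhoCG / 3 * ‖yq z - kC * z‖ := by
      rw [bq, norm_mul]
      congr 1
      rw [norm_div, norm_mul, norm_real, Real.norm_of_nonneg hr.le]
      norm_num
    have h6 : ‖aq z‖ = ‖kC / (rhoCG * eOne)‖ * ‖wz z‖ := by
      rw [aq, norm_mul, norm_neg]
    have h7 : 2 * (‖bq z‖ - ‖aq z‖) ≤ ‖phiq z‖ := by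
      rw [phiq, norm_mul, norm_sub_rev, Complex.norm_ofNat]
      have := norm_sub_norm_le (conj (bq z)) (aq z)
      rw [RCLike.norm_conj] at this
      linarith
    rw [norm_mul, norm_mul, norm_mul] at h1
    have h8 : ‖z ^ 3‖ * ‖xq z‖ ≤ ‖z ^ 3‖ * (δ * (2 * (‖bq z‖ - ‖aq z‖))) := by
      rw [h5, h6]
      refine h1.le.trans (le_of_eq ?_)
      ring
    have h9 := le_of_mul_le_mul_left h8 hz
    exact h9.trans (mul_le_mul_of_nonneg_left h7 hδ.le)
  obtain ⟨K, hK, hKs⟩ := mem_cocompact.1 hev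
  obtain ⟨C, hC⟩ := (hK.image (f := fun p : CGCurve => ‖(p : ℂ × ℂ).1‖) (by fun_prop)).bddAbove
  refine ⟨max C 0, le_max_right _ _, fun p => ?_⟩
  by_cases hp : p ∈ K
  · have h1 := hC ⟨p, hp, rfl⟩
    have h2 : 0 ≤ δ * ‖PhiC p‖ := by positivity
    simp only at h1
    linarith [le_max_left C 0]
  · have h1 : ‖(p : ℂ × ℂ).1‖ ≤ δ * ‖PhiC p‖ := hKs hp
    linarith [le_max_right C 0]

end ChenGackstatter

end

noncomputable section

namespace ChenGackstatter

open Complex PeriodPair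

/-! ### Real parts of null curves -/

/-- The map `u ↦ 2 Re u` from `ℂ⁴` to `ℝ⁴₁`. -/
def rv (u : Fin 4 → ℂ) : R41 := fun k => 2 * (u k).re

/-- The differential `v ↦ 2 Re (v W')` of `2 Re W`. -/
def rvCLM (W' : Fin 4 → ℂ) : ℂ →L[ℝ] R41 :=
  ContinuousLinearMap.pi fun k => (2 : ℝ) • reCLM.comp (W' k • (1 : ℂ →L[ℝ] ℂ))

lemma rvCLM_apply (W' : Fin 4 → ℂ) (v : ℂ) : rvCLM W' v = rv (v • W') := by
  ext k
  simp [rvCLM, rv]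
  ring

lemma hasFDerivAt_rv {W : ℂ → Fin 4 → ℂ} {W' : Fin 4 → ℂ} {u : ℂ} (h : HasDerivAt W W' u) :
    HasFDerivAt (fun u => rv (W u)) (rvCLM W') u := by
  rw [hasFDerivAt_pi']
  intro k
  have h1 := ((hasDerivAt_pi.1 h k).hasFDerivAt.restrictScalars ℝ)
  have h2 : HasFDerivAt (fun u => 2 * (W u k).re) _ u :=
    (reCLM.hasFDerivAt.comp u h1).const_mul (2 : ℝ)
  refine h2.congr_fderiv ?_
  ext v
  simp [rvCLM]
  ring

/-- The vector `(a - b, -i (a + b), (ζ + 1 / ζ) c, (ζ - 1 / ζ) c)`. For `a = G dx`, `b = dx / G`,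
`c = dx` this is the Weierstrass integrand of the deformation, for the primitives of these forms
its integral. -/
def tv (ζ a b c : ℂ) : Fin 4 → ℂ := ![a - b, -I * (a + b), (ζ + ζ⁻¹) * c, (ζ - ζ⁻¹) * c]

lemma hasDerivAt_tv (ζ : ℂ) {a b c : ℂ → ℂ} {a' b' c' u : ℂ} (ha : HasDerivAt a a' u)
    (hb : HasDerivAt b b' u) (hc : HasDerivAt c c' u) :
    HasDerivAt (fun u => tv ζ (a u) (b u) (c u)) (tv ζ a' b' c') u := by
  rw [hasDerivAt_pi]
  intro k
  fin_cases k
  · exact ha.sub hb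
  · exact (ha.add hb).const_mul (-I)
  · exact hc.const_mul (ζ + ζ⁻¹)
  · exact hc.const_mul (ζ - ζ⁻¹)

/-- The constant `Re (ζ / conj ζ)`. -/
def kap (ζ : ℂ) : ℝ := (ζ * conj ζ⁻¹).re

/-- The conformal factor of the metric. -/
def eForm (ζ a b c : ℂ) : ℝ := 4 * (‖a‖ ^ 2 + ‖b‖ ^ 2) + 8 * kap ζ * ‖c‖ ^ 2

lemma neg_one_lt_kap {ζ : ℂ} (h : ζ.re ≠ 0) : -1 < kap ζ := by
  have hn : 0 < normSq ζ := normSq_pos.2 fun h0 => h (by simp [h0])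
  have h1 : 0 < ζ.re ^ 2 := by positivity
  have : kap ζ = (ζ.re ^ 2 - ζ.im ^ 2) / normSq ζ := by
    rw [kap, inv_def]
    simp
    field_simp
  rw [this, lt_div_iff₀ hn, normSq_apply]
  nlinarith

/-- Null curves: if `a b = c ^ 2`, the vector `tv ζ a b c` is isotropic, so that the real part of its
multiples is conformal. -/
lemma lor_rv_tv {ζ a b c : ℂ} (hζ : ζ ≠ 0) (h : a * b = c ^ 2) (d d' : ℂ) :
    lor (rv (d • tv ζ a b c)) (rv (d' • tv ζ a b c)) = eForm ζ a b c * (d * conj d').re := by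
  obtain ⟨j, hj⟩ : ∃ j, j = ζ⁻¹ := ⟨_, rfl⟩
  have hj1 : ζ * j = 1 := by rw [hj, mul_inv_cancel₀ hζ]
  have e1 := congrArg Complex.re h
  have e2 := congrArg Complex.im h
  have e3 := congrArg Complex.re hj1
  have e4 := congrArg Complex.im hj1
  simp only [pow_two, mul_re, mul_im, one_re, one_im] at e1 e2 e3 e4
  simp only [lor, rv, tv, eForm, kap, ← hj, Complex.sq_norm, normSq_apply]
  simp only [Pi.smul_apply, smul_eq_mul, Matrix.cons_val_zero, Matrix.cons_val_one,
    Matrix.cons_val, mul_re, mul_im, add_re, add_im, sub_re, sub_im, neg_re, neg_im, I_re, I_im,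
    conj_re, conj_im]
  linear_combination (-8 * (d.re * d'.re - d.im * d'.im)) * e1 +
    (8 * (d.re * d'.im + d.im * d'.re)) * e2 +
    (8 * ((c.re ^ 2 - c.im ^ 2) * (d.re * d'.re - d.im * d'.im) -
      2 * c.re * c.im * (d.re * d'.im + d.im * d'.re))) * e3 -
    (8 * ((c.re ^ 2 - c.im ^ 2) * (d.re * d'.im + d.im * d'.re) +
      2 * c.re * c.im * (d.re * d'.re - d.im * d'.im))) * e4

lemma eForm_ge {ζ a b c : ℂ} (h : a * b = c ^ 2) : 8 * (1 + kap ζ) * ‖c‖ ^ 2 ≤ eForm ζ a b c := by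
  have h1 : ‖c‖ ^ 2 = ‖a‖ * ‖b‖ := by rw [← norm_pow, ← h, norm_mul]
  rw [eForm, h1]
  nlinarith [sq_nonneg (‖a‖ - ‖b‖)]

lemma eForm_pos {ζ a b c : ℂ} (hζ : ζ.re ≠ 0) (h : a * b = c ^ 2) (hne : a ≠ 0 ∨ b ≠ 0) :
    0 < eForm ζ a b c := by
  have hk := neg_one_lt_kap hζ
  by_cases hc : c = 0
  · rw [eForm, hc, norm_zero]
    rcases hne with h | h
    · have := pow_pos (norm_pos_iff.2 h) 2
      nlinarith [sq_nonneg ‖b‖]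
    · have := pow_pos (norm_pos_iff.2 h) 2
      nlinarith [sq_nonneg ‖a‖]
  · have := norm_pos_iff.2 hc
    have h1 : 0 < 1 + kap ζ := by linarith
    exact lt_of_lt_of_le (by positivity) (eForm_ge h)

/-! ### The surfaces -/

/-- The Lorentz deformation with parameter `ζ`, normalized by `X = 0` at the branch point
`(x, y) = (0, 0)`. -/
def Xstd (ζ : ℂ) (p : CGCurve) : R41 :=
  ![(PhiC p).re, (PhiC p).im, 2 * ((ζ + ζ⁻¹) * (p : ℂ × ℂ).1).re,
    2 * ((ζ - ζ⁻¹) * (p : ℂ × ℂ).1).re]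

lemma Xstd_eq_rv {ζ a b : ℂ} {p : CGCurve} (h : PhiC p = 2 * (a - conj b)) :
    Xstd ζ p = rv (tv ζ a b (p : ℂ × ℂ).1) := by
  ext k
  fin_cases k <;> simp [Xstd, rv, tv, h]

lemma continuous_Xstd (ζ : ℂ) : Continuous (Xstd ζ) := by
  have := continuous_PhiC
  unfold Xstd
  refine continuous_pi fun k => ?_
  fin_cases k
  · exact continuous_re.comp this
  · exact continuous_im.comp this
  · simp only [Fin.reduceFinMk, Matrix.cons_val]
    fun_prop
  · simp only [Fin.reduceFinMk, Matrix.cons_val]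
    fun_prop

lemma hasFDerivAt_Xstd (ζ : ℂ) {V : Type*} [NormedAddCommGroup V] [NormedSpace ℝ V]
    {c : V → CGCurve} {t : V} {c' : V →L[ℝ] ℂ × ℂ}
    (hc : HasFDerivAt (fun t => (c t : ℂ × ℂ)) c' t) (hy : (c t : ℂ × ℂ).2 ≠ 0) :
    HasFDerivAt (fun u => Xstd ζ (c u))
      ((rvCLM (tv ζ (gaussCG (c t)) (gaussCG (c t))⁻¹ 1)).comp
        ((ContinuousLinearMap.fst ℝ ℂ ℂ).comp c')) t := by
  have h1 := hasFDerivAt_PhiC hc hy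
  have h2 : HasFDerivAt (fun u => (c u : ℂ × ℂ).1) ((ContinuousLinearMap.fst ℝ ℂ ℂ).comp c') t :=
    (ContinuousLinearMap.fst ℝ ℂ ℂ).hasFDerivAt.comp t hc
  rw [hasFDerivAt_pi']
  intro k
  fin_cases k
  · have h3 : HasFDerivAt (fun u => (PhiC (c u)).re) _ t := reCLM.hasFDerivAt.comp t h1
    refine h3.congr_fderiv ?_
    ext v
    simp [rvCLM_apply, rv, tv, phiDer_apply, div_eq_mul_inv]
    ring
  · have h3 : HasFDerivAt (fun u => (PhiC (c u)).im) _ t := imCLM.hasFDerivAt.comp t h1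
    refine h3.congr_fderiv ?_
    ext v
    simp [rvCLM_apply, rv, tv, phiDer_apply, div_eq_mul_inv]
    ring
  · have h3 : HasFDerivAt (fun u => 2 * ((ζ + ζ⁻¹) * (c u : ℂ × ℂ).1).re) _ t :=
      (reCLM.hasFDerivAt.comp t (h2.const_mul (ζ + ζ⁻¹))).const_mul (2 : ℝ)
    refine h3.congr_fderiv ?_
    ext v
    simp [rvCLM_apply, rv, tv]
    ring
  · have h3 : HasFDerivAt (fun u => 2 * ((ζ - ζ⁻¹) * (c u : ℂ × ℂ).1).re) _ t :=
      (reCLM.hasFDerivAt.comp t (h2.const_mul (ζ - ζ⁻¹))).const_mul (2 : ℝ)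
    refine h3.congr_fderiv ?_
    ext v
    simp [rvCLM_apply, rv, tv]
    ring

lemma weierstrassVector_eq {ζ : ℂ} (hζ : ζ ≠ 0) {p : CGCurve} (hy : (p : ℂ × ℂ).2 ≠ 0) (d : ℂ)
    (k : Fin 4) : weierstrassVector (phiCG ζ p) (psiCG ζ p) k * (ζ * d) =
      (d • tv ζ (gaussCG p) (gaussCG p)⁻¹ 1) k := by
  have hG := gaussCG_ne_zero hy
  fin_cases k <;> simp [weierstrassVector, phiCG, psiCG, tv] <;> field_simp <;> ring

/-- The coordinate `x` along a parametrization. -/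
lemma IsParam.hasDerivAt {γ : ℂ → CGCurve} {U : Set ℂ} (hγ : IsParam γ U) {w : ℂ} (hw : w ∈ U) :
    HasDerivAt (fun w => (γ w : ℂ × ℂ)) (deriv (fun w => (γ w : ℂ × ℂ)) w) w :=
  (hγ.holo.differentiableAt (hγ.isOpen.mem_nhds hw)).hasDerivAt

lemma IsParam.hasDerivAt_fst {γ : ℂ → CGCurve} {U : Set ℂ} (hγ : IsParam γ U) {w : ℂ}
    (hw : w ∈ U) :
    HasDerivAt (fun w => (γ w : ℂ × ℂ).1) (deriv (fun w => (γ w : ℂ × ℂ)) w).1 w :=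
  (ContinuousLinearMap.fst ℂ ℂ ℂ).hasFDerivAt.comp_hasDerivAt w (IsParam.hasDerivAt hγ hw)

lemma IsParam.analyticAt {γ : ℂ → CGCurve} {U : Set ℂ} (hγ : IsParam γ U) {w : ℂ} (hw : w ∈ U) :
    AnalyticAt ℂ (fun w => (γ w : ℂ × ℂ)) w :=
  hγ.holo.analyticAt (hγ.isOpen.mem_nhds hw)

lemma IsParam.hasFDerivAt {γ : ℂ → CGCurve} {U : Set ℂ} (hγ : IsParam γ U) {w : ℂ} (hw : w ∈ U) :
    HasFDerivAt (𝕜 := ℝ) (fun w => (γ w : ℂ × ℂ)) ((ContinuousLinearMap.toSpanSingleton ℂ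
      (deriv (fun w => (γ w : ℂ × ℂ)) w)).restrictScalars ℝ) w :=
  (IsParam.hasDerivAt hγ hw).hasFDerivAt.restrictScalars ℝ

lemma hasFDerivAt_Xstd_param (ζ : ℂ) {γ : ℂ → CGCurve} {U : Set ℂ} (hγ : IsParam γ U) {w : ℂ}
    (hw : w ∈ U) (hy : (γ w : ℂ × ℂ).2 ≠ 0) : HasFDerivAt (Xstd ζ ∘ γ)
      (rvCLM ((deriv (fun w => (γ w : ℂ × ℂ).1) w) • tv ζ (gaussCG (γ w)) (gaussCG (γ w))⁻¹ 1))
      w := by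
  refine (hasFDerivAt_Xstd ζ (IsParam.hasFDerivAt hγ hw) hy).congr_fderiv ?_
  rw [(IsParam.hasDerivAt_fst hγ hw).deriv]
  ext1 v
  simp [rvCLM_apply, smul_smul]

lemma isLorentzDeformation_Xstd {ζ : ℂ} (hζ : ζ.re ≠ 0) : IsLorentzDeformationCG ζ (Xstd ζ) := by
  have h0 : ζ ≠ 0 := fun h => hζ (by simp [h])
  refine ⟨continuous_Xstd ζ, fun γ U hγ w hw hy => ?_⟩
  have h1 := hasFDerivAt_Xstd_param ζ hγ hw hy
  refine ⟨h1.differentiableAt, fun v k => ?_⟩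
  have h2 : deriv ((fun p => ζ * heightCG p) ∘ γ) w = ζ * deriv (fun w => (γ w : ℂ × ℂ).1) w :=
    ((IsParam.hasDerivAt_fst hγ hw).differentiableAt.hasDerivAt.const_mul ζ).deriv
  rw [h1.fderiv, h2, mul_assoc, weierstrassVector_eq h0 hy, rvCLM_apply, smul_smul, mul_comm v]
  rfl

/-- The Lorentz deformation is unique up to translation. -/
lemma exists_translation {ζ : ℂ} (hζ : ζ.re ≠ 0) {X : CGCurve → R41}
    (hX : IsLorentzDeformationCG ζ X) : ∃ v, ∀ p, X p = Xstd ζ p + v := by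
  let o : CGCurve := ⟨(0, 0), by simp⟩
  have h1 := isLorentzDeformation_Xstd hζ
  have key := eq_of_hasFDerivAt_zero (f := fun p => X p - Xstd ζ p) (hX.1.sub h1.1) ?_
  · refine ⟨X o - Xstd ζ o, fun p => ?_⟩
    rw [← key p o]
    abel
  · intro γ U hγ w hw hy
    obtain ⟨d1, e1⟩ := hX.2 γ U hγ w hw hy
    obtain ⟨d2, e2⟩ := h1.2 γ U hγ w hw hy
    refine (d1.hasFDerivAt.sub d2.hasFDerivAt).congr_fderiv ?_
    ext v k
    simp [e1 v k, e2 v k]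

lemma exists_yq_ne_zero : ∃ z, z ∉ sqL.lattice ∧ yq z ≠ 0 := by
  obtain ⟨z, hz, h⟩ := qC_surjective ⟨(2, √6), by
    simp only
    rw [← ofReal_pow, Real.sq_sqrt (by norm_num)]
    norm_num⟩
  refine ⟨z, hz, ?_⟩
  have : yq z = √6 := congrArg (fun p : CGCurve => (p : ℂ × ℂ).2) h
  rw [this]
  simp

/-- The parameter is determined by the third and fourth coordinates. -/
theorem parameter_unique {ζ ζ' : ℂ} {X : CGCurve → R41} (hζ : ζ.re ≠ 0) (hζ' : ζ'.re ≠ 0)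
    (h : IsLorentzDeformationCG ζ X) (h' : IsLorentzDeformationCG ζ' X) : ζ = ζ' := by
  have h0 : ζ ≠ 0 := fun h => hζ (by simp [h])
  have h0' : ζ' ≠ 0 := fun h => hζ' (by simp [h])
  obtain ⟨z, hz, hy⟩ := exists_yq_ne_zero
  have hzU : z ∈ Metric.ball z (1 / 2) ∩ (sqL.lattice : Set ℂ)ᶜ :=
    ⟨Metric.mem_ball_self (by norm_num), hz⟩
  obtain ⟨-, e1⟩ := h.2 qC _ (isParam_qC z) z hzU hy
  obtain ⟨-, e2⟩ := h'.2 qC _ (isParam_qC z) z hzU hy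
  have hd : ∀ ζ : ℂ, deriv ((fun p => ζ * heightCG p) ∘ qC) z = ζ * (kC * yq z) := fun ζ =>
    ((hasDerivAt_xq hz).const_mul ζ).deriv
  have hky : kC * yq z ≠ 0 := mul_ne_zero kC_ne_zero hy
  have hre : ∀ (v : ℂ) (k : Fin 4),
      ((v • tv ζ (gaussCG (qC z)) (gaussCG (qC z))⁻¹ 1) k).re =
        ((v • tv ζ' (gaussCG (qC z)) (gaussCG (qC z))⁻¹ 1) k).re := by
    intro v k
    have a1 := e1 (v / (kC * yq z)) k
    have a2 := e2 (v / (kC * yq z)) k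
    rw [hd, mul_assoc, mul_div_cancel₀ _ hky, weierstrassVector_eq h0 hy] at a1
    rw [hd, mul_assoc, mul_div_cancel₀ _ hky, weierstrassVector_eq h0' hy] at a2
    linarith
  have a1 := hre 1 2
  have a2 := hre 1 3
  have b1 := hre I 2
  have b2 := hre I 3
  simp [tv] at a1 a2 b1 b2
  exact Complex.ext (by linarith) (by linarith)

/-! ### Local behaviour -/

/-- Parametrizations of the curve lift locally to the universal cover. -/
lemma exists_transition {γ : ℂ → CGCurve} {U : Set ℂ} (hγ : IsParam γ U) {w : ℂ} (hw : w ∈ U)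
    {z : ℂ} (hz : z ∉ sqL.lattice) (hzw : qC z = γ w) :
    ∃ τ : ℂ → ℂ, AnalyticAt ℂ τ w ∧ τ w = z ∧ deriv τ w ≠ 0 ∧
      ∀ᶠ u in 𝓝 w, τ u ∉ sqL.lattice ∧ qC (τ u) = γ u := by
  obtain ⟨s, hs, hs0, hs1⟩ := exists_local_section hz
  rw [hzw] at hs hs0 hs1
  have hγa := IsParam.analyticAt hγ hw
  have hcc : ContinuousAt γ w := Topology.IsInducing.subtypeVal.continuousAt_iff.2 hγa.continuousAt
  have ha : AnalyticAt ℂ (fun u => s (γ u)) w := hs.comp (g := s) (f := fun u => (γ u : ℂ × ℂ)) hγa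
  have hev := hcc.eventually hs1
  refine ⟨fun u => s (γ u), ha, hs0, ?_, hev⟩
  intro h0
  have h1 : HasDerivAt (fun u => (qC (s (γ u)) : ℂ × ℂ)) _ w :=
    HasDerivAt.scomp_of_eq (g₁ := fun z => (qC z : ℂ × ℂ)) w (hasDerivAt_qC hz) ha.differentiableAt.hasDerivAt hs0.symm
  rw [h0, zero_smul] at h1
  refine hγ.regular w hw ?_
  refine (h1.congr_of_eventuallyEq ?_).deriv
  filter_upwards [hev] with u hu
  rw [hu.2]

/-- The conformal factor in the coordinate of the universal cover. -/
def eFac (ζ z : ℂ) : ℝ :=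
  eForm ζ (kC * xq z / rhoCG) (rhoCG * kC * (xq z ^ 2 - 1)) (kC * yq z)

lemma null_q (z : ℂ) :
    kC * xq z / rhoCG * (rhoCG * kC * (xq z ^ 2 - 1)) = (kC * yq z) ^ 2 := by
  have hr := rhoCG_ne_zero
  have h := curve_eq z
  field_simp
  linear_combination (-kC ^ 2) * h

lemma eFac_pos {ζ : ℂ} (hζ : ζ.re ≠ 0) (z : ℂ) : 0 < eFac ζ z := by
  refine eForm_pos hζ (null_q z) ?_
  by_cases h : xq z = 0
  · right
    rw [h]
    have hr := rhoCG_ne_zero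
    have hk := kC_ne_zero
    simp [hr, hk]
  · left
    exact div_ne_zero (mul_ne_zero kC_ne_zero h) rhoCG_ne_zero

/-- The surface on the universal cover, as a null curve. -/
def Wq (ζ z : ℂ) : Fin 4 → ℂ := tv ζ (aq z) (bq z) (xq z)

/-- The derivative of the null curve `Wq ζ`. -/
def Wq' (ζ z : ℂ) : Fin 4 → ℂ :=
  tv ζ (kC * xq z / rhoCG) (rhoCG * kC * (xq z ^ 2 - 1)) (kC * yq z)

lemma hasDerivAt_Wq (ζ : ℂ) {z : ℂ} (hz : z ∉ sqL.lattice) : HasDerivAt (Wq ζ) (Wq' ζ z) z :=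
  hasDerivAt_tv ζ (hasDerivAt_aq hz) (hasDerivAt_bq hz) (hasDerivAt_xq hz)

lemma Xstd_qC (ζ : ℂ) {z : ℂ} (hz : z ∉ sqL.lattice) : Xstd ζ (qC z) = rv (Wq ζ z) :=
  Xstd_eq_rv (PhiC_qC hz)

/-- Locally the surface is the real part of the null curve `Wq ζ ∘ τ`. -/
lemma local_rep {ζ : ℂ} {X : CGCurve → R41} {v₀ : R41} (hX : ∀ p, X p = Xstd ζ p + v₀)
    {γ : ℂ → CGCurve} {w : ℂ} {τ : ℂ → ℂ}
    (hτ : AnalyticAt ℂ τ w) (hτq : ∀ᶠ u in 𝓝 w, τ u ∉ sqL.lattice ∧ qC (τ u) = γ u) :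
    AnalyticAt ℂ (fun u => Wq ζ (τ u)) w ∧
    (∀ᶠ u in 𝓝 w, (X ∘ γ) u = rv (Wq ζ (τ u)) + v₀) ∧
    (∀ᶠ u in 𝓝 w, HasDerivAt (fun u => Wq ζ (τ u)) (deriv τ u • Wq' ζ (τ u)) u) ∧
    ∀ᶠ u in 𝓝 w, HasFDerivAt (X ∘ γ) (rvCLM (deriv τ u • Wq' ζ (τ u))) u := by
  have h1 : ∀ᶠ u in 𝓝 w, (X ∘ γ) u = rv (Wq ζ (τ u)) + v₀ := by
    filter_upwards [hτq] with u hu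
    rw [Function.comp_apply, hX, ← hu.2, Xstd_qC ζ hu.1]
  have h2 : ∀ᶠ u in 𝓝 w, HasDerivAt (fun u => Wq ζ (τ u)) (deriv τ u • Wq' ζ (τ u)) u := by
    filter_upwards [hτq, hτ.eventually_analyticAt] with u hu hu'
    exact HasDerivAt.scomp u (hasDerivAt_Wq ζ hu.1) hu'.differentiableAt.hasDerivAt
  refine ⟨?_, h1, h2, ?_⟩
  · rw [Complex.analyticAt_iff_eventually_differentiableAt]
    exact h2.mono fun u hu => hu.differentiableAt
  · filter_upwards [h2, h1.eventually_nhds] with u hu hu'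
    exact ((hasFDerivAt_rv hu).add_const v₀).congr_of_eventuallyEq hu'

lemma firstFF_eq {ζ : ℂ} (hζ : ζ.re ≠ 0) {X : CGCurve → R41} {v₀ : R41}
    (hX : ∀ p, X p = Xstd ζ p + v₀) {γ : ℂ → CGCurve} {w : ℂ} {τ : ℂ → ℂ}
    (hτ : AnalyticAt ℂ τ w) (hτq : ∀ᶠ u in 𝓝 w, τ u ∉ sqL.lattice ∧ qC (τ u) = γ u) :
    ∀ᶠ u in 𝓝 w, ∀ d d' : ℂ,
      firstFF (X ∘ γ) u d d' = eFac ζ (τ u) * ‖deriv τ u‖ ^ 2 * (d * conj d').re := by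
  have h0 : ζ ≠ 0 := fun h => hζ (by simp [h])
  filter_upwards [(local_rep hX hτ hτq).2.2.2] with u hu d d'
  rw [firstFF, hu.fderiv, rvCLM_apply, rvCLM_apply, smul_smul, smul_smul, Wq',
    lor_rv_tv h0 (null_q _), ← eFac]
  have : d * deriv τ u * conj (d' * deriv τ u) =
      ((‖deriv τ u‖ ^ 2 : ℝ) : ℂ) * (d * conj d') := by
    rw [← normSq_eq_norm_sq, ← mul_conj, map_mul]
    ring
  rw [this, re_ofReal_mul, mul_assoc]

lemma firstFF_eq_of_y {ζ : ℂ} (hζ : ζ.re ≠ 0) {X : CGCurve → R41} {v₀ : R41}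
    (hX : ∀ p, X p = Xstd ζ p + v₀) {γ : ℂ → CGCurve} {U : Set ℂ} (hγ : IsParam γ U) {w : ℂ}
    (hw : w ∈ U) (hy : (γ w : ℂ × ℂ).2 ≠ 0) (d d' : ℂ) :
    firstFF (X ∘ γ) w d d' = eForm ζ (gaussCG (γ w)) (gaussCG (γ w))⁻¹ 1 *
      ‖deriv (fun w => (γ w : ℂ × ℂ).1) w‖ ^ 2 * (d * conj d').re := by
  have h0 : ζ ≠ 0 := fun h => hζ (by simp [h])
  have h1 : X ∘ γ = fun u => (Xstd ζ ∘ γ) u + v₀ := funext fun u => hX _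
  have h2 := (hasFDerivAt_Xstd_param ζ hγ hw hy).add_const v₀
  rw [← h1] at h2
  rw [firstFF, h2.fderiv, rvCLM_apply, rvCLM_apply, smul_smul, smul_smul,
    lor_rv_tv h0 (by rw [mul_inv_cancel₀ (gaussCG_ne_zero hy), one_pow])]
  set t := deriv (fun w => (γ w : ℂ × ℂ).1) w
  have : d * t * conj (d' * t) = ((‖t‖ ^ 2 : ℝ) : ℂ) * (d * conj d') := by
    rw [← normSq_eq_norm_sq, ← mul_conj, map_mul]
    ring
  rw [this, re_ofReal_mul, mul_assoc]

lemma contDiff_rv : ContDiff ℝ ∞ rv := by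
  unfold rv
  refine contDiff_pi.2 fun k => ?_
  have : (fun u : Fin 4 → ℂ => 2 * (u k).re) =
    fun u => (2 : ℝ) * reCLM ((ContinuousLinearMap.proj (R := ℝ) k : (Fin 4 → ℂ) →L[ℝ] ℂ) u) := rfl
  rw [this]
  fun_prop

lemma contDiffOn_X {ζ : ℂ} {X : CGCurve → R41} {v₀ : R41} (hX : ∀ p, X p = Xstd ζ p + v₀)
    {γ : ℂ → CGCurve} {U : Set ℂ} (hγ : IsParam γ U) : ContDiffOn ℝ ∞ (X ∘ γ) U := by
  intro w hw
  obtain ⟨z, hz, hzw⟩ := qC_surjective (γ w)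
  obtain ⟨τ, hτ, -, -, hτq⟩ := exists_transition hγ hw hz hzw
  obtain ⟨h1, h2, -⟩ := local_rep hX hτ hτq
  have h3 : ContDiffAt ℝ ∞ (fun u => Wq ζ (τ u)) w := h1.contDiffAt.restrict_scalars ℝ
  exact (((contDiff_rv.contDiffAt.comp w h3).add contDiffAt_const).congr_of_eventuallyEq
    h2).contDiffWithinAt

theorem isStationarySurface {ζ : ℂ} (hζ : ζ.re ≠ 0) {X : CGCurve → R41} {v₀ : R41}
    (hX : ∀ p, X p = Xstd ζ p + v₀) : IsStationarySurface X := by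
  have key : ∀ γ U, IsParam γ U → ∀ w ∈ U, ∃ E : ℝ, 0 < E ∧ ∀ d d' : ℂ,
      firstFF (X ∘ γ) w d d' = E * (d * conj d').re := by
    intro γ U hγ w hw
    obtain ⟨z, hz, hzw⟩ := qC_surjective (γ w)
    obtain ⟨τ, hτ, hτ0, hτ', hτq⟩ := exists_transition hγ hw hz hzw
    have hp := norm_pos_iff.2 hτ'
    have he := eFac_pos hζ (τ w)
    exact ⟨eFac ζ (τ w) * ‖deriv τ w‖ ^ 2, by positivity, (firstFF_eq hζ hX hτ hτq).self_of_nhds⟩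
  refine ⟨fun γ U hγ => ⟨contDiffOn_X hX hγ, fun w hw v hv => ?_⟩, fun γ U hγ w hw => ?_,
    fun γ U hγ w hw => ?_⟩
  · obtain ⟨E, hE, h⟩ := key γ U hγ w hw
    rw [h, mul_conj, ofReal_re]
    exact mul_pos hE (normSq_pos.2 hv)
  · obtain ⟨E, hE, h⟩ := key γ U hγ w hw
    rw [h, h, h]
    simp
  · obtain ⟨E, hE, h⟩ := key γ U hγ w hw
    obtain ⟨z, hz, hzw⟩ := qC_surjective (γ w)
    obtain ⟨τ, hτ, hτ0, hτ', hτq⟩ := exists_transition hγ hw hz hzw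
    obtain ⟨h1, -, h3, h4⟩ := local_rep hX hτ hτq
    have hW : ∀ᶠ u in 𝓝 w, deriv (fun u => Wq ζ (τ u)) u = deriv τ u • Wq' ζ (τ u) :=
      h3.mono fun u hu => hu.deriv
    -- `X` is harmonic: its second derivative in directions `a`, `b` is `2 Re (W'' a b)`
    have hsec : ∀ a b : ℂ, secondDeriv (X ∘ γ) w a b =
        rv ((b * a) • deriv (deriv fun u => Wq ζ (τ u)) w) := by
      intro a b
      have e1 : (fun u => fderiv ℝ (X ∘ γ) u a) =ᶠ[𝓝 w]
          fun u => rv (a • deriv (fun u => Wq ζ (τ u)) u) := by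
        filter_upwards [h4, hW] with u hu hu'
        rw [hu.fderiv, rvCLM_apply, hu']
      rw [secondDeriv, e1.fderiv_eq]
      have h5 : HasDerivAt (fun u => a • deriv (fun u => Wq ζ (τ u)) u) _ w :=
        (h1.deriv.differentiableAt.hasDerivAt).const_smul a
      rw [(hasFDerivAt_rv h5).fderiv, rvCLM_apply, smul_smul]
    have hsum : secondDeriv (X ∘ γ) w 1 1 + secondDeriv (X ∘ γ) w I I = 0 := by
      rw [hsec, hsec]
      ext k
      simp [rv]
    have e11 : firstFF (X ∘ γ) w 1 1 = E := by rw [h]; simp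
    have eII : firstFF (X ∘ γ) w I I = E := by rw [h]; simp
    have e1I : firstFF (X ∘ γ) w 1 I = 0 := by rw [h]; simp
    rw [e11, eII, e1I, mul_zero, zero_smul, sub_zero, ← smul_add, hsum, smul_zero]
    exact zero_mem _

/-- The deformations form a smooth family. -/
theorem contDiffOn_family {γ : ℂ → CGCurve} {U : Set ℂ} (hγ : IsParam γ U) :
    ContDiffOn ℝ ∞ (fun s : ℂ × ℂ => Xstd s.1 (γ s.2)) ({ζ : ℂ | ζ.re ≠ 0} ×ˢ U) := by
  have hX := contDiffOn_X (ζ := 1) (X := Xstd 1) (v₀ := 0) (by simp) hγ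
  have hsnd : ContDiffOn ℝ ∞ (fun s : ℂ × ℂ => (Xstd 1 ∘ γ) s.2) ({ζ : ℂ | ζ.re ≠ 0} ×ˢ U) :=
    hX.comp contDiff_snd.contDiffOn fun s hs => hs.2
  have hx : ContDiffOn ℝ ∞ (fun s : ℂ × ℂ => (γ s.2 : ℂ × ℂ).1) ({ζ : ℂ | ζ.re ≠ 0} ×ˢ U) := by
    have : ContDiffOn ℝ ∞ (fun w => (γ w : ℂ × ℂ).1) U := fun w hw =>
      (ContDiffAt.restrict_scalars ℝ ((IsParam.analyticAt hγ hw).contDiffAt.fst)).contDiffWithinAt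
    exact this.comp contDiff_snd.contDiffOn fun s hs => hs.2
  have hinv : ContDiffOn ℝ ∞ (fun s : ℂ × ℂ => s.1⁻¹) ({ζ : ℂ | ζ.re ≠ 0} ×ˢ U) := by
    refine ContDiffOn.inv contDiff_fst.contDiffOn fun s hs h0 => hs.1 ?_
    simp [h0]
  have hfst : ContDiffOn ℝ ∞ (fun s : ℂ × ℂ => s.1) ({ζ : ℂ | ζ.re ≠ 0} ×ˢ U) :=
    contDiff_fst.contDiffOn
  rw [contDiffOn_pi] at hsnd ⊢
  intro k
  fin_cases k
  · exact hsnd 0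
  · exact hsnd 1
  · exact contDiffOn_const.mul (reCLM.contDiff.comp_contDiffOn ((hfst.add hinv).mul hx))
  · exact contDiffOn_const.mul (reCLM.contDiff.comp_contDiffOn ((hfst.sub hinv).mul hx))

/-! ### Completeness and the end -/

lemma three_sq_ne_of_y {p : CGCurve} (h0 : (p : ℂ × ℂ).2 = 0) : 3 * (p : ℂ × ℂ).1 ^ 2 - 1 ≠ 0 := by
  intro h2
  have h3 := p.2
  rw [h0] at h3
  have h5 : ((p : ℂ × ℂ).1 ^ 3 - (p : ℂ × ℂ).1) = 0 := by linear_combination -h3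
  have h6 : (3 : ℂ) * (p : ℂ × ℂ).1 ^ 2 = 1 := by linear_combination h2
  have h7 : (p : ℂ × ℂ).1 = 0 := by
    linear_combination (1 / 2 : ℂ) * (p : ℂ × ℂ).1 * h6 - (3 / 2 : ℂ) * h5
  rw [h7] at h6
  norm_num at h6

/-- Completeness: the metric dominates a multiple of `|dx|²`, and `x` is unbounded along divergent
curves. -/
theorem isCompleteSurface {ζ : ℂ} (hζ : ζ.re ≠ 0) {X : CGCurve → R41} {v₀ : R41}
    (hX : ∀ p, X p = Xstd ζ p + v₀) : IsCompleteSurface X := by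
  have h0 : ζ ≠ 0 := fun h => hζ (by simp [h])
  intro c hc hdiv
  set ξ : ℝ → ℂ := fun t => (c t : ℂ × ℂ).1 with hξ
  have hξC : ContDiffOn ℝ 1 ξ (Set.Ici 0) := hc.fst
  set M : ℝ := √(8 * (1 + kap ζ)) with hM
  have hMpos : 0 < M := Real.sqrt_pos.2 (by linarith [neg_one_lt_kap hζ])
  have hpt : ∀ t ∈ Set.Ioi (0 : ℝ), M * ‖deriv ξ t‖ ≤
      √(lor (deriv (X ∘ c) t) (deriv (X ∘ c) t)) := by
    intro t ht
    have hnh : Set.Ici (0 : ℝ) ∈ 𝓝 t := Ici_mem_nhds ht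
    have hcd : HasDerivAt (fun t => (c t : ℂ × ℂ)) (deriv (fun t => (c t : ℂ × ℂ)) t) t :=
      ((hc.contDiffAt hnh).differentiableAt one_ne_zero).hasDerivAt
    set d := deriv (fun t => (c t : ℂ × ℂ)) t
    have hξd : HasDerivAt ξ d.1 t :=
      (ContinuousLinearMap.fst ℝ ℂ ℂ).hasFDerivAt.comp_hasDerivAt t hcd
    rw [hξd.deriv]
    -- at the zeros of `y` the curve equation forces `x' = 0`, so nothing has to be shown there
    by_cases hy : (c t : ℂ × ℂ).2 = 0
    · have hηd : HasDerivAt (fun t => (c t : ℂ × ℂ).2) d.2 t :=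
        (ContinuousLinearMap.snd ℝ ℂ ℂ).hasFDerivAt.comp_hasDerivAt t hcd
      have h1 : HasDerivAt (fun t => (c t : ℂ × ℂ).2 ^ 2) 0 t := by
        have : HasDerivAt (fun t => (c t : ℂ × ℂ).2 ^ 2) _ t := hηd.pow 2
        exact this.congr_deriv (by simp [hy])
      have h2 : HasDerivAt (fun t => (c t : ℂ × ℂ).2 ^ 2) ((3 * (c t : ℂ × ℂ).1 ^ 2 - 1) * d.1) t := by
        have : HasDerivAt (fun t => ξ t ^ 3 - ξ t) ((3 * (c t : ℂ × ℂ).1 ^ 2 - 1) * d.1) t := by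
          refine ((hξd.pow 3).sub hξd).congr_deriv ?_
          simp only [hξ]
          push_cast
          ring
        refine this.congr_of_eventuallyEq (Eventually.of_forall fun t => ?_)
        simp only [hξ]
        rw [(c t).2]
        ring
      have h3 : d.1 = 0 := (mul_eq_zero.1 (h2.unique h1)).resolve_left (three_sq_ne_of_y hy)
      rw [h3, norm_zero, mul_zero]
      exact Real.sqrt_nonneg _
    · have h1 := (hasFDerivAt_Xstd ζ hcd.hasFDerivAt hy).add_const v₀
      have h2 : X ∘ c = fun u => Xstd ζ (c u) + v₀ := funext fun u => hX _
      rw [← h2] at h1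
      have h3 : deriv (X ∘ c) t = rv (d.1 • tv ζ (gaussCG (c t)) (gaussCG (c t))⁻¹ 1) := by
        rw [h1.hasDerivAt.deriv]
        simp [rvCLM_apply]
      have hnull : gaussCG (c t) * (gaussCG (c t))⁻¹ = 1 ^ 2 := by
        rw [mul_inv_cancel₀ (gaussCG_ne_zero hy), one_pow]
      have h4 := eForm_ge (ζ := ζ) hnull
      rw [h3, lor_rv_tv h0 hnull, mul_conj, ofReal_re, normSq_eq_norm_sq]
      have h5 : M * ‖d.1‖ = √(8 * (1 + kap ζ) * ‖d.1‖ ^ 2) := by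
        rw [Real.sqrt_mul (by linarith [neg_one_lt_kap hζ]), Real.sqrt_sq (norm_nonneg _)]
      rw [h5]
      refine Real.sqrt_le_sqrt (mul_le_mul_of_nonneg_right ?_ (by positivity))
      simpa using h4
  have hle : ENNReal.ofReal M * ∫⁻ t in Set.Ioi (0 : ℝ), ‖deriv ξ t‖ₑ ≤
      ∫⁻ t in Set.Ioi (0 : ℝ), ENNReal.ofReal (√(lor (deriv (X ∘ c) t) (deriv (X ∘ c) t))) := by
    rw [← lintegral_const_mul' _ _ ENNReal.ofReal_ne_top]
    refine setLIntegral_mono' measurableSet_Ioi fun t ht => ?_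
    rw [← ofReal_norm, ← ENNReal.ofReal_mul hMpos.le]
    exact ENNReal.ofReal_le_ofReal (hpt t ht)
  -- finite length of `x ∘ c` would keep `c` in a compact set
  have htop : ∫⁻ t in Set.Ioi (0 : ℝ), ‖deriv ξ t‖ₑ = ⊤ := by
    by_contra hne
    have hbd : ∀ T, 0 ≤ T → ‖ξ T - ξ 0‖ₑ ≤ ∫⁻ t in Set.Ioi (0 : ℝ), ‖deriv ξ t‖ₑ := by
      intro T hT
      refine (enorm_sub_le_lintegral_deriv_of_contDiffOn_Icc
        (hξC.mono Set.Icc_subset_Ici_self) hT).trans ?_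
      rw [setLIntegral_congr Ioc_ae_eq_Icc.symm]
      exact lintegral_mono_set Set.Ioc_subset_Ioi_self
    have h1 : Tendsto (fun t => ‖ξ t‖) atTop atTop := by
      rw [cocompact_curve, tendsto_comap_iff] at hdiv
      exact hdiv
    obtain ⟨T, hT1, hT2⟩ := ((h1.eventually_gt_atTop
      ((∫⁻ t in Set.Ioi (0 : ℝ), ‖deriv ξ t‖ₑ).toReal + ‖ξ 0‖)).and (eventually_ge_atTop 0)).exists
    have h2 := (ENNReal.toReal_le_toReal (by simp) hne).2 (hbd T hT2)
    rw [toReal_enorm] at h2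
    have h3 := norm_sub_norm_le (ξ T) (ξ 0)
    linarith
  rw [htop, ENNReal.mul_top (by simpa using hMpos)] at hle
  exact top_le_iff.1 hle

lemma norm_gaussCG_sq (p : CGCurve) : ‖gaussCG p‖ ^ 2 =
    ‖(p : ℂ × ℂ).1‖ / (rhoCG ^ 2 * ‖(p : ℂ × ℂ).1 ^ 2 - 1‖) := by
  have h : gaussCG p ^ 2 = (p : ℂ × ℂ).1 / (rhoCG ^ 2 * ((p : ℂ × ℂ).1 ^ 2 - 1)) := by
    rw [gaussCG, div_pow, mul_pow, p.2]
    by_cases hx : (p : ℂ × ℂ).1 = 0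
    · simp [hx]
    · by_cases hx2 : (p : ℂ × ℂ).1 ^ 2 - 1 = 0
      · have : (p : ℂ × ℂ).1 * ((p : ℂ × ℂ).1 - 1) * ((p : ℂ × ℂ).1 + 1) = 0 := by
          linear_combination (p : ℂ × ℂ).1 * hx2
        rw [this, hx2]
        simp
      · have h3 : (p : ℂ × ℂ).1 * ((p : ℂ × ℂ).1 - 1) * ((p : ℂ × ℂ).1 + 1) =
          (p : ℂ × ℂ).1 * ((p : ℂ × ℂ).1 ^ 2 - 1) := by ring
        rw [h3]
        have hr := rhoCG_ne_zero
        field_simp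
  rw [← norm_pow, h, norm_div, norm_mul, norm_pow, norm_real, Real.norm_of_nonneg rhoCG_pos.le]

lemma tendsto_gaussCG : Tendsto gaussCG (cocompact CGCurve) (𝓝 0) := by
  have hr := rhoCG_pos
  have hx : Tendsto (fun p : CGCurve => ‖(p : ℂ × ℂ).1‖) (cocompact CGCurve) atTop := by
    rw [cocompact_curve]
    exact tendsto_comap
  have h1 : Tendsto (fun p : CGCurve => 2 / (rhoCG ^ 2) * ‖(p : ℂ × ℂ).1‖⁻¹) (cocompact CGCurve)
      (𝓝 0) := by
    simpa using (tendsto_inv_atTop_zero.comp hx).const_mul (2 / (rhoCG ^ 2))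
  have h2 : Tendsto (fun p => ‖gaussCG p‖ ^ 2) (cocompact CGCurve) (𝓝 0) := by
    refine tendsto_of_tendsto_of_tendsto_of_le_of_le' tendsto_const_nhds h1
      (Eventually.of_forall fun p => by positivity) ?_
    filter_upwards [hx.eventually_ge_atTop 2] with p hp
    rw [norm_gaussCG_sq]
    have h3 : ‖(p : ℂ × ℂ).1‖ ^ 2 - 1 ≤ ‖(p : ℂ × ℂ).1 ^ 2 - 1‖ := by
      have := norm_sub_norm_le ((p : ℂ × ℂ).1 ^ 2) 1
      rwa [norm_pow, norm_one] at this
    have h4 : ‖(p : ℂ × ℂ).1‖ ^ 2 / 2 ≤ ‖(p : ℂ × ℂ).1 ^ 2 - 1‖ := by nlinarith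
    have h5 : 0 < ‖(p : ℂ × ℂ).1‖ := by linarith
    calc ‖(p : ℂ × ℂ).1‖ / (rhoCG ^ 2 * ‖(p : ℂ × ℂ).1 ^ 2 - 1‖)
        ≤ ‖(p : ℂ × ℂ).1‖ / (rhoCG ^ 2 * (‖(p : ℂ × ℂ).1‖ ^ 2 / 2)) := by gcongr
      _ = _ := by field_simp
  rw [tendsto_zero_iff_norm_tendsto_zero]
  have h3 := h2.sqrt
  simp only [Real.sqrt_zero] at h3
  refine h3.congr fun p => Real.sqrt_sq (norm_nonneg _)

theorem hasRegularEnd {ζ : ℂ} (hζ : ζ.re ≠ 0) : HasRegularEnd (phiCG ζ) (psiCG ζ) := by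
  have h0 : ζ ≠ 0 := fun h => hζ (by simp [h])
  refine ⟨((0 : ℂ) : OnePoint ℂ), OnePoint.infty, ?_, ?_, OnePoint.coe_ne_infty _⟩
  · have : Tendsto (phiCG ζ) (cocompact CGCurve) (𝓝 0) := by
      have h := tendsto_gaussCG.div_const ζ
      rw [zero_div] at h
      exact h
    exact (OnePoint.continuous_coe.tendsto 0).comp this
  · have hx : Tendsto (fun p : CGCurve => ‖(p : ℂ × ℂ).1‖) (cocompact CGCurve) atTop := by
      rw [cocompact_curve]
      exact tendsto_comap
    refine (OnePoint.tendsto_coe_infty (X := ℂ)).comp ?_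
    rw [coclosedCompact_eq_cocompact, ← Metric.cobounded_eq_cocompact (α := ℂ),
      ← tendsto_norm_atTop_iff_cobounded]
    have h1 : Tendsto (fun p => ‖ζ * gaussCG p‖) (cocompact CGCurve) (𝓝[>] 0) := by
      refine tendsto_nhdsWithin_iff.2 ⟨?_, ?_⟩
      · simpa using (tendsto_gaussCG.const_mul ζ).norm
      · filter_upwards [hx.eventually_gt_atTop 1] with p hp
        have hy : (p : ℂ × ℂ).2 ≠ 0 := by
          intro hy
          have h3 := p.2
          rw [hy] at h3
          have : (p : ℂ × ℂ).1 * ((p : ℂ × ℂ).1 - 1) * ((p : ℂ × ℂ).1 + 1) = 0 := by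
            rw [← h3]
            ring
          rcases mul_eq_zero.1 this with h | h
          · rcases mul_eq_zero.1 h with h | h
            · rw [h, norm_zero] at hp
              linarith
            · rw [sub_eq_zero.1 h, norm_one] at hp
              linarith
          · rw [eq_neg_of_add_eq_zero_left h, norm_neg, norm_one] at hp
            linarith
        exact norm_pos_iff.2 (mul_ne_zero h0 (gaussCG_ne_zero hy))
    refine h1.inv_tendsto_nhdsGT_zero.congr fun p => ?_
    simp [psiCG]

end ChenGackstatter

end

noncomputable section

namespace ChenGackstatter

open Complex PeriodPair

/-! ### The Laplacian in the plane -/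

lemma laplacian_of_hasFDerivAt {f : ℂ → ℝ} {A : ℂ → ℂ →L[ℝ] ℝ} {A' : ℂ →L[ℝ] ℂ →L[ℝ] ℝ} {z : ℂ}
    (h1 : ∀ᶠ u in 𝓝 z, HasFDerivAt f (A u) u) (h2 : HasFDerivAt A A' z) :
    Δ f z = A' 1 1 + A' I I := by
  have h3 : fderiv ℝ f =ᶠ[𝓝 z] A := h1.mono fun u hu => hu.fderiv
  rw [InnerProductSpace.laplacian_eq_iteratedFDeriv_complexPlane]
  simp only [iteratedFDeriv_two_apply, h3.fderiv_eq, h2.fderiv]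
  simp

lemma hasFDerivAt_mul_of_hasDerivAt {g : ℂ → ℂ} {g' u : ℂ} (h : HasDerivAt g g' u) :
    HasFDerivAt g (ContinuousLinearMap.mul ℝ ℂ g') u :=
  (h.hasFDerivAt.restrictScalars ℝ).congr_fderiv (by ext v; simp [mul_comm])

/-- The Laplacian transforms under holomorphic maps with the square of the derivative. -/
lemma laplacian_comp {f : ℂ → ℝ} {τ : ℂ → ℂ} {w : ℂ} (hf : ContDiffAt ℝ 2 f (τ w))
    (hτ : AnalyticAt ℂ τ w) : Δ (fun u => f (τ u)) w = ‖deriv τ w‖ ^ 2 * Δ f (τ w) := by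
  have h1 : ∀ᶠ u in 𝓝 w, HasFDerivAt (fun u => f (τ u))
      ((fderiv ℝ f (τ u)).comp (ContinuousLinearMap.mul ℝ ℂ (deriv τ u))) u := by
    have hf1 : ∀ᶠ z in 𝓝 (τ w), DifferentiableAt ℝ f z := by
      filter_upwards [hf.eventually (by simp)] with z hz
      exact hz.differentiableAt (by simp)
    filter_upwards [hτ.continuousAt.eventually hf1, hτ.eventually_analyticAt] with u hu hu'
    exact hu.hasFDerivAt.comp u (hasFDerivAt_mul_of_hasDerivAt hu'.differentiableAt.hasDerivAt)
  have hf2 : HasFDerivAt (fderiv ℝ f) (fderiv ℝ (fderiv ℝ f) (τ w)) (τ w) :=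
    ((hf.fderiv_right (m := 1) (by norm_num)).differentiableAt (by simp)).hasFDerivAt
  have h2 := (hf2.comp w (hasFDerivAt_mul_of_hasDerivAt hτ.differentiableAt.hasDerivAt)).clm_comp
    ((ContinuousLinearMap.mul ℝ ℂ).hasFDerivAt.comp w (hasFDerivAt_mul_of_hasDerivAt hτ.deriv.differentiableAt.hasDerivAt))
  rw [laplacian_of_hasFDerivAt h1 h2, laplacian_of_hasFDerivAt
    ((hf.eventually (by simp)).mono fun z hz => (hz.differentiableAt (by simp)).hasFDerivAt) hf2]
  set B := fderiv ℝ (fderiv ℝ f) (τ w)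
  set t := deriv τ w with ht
  have et : t = (t.re : ℝ) • (1 : ℂ) + (t.im : ℝ) • I := by
    simp [re_add_im]
  have et2 : t * I = (-t.im : ℝ) • (1 : ℂ) + (t.re : ℝ) • I := by
    conv_lhs => rw [et]
    apply Complex.ext <;> simp
  have e1 : B t t = t.re ^ 2 * B 1 1 + t.re * t.im * (B 1 I + B I 1) + t.im ^ 2 * B I I := by
    conv_lhs => rw [et]
    simp only [map_add, map_smul, add_apply, smul_apply, smul_eq_mul]
    ring
  have e2 : B (t * I) (t * I) =
      t.im ^ 2 * B 1 1 - t.re * t.im * (B 1 I + B I 1) + t.re ^ 2 * B I I := by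
    rw [et2]
    simp only [map_add, map_smul, add_apply, smul_apply, smul_eq_mul]
    ring
  have e3 : ‖t‖ ^ 2 = t.re ^ 2 + t.im ^ 2 := by rw [← normSq_eq_norm_sq, normSq_apply]; ring
  have e4 : deriv (deriv τ) w * I * I = - deriv (deriv τ) w := by
    rw [mul_assoc, I_mul_I]
    ring
  simp only [Function.comp_def, add_apply, ContinuousLinearMap.comp_apply,
    ContinuousLinearMap.compL_apply, ContinuousLinearMap.flip_apply, ContinuousLinearMap.mul_apply',
    mul_one, ← ht, e1, e2, e3, e4, map_neg]
  ring

/-- The Laplacian of a function of `‖z‖ ^ 2`. -/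
lemma laplacian_radial {F F₁ : ℝ → ℝ} {F₂ : ℝ} {z : ℂ}
    (h1 : ∀ᶠ t in 𝓝 (‖z‖ ^ 2), HasDerivAt F (F₁ t) t) (h2 : HasDerivAt F₁ F₂ (‖z‖ ^ 2)) :
    Δ (fun z : ℂ => F (‖z‖ ^ 2)) z = 4 * (F₁ (‖z‖ ^ 2) + ‖z‖ ^ 2 * F₂) := by
  have hn : ∀ u : ℂ, HasFDerivAt (fun u : ℂ => ‖u‖ ^ 2) (2 • innerSL ℝ u) u := fun u =>
    (hasStrictFDerivAt_norm_sq u).hasFDerivAt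
  have hA : ∀ᶠ u in 𝓝 z, HasFDerivAt (fun z : ℂ => F (‖z‖ ^ 2))
      (F₁ (‖u‖ ^ 2) • (2 • innerSL ℝ u)) u := by
    have hc : ContinuousAt (fun u : ℂ => ‖u‖ ^ 2) z := (hn z).continuousAt
    filter_upwards [hc.eventually h1] with u hu
    exact hu.comp_hasFDerivAt u (hn u)
  have hA' := (h2.comp_hasFDerivAt z (hn z)).smul (((innerSL ℝ).hasFDerivAt (x := z)).const_smul 2)
  rw [laplacian_of_hasFDerivAt hA hA']
  have e3 : ‖z‖ ^ 2 = z.re ^ 2 + z.im ^ 2 := by rw [← normSq_eq_norm_sq, normSq_apply]; ring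
  have hi : ∀ u v : ℂ, innerSL ℝ u v = u.re * v.re + u.im * v.im := fun u v => by
    rw [innerSL_apply_apply, Complex.inner]
    simp
    ring
  simp [hi]
  rw [e3]
  ring

/-! ### The curvature density of the deformations -/

lemma kap_le_one (ζ : ℂ) : kap ζ ≤ 1 := by
  refine (re_le_norm _).trans ?_
  by_cases h : ζ = 0
  · simp [h]
  · simp [h]

/-- `-K dA`, written in the coordinate `g` given by the Gauss map `G`, as a function of
`t = |g|²`. -/
def curvDens (κ t : ℝ) : ℝ := 4 * (κ * t ^ 2 + 2 * t + κ) / (t ^ 2 + 2 * κ * t + 1) ^ 2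

lemma metricPoly_ge {κ : ℝ} (h1 : κ ≤ 1) (t : ℝ) :
    (1 + κ) / 2 * (1 + t) ^ 2 ≤ t ^ 2 + 2 * κ * t + 1 := by
  nlinarith [mul_nonneg (sub_nonneg.2 h1) (sq_nonneg (t - 1))]

lemma metricPoly_pos {κ : ℝ} (h0 : -1 < κ) (h1 : κ ≤ 1) {t : ℝ} (ht : 0 ≤ t) :
    0 < t ^ 2 + 2 * κ * t + 1 := by
  have : 0 < 1 + κ := by linarith
  exact lt_of_lt_of_le (by positivity) (metricPoly_ge h1 t)

lemma laplacian_log_metricPoly {κ : ℝ} (h0 : -1 < κ) (h1 : κ ≤ 1) (z : ℂ) :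
    Δ (fun z : ℂ => Real.log ((‖z‖ ^ 2) ^ 2 + 2 * κ * ‖z‖ ^ 2 + 1)) z =
      2 * curvDens κ (‖z‖ ^ 2) := by
  have hf : ∀ t : ℝ, HasDerivAt (fun t => t ^ 2 + 2 * κ * t + 1) (2 * t + 2 * κ) t := fun t => by
    have := (((hasDerivAt_id t).pow 2).add ((hasDerivAt_id t).const_mul (2 * κ))).add_const (1 : ℝ)
    refine this.congr_deriv (by simp)
  have hp := metricPoly_pos h0 h1 (sq_nonneg ‖z‖)
  have hev : ∀ᶠ t in 𝓝 (‖z‖ ^ 2), 0 < t ^ 2 + 2 * κ * t + 1 :=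
    (hf _).continuousAt.eventually (lt_mem_nhds hp)
  have hd1 : ∀ᶠ t in 𝓝 (‖z‖ ^ 2), HasDerivAt (fun t => Real.log (t ^ 2 + 2 * κ * t + 1))
      ((2 * t + 2 * κ) / (t ^ 2 + 2 * κ * t + 1)) t :=
    hev.mono fun t ht => (hf t).log ht.ne'
  have hd2 : HasDerivAt (fun t => (2 * t + 2 * κ) / (t ^ 2 + 2 * κ * t + 1)) _ (‖z‖ ^ 2) :=
    (((hasDerivAt_id (‖z‖ ^ 2)).const_mul 2).add_const (2 * κ)).div (hf _) hp.ne'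
  rw [laplacian_radial (F := fun t => Real.log (t ^ 2 + 2 * κ * t + 1)) hd1 hd2, curvDens]
  set t := ‖z‖ ^ 2
  simp only [id]
  have := hp.ne'
  field_simp
  ring

lemma abs_curvDens_le {κ : ℝ} (h0 : -1 < κ) (h1 : κ ≤ 1) {t : ℝ} (ht : 0 ≤ t) :
    |curvDens κ t| ≤ 16 / (1 + κ) ^ 2 * ((1 + t) ^ 2)⁻¹ := by
  have hk : 0 < 1 + κ := by linarith
  have hp := metricPoly_pos h0 h1 ht
  have hge := metricPoly_ge h1 t
  have hnum : |4 * (κ * t ^ 2 + 2 * t + κ)| ≤ 4 * (1 + t) ^ 2 := by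
    rw [abs_le]
    constructor <;> nlinarith [sq_nonneg t, mul_nonneg hk.le (sq_nonneg t)]
  rw [curvDens, abs_div, abs_of_pos (pow_pos hp 2)]
  calc |4 * (κ * t ^ 2 + 2 * t + κ)| / (t ^ 2 + 2 * κ * t + 1) ^ 2
      ≤ 4 * (1 + t) ^ 2 / ((1 + κ) / 2 * (1 + t) ^ 2) ^ 2 := by gcongr
    _ = _ := by field_simp; norm_num

lemma continuousOn_curvDens {κ : ℝ} (h0 : -1 < κ) (h1 : κ ≤ 1) :
    ContinuousOn (curvDens κ) (Set.Ici 0) := by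
  unfold curvDens
  refine ContinuousOn.div (by fun_prop) (by fun_prop) fun t ht => ?_
  exact (pow_pos (metricPoly_pos h0 h1 ht) 2).ne'

lemma continuous_curvDens {κ : ℝ} (h0 : -1 < κ) (h1 : κ ≤ 1) :
    Continuous fun z : ℂ => curvDens κ (‖z‖ ^ 2) :=
  (continuousOn_curvDens h0 h1).comp_continuous (by fun_prop) fun z => sq_nonneg ‖z‖

lemma integrable_curvDens {κ : ℝ} (h0 : -1 < κ) (h1 : κ ≤ 1) :
    Integrable fun z : ℂ => curvDens κ (‖z‖ ^ 2) := by
  have h := (integrable_rpow_neg_one_add_norm_sq (E := ℂ) (μ := volume) (r := 4)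
    (by rw [finrank_real_complex]; norm_num)).const_mul (16 / (1 + κ) ^ 2)
  refine h.mono' (continuous_curvDens h0 h1).aestronglyMeasurable (Eventually.of_forall fun z => ?_)
  refine (abs_curvDens_le h0 h1 (sq_nonneg ‖z‖)).trans (le_of_eq ?_)
  rw [show (-4 / 2 : ℝ) = -(2 : ℕ) by norm_num, Real.rpow_neg (by positivity), Real.rpow_natCast]

/-- The total curvature of one sheet. -/
lemma integral_curvDens {κ : ℝ} (h0 : -1 < κ) (h1 : κ ≤ 1) :
    ∫ z : ℂ, curvDens κ (‖z‖ ^ 2) = 4 * Real.pi := by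
  have hint := integrable_curvDens h0 h1
  rw [integrable_fun_norm_addHaar volume (f := fun r => curvDens κ (r ^ 2))] at hint
  rw [integral_fun_norm_addHaar volume (f := fun r => curvDens κ (r ^ 2))]
  simp only [finrank_real_complex, Nat.add_one_sub_one, pow_one, smul_eq_mul] at hint ⊢
  -- a primitive of `r Ω(r²)`
  have hd : ∀ r ∈ Set.Ici (0 : ℝ), HasDerivAt
      (fun r => (2 * r ^ 4 + 2 * κ * r ^ 2) / ((r ^ 2) ^ 2 + 2 * κ * r ^ 2 + 1))
      (r * curvDens κ (r ^ 2)) r := by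
    intro r _
    have hp := metricPoly_pos h0 h1 (sq_nonneg r)
    have hN : HasDerivAt (fun r => 2 * r ^ 4 + 2 * κ * r ^ 2) (8 * r ^ 3 + 4 * κ * r) r := by
      refine (((hasDerivAt_pow 4 r).const_mul 2).add
        ((hasDerivAt_pow 2 r).const_mul (2 * κ))).congr_deriv ?_
      norm_num
      ring
    have hD : HasDerivAt (fun r => (r ^ 2) ^ 2 + 2 * κ * r ^ 2 + 1) (4 * r ^ 3 + 4 * κ * r) r := by
      refine ((((hasDerivAt_pow 2 r).pow 2).add
        ((hasDerivAt_pow 2 r).const_mul (2 * κ))).add_const 1).congr_deriv ?_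
      norm_num
      ring
    refine (hN.div hD hp.ne').congr_deriv ?_
    rw [curvDens]
    have := hp.ne'
    field_simp
    ring
  have hlim : Tendsto (fun r : ℝ => (2 * r ^ 4 + 2 * κ * r ^ 2) / ((r ^ 2) ^ 2 + 2 * κ * r ^ 2 + 1))
      atTop (𝓝 2) := by
    have hi : Tendsto (fun r : ℝ => (r ^ 2)⁻¹) atTop (𝓝 0) :=
      tendsto_inv_atTop_zero.comp (tendsto_pow_atTop two_ne_zero)
    have h2 : Tendsto (fun r : ℝ => (2 + 2 * κ * (r ^ 2)⁻¹) /
        (1 + 2 * κ * (r ^ 2)⁻¹ + (r ^ 2)⁻¹ ^ 2)) atTop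
        (𝓝 ((2 + 2 * κ * 0) / (1 + 2 * κ * 0 + 0 ^ 2))) := by
      refine Tendsto.div ?_ ?_ (by norm_num)
      · exact (hi.const_mul (2 * κ)).const_add 2
      · exact ((hi.const_mul (2 * κ)).const_add 1).add (hi.pow 2)
    norm_num at h2
    refine h2.congr' ?_
    filter_upwards [eventually_gt_atTop 0] with r hr
    have hp := (metricPoly_pos h0 h1 (sq_nonneg r)).ne'
    have : 1 + 2 * κ * (r ^ 2)⁻¹ + ((r ^ 2)⁻¹) ^ 2 =
        ((r ^ 2) ^ 2 + 2 * κ * r ^ 2 + 1) / r ^ 4 := by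
      field_simp
    norm_num at this
    rw [this]
    field_simp
  rw [integral_Ioi_of_hasDerivAt_of_tendsto' hd hint hlim]
  simp
  rw [Measure.real, Complex.volume_ball]
  simp
  ring

end ChenGackstatter

end

noncomputable section

namespace ChenGackstatter

open Complex PeriodPair

/-! ### The complex square root -/

/-- The principal branch of the square root. -/
def csqrt (z : ℂ) : ℂ := z ^ ((2 : ℕ) : ℂ)⁻¹

lemma csqrt_sq (z : ℂ) : csqrt z ^ 2 = z := cpow_nat_inv_pow _ two_ne_zero

lemma csqrt_re_pos {z : ℂ} (h : z ∈ slitPlane) : 0 < (csqrt z).re := by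
  rw [csqrt, cpow_def_of_ne_zero (slitPlane_ne_zero h), exp_re]
  refine mul_pos (Real.exp_pos _) (Real.cos_pos_of_mem_Ioo ?_)
  have h1 := (mem_slitPlane_iff_arg.1 h).1
  have h2 := neg_pi_lt_arg z
  have h3 := lt_of_le_of_ne (arg_le_pi z) h1
  have h4 : (log z * ((2 : ℕ) : ℂ)⁻¹).im = arg z / 2 := by
    rw [show ((2 : ℕ) : ℂ)⁻¹ = ((2⁻¹ : ℝ) : ℂ) by push_cast; rfl, im_mul_ofReal, log_im]
    rfl
  rw [h4]
  constructor <;> linarith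

lemma sq_mem_slitPlane {q : ℂ} (hq : q.re ≠ 0) : q ^ 2 ∈ slitPlane := by
  rw [mem_slitPlane_iff]
  by_cases h : q.im = 0
  · left
    simp [pow_two, h]
    positivity
  · right
    have h2 : (q ^ 2).im = 2 * (q.re * q.im) := by
      simp [pow_two]
      ring
    rw [h2]
    exact mul_ne_zero two_ne_zero (mul_ne_zero hq h)

/-! ### The two sheets of the Gauss map -/

/-- The plane without `0` and without the slits over which the two sheets of the Gauss map meet. -/
def sheetDom : Set ℂ := {g | g ≠ 0 ∧ 1 + 4 * (rhoCG : ℂ) ^ 4 * g ^ 4 ∈ slitPlane}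

/-- The square root of the discriminant of the quadratic equation `ρ² g² (x² - 1) = x`. -/
def sheetRoot (g : ℂ) : ℂ := csqrt (1 + 4 * (rhoCG : ℂ) ^ 4 * g ^ 4)

/-- The solutions `x` of `ρ² g² (x² - 1) = x`, where the sign `s = ±1` selects the solution. -/
def sheetX (s g : ℂ) : ℂ := (1 + s * sheetRoot g) / (2 * rhoCG ^ 2 * g ^ 2)

lemma isOpen_sheetDom : IsOpen sheetDom := by
  have h : Continuous fun g : ℂ => 1 + 4 * (rhoCG : ℂ) ^ 4 * g ^ 4 := by fun_prop
  exact isOpen_ne.inter (isOpen_slitPlane.preimage h)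

lemma sheetRoot_sq (g : ℂ) : sheetRoot g ^ 2 = 1 + 4 * (rhoCG : ℂ) ^ 4 * g ^ 4 := csqrt_sq _

lemma sheetRoot_re_pos {g : ℂ} (hg : g ∈ sheetDom) : 0 < (sheetRoot g).re := csqrt_re_pos hg.2

lemma sheetX_eq {s g : ℂ} (hs : s ^ 2 = 1) (hg : g ≠ 0) :
    (rhoCG : ℂ) ^ 2 * g ^ 2 * (sheetX s g ^ 2 - 1) = sheetX s g := by
  have hr := rhoCG_ne_zero
  have h := sheetRoot_sq g
  rw [sheetX]
  field_simp
  linear_combination sheetRoot g ^ 2 * hs + h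

lemma sheetX_ne_zero {s g : ℂ} (hs : s ^ 2 = 1) (hg : g ≠ 0) : sheetX s g ≠ 0 := by
  intro h
  have h1 := sheetX_eq hs hg
  rw [h] at h1
  have := mul_ne_zero (pow_ne_zero 2 rhoCG_ne_zero) (pow_ne_zero 2 hg)
  exact this (by linear_combination -h1)

lemma norm_sheetX_mul {g : ℂ} (hg : g ≠ 0) : ‖sheetX 1 g‖ * ‖sheetX (-1) g‖ = 1 := by
  have hr := rhoCG_ne_zero
  have h := sheetRoot_sq g
  have : sheetX 1 g * sheetX (-1) g = -1 := by
    rw [sheetX, sheetX]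
    field_simp
    linear_combination -h
  rw [← norm_mul, this, norm_neg, norm_one]

lemma norm_sheetX_lt {g : ℂ} (hg : g ∈ sheetDom) : ‖sheetX (-1) g‖ < ‖sheetX 1 g‖ := by
  rw [sheetX, sheetX, norm_div, norm_div]
  have h0 : 0 < ‖2 * (rhoCG : ℂ) ^ 2 * g ^ 2‖ := norm_pos_iff.2
    (mul_ne_zero (mul_ne_zero two_ne_zero (pow_ne_zero 2 rhoCG_ne_zero)) (pow_ne_zero 2 hg.1))
  refine div_lt_div_of_pos_right ?_ h0
  have hp := sheetRoot_re_pos hg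
  refine lt_of_pow_lt_pow_left₀ 2 (norm_nonneg _) ?_
  rw [← normSq_eq_norm_sq, ← normSq_eq_norm_sq, normSq_apply, normSq_apply]
  simp
  nlinarith

lemma one_lt_norm_sheetX {g : ℂ} (hg : g ∈ sheetDom) : 1 < ‖sheetX 1 g‖ := by
  nlinarith [norm_sheetX_mul hg.1, norm_sheetX_lt hg, norm_nonneg (sheetX (-1) g)]

lemma norm_sheetX_neg_lt_one {g : ℂ} (hg : g ∈ sheetDom) : ‖sheetX (-1) g‖ < 1 := by
  nlinarith [norm_sheetX_mul hg.1, norm_sheetX_lt hg, norm_nonneg (sheetX (-1) g)]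

/-- The set of `x`-values of a sheet: `|x| > 1` for the sign `1` and `|x| < 1` for `-1`. -/
def sheetRange (s : ℂ) : Set ℂ := {x | 0 < s.re * (‖x‖ - 1)}

lemma isOpen_sheetRange (s : ℂ) : IsOpen (sheetRange s) :=
  isOpen_lt continuous_const (by fun_prop)

lemma sheetX_mem_sheetRange {s g : ℂ} (hs : s = 1 ∨ s = -1) (hg : g ∈ sheetDom) :
    sheetX s g ∈ sheetRange s := by
  rcases hs with rfl | rfl
  · simpa [sheetRange] using one_lt_norm_sheetX hg
  · simpa [sheetRange] using norm_sheetX_neg_lt_one hg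

lemma sq_eq_one_of_sign {s : ℂ} (hs : s = 1 ∨ s = -1) : s ^ 2 = 1 := by
  rcases hs with rfl | rfl <;> norm_num

open Classical in
/-- The sheet with sign `s = ±1`, parametrized by the Gauss map. -/
def sheet (s g : ℂ) : CGCurve :=
  if h : g ∈ sheetDom ∧ s ^ 2 = 1 then ⟨(sheetX s g, sheetX s g / (rhoCG * g)), by
    have hg := h.1.1
    have h1 := sheetX_eq h.2 hg
    have hr := rhoCG_ne_zero
    simp only
    field_simp
    linear_combination -sheetX s g * h1⟩
  else ⟨(0, 0), by simp⟩

lemma coe_sheet {s g : ℂ} (hs : s = 1 ∨ s = -1) (hg : g ∈ sheetDom) :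
    (sheet s g : ℂ × ℂ) = (sheetX s g, sheetX s g / (rhoCG * g)) := by
  rw [sheet, dif_pos ⟨hg, sq_eq_one_of_sign hs⟩]

lemma sheet_snd_ne_zero {s g : ℂ} (hs : s = 1 ∨ s = -1) (hg : g ∈ sheetDom) :
    (sheet s g : ℂ × ℂ).2 ≠ 0 := by
  rw [coe_sheet hs hg]
  exact div_ne_zero (sheetX_ne_zero (sq_eq_one_of_sign hs) hg.1) (mul_ne_zero rhoCG_ne_zero hg.1)

lemma gaussCG_sheet {s g : ℂ} (hs : s = 1 ∨ s = -1) (hg : g ∈ sheetDom) :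
    gaussCG (sheet s g) = g := by
  have h := sheetX_ne_zero (sq_eq_one_of_sign hs) hg.1
  have hr := rhoCG_ne_zero
  rw [gaussCG, coe_sheet hs hg]
  field_simp

lemma measurable_sheetX (s : ℂ) : Measurable (sheetX s) := by
  unfold sheetX sheetRoot csqrt
  fun_prop

lemma measurable_sheet {s : ℂ} (hs : s = 1 ∨ s = -1) : Measurable (sheet s) := by
  classical
  have h : Measurable fun g => (sheet s g : ℂ × ℂ) := by
    have e : (fun g => (sheet s g : ℂ × ℂ)) =
        fun g => if g ∈ sheetDom then (sheetX s g, sheetX s g / (rhoCG * g)) else (0, 0) := by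
      funext g
      by_cases hg : g ∈ sheetDom
      · rw [coe_sheet hs hg, if_pos hg]
      · rw [sheet, dif_neg fun h => hg h.1, if_neg hg]
    rw [e]
    refine Measurable.ite isOpen_sheetDom.measurableSet ?_ measurable_const
    exact (measurable_sheetX s).prodMk ((measurable_sheetX s).div (by fun_prop))
  exact h.subtype_mk (h := fun g => (sheet s g).2)

lemma differentiableOn_sheetX (s : ℂ) : DifferentiableOn ℂ (sheetX s) sheetDom := by
  intro g hg
  have h1 : DifferentiableAt ℂ sheetRoot g := by
    unfold sheetRoot csqrt
    refine DifferentiableAt.cpow (by fun_prop) (differentiableAt_const _) hg.2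
  have h0 : 2 * (rhoCG : ℂ) ^ 2 * g ^ 2 ≠ 0 :=
    mul_ne_zero (mul_ne_zero two_ne_zero (pow_ne_zero 2 rhoCG_ne_zero)) (pow_ne_zero 2 hg.1)
  have h2 : DifferentiableAt ℂ (sheetX s) g := by
    unfold sheetX
    fun_prop (disch := exact h0)
  exact h2.differentiableWithinAt

lemma differentiableAt_gauss {p : ℂ × ℂ} (hy : p.2 ≠ 0) :
    DifferentiableAt ℂ (fun p : ℂ × ℂ => p.1 / (rhoCG * p.2)) p := by
  have : (rhoCG : ℂ) * p.2 ≠ 0 := mul_ne_zero rhoCG_ne_zero hy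
  fun_prop (disch := exact this)

lemma isParam_sheet {s : ℂ} (hs : s = 1 ∨ s = -1) : IsParam (sheet s) sheetDom := by
  have hd : DifferentiableOn ℂ (fun g => (sheet s g : ℂ × ℂ)) sheetDom := by
    refine DifferentiableOn.congr (f := fun g => (sheetX s g, sheetX s g / (rhoCG * g))) ?_
      fun g hg => coe_sheet hs hg
    refine (differentiableOn_sheetX s).prodMk ((differentiableOn_sheetX s).div (by fun_prop) ?_)
    exact fun g hg => mul_ne_zero rhoCG_ne_zero hg.1
  refine ⟨isOpen_sheetDom, hd, fun g hg h0 => ?_, fun g hg g' hg' h => ?_⟩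
  · have hnh := isOpen_sheetDom.mem_nhds hg
    have h1 := (hd.differentiableAt hnh).hasDerivAt
    rw [h0] at h1
    have h2 := (differentiableAt_gauss (sheet_snd_ne_zero hs hg)).hasFDerivAt.comp_hasDerivAt g h1
    rw [map_zero] at h2
    have h3 : HasDerivAt (fun g => g) 0 g := h2.congr_of_eventuallyEq (by
      filter_upwards [hnh] with u hu
      exact (gaussCG_sheet hs hu).symm)
    exact one_ne_zero ((hasDerivAt_id g).unique h3)
  · rw [← gaussCG_sheet hs hg, ← gaussCG_sheet hs hg', h]

/-- The sheets cover the curve except for the points with `|x| = 1` or `y = 0`. -/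
lemma sheet_gaussCG {s : ℂ} (hs : s = 1 ∨ s = -1) {p : CGCurve} (hy : (p : ℂ × ℂ).2 ≠ 0)
    (hx : (p : ℂ × ℂ).1 ∈ sheetRange s) :
    gaussCG p ∈ sheetDom ∧ sheet s (gaussCG p) = p := by
  have hr := rhoCG_ne_zero
  have hg0 := gaussCG_ne_zero hy
  have hx0 := x_ne_zero_of_y hy
  set x := (p : ℂ × ℂ).1 with hxd
  have hgy : gaussCG p * (rhoCG * (p : ℂ × ℂ).2) = x := div_mul_cancel₀ _ (mul_ne_zero hr hy)
  have hp : (p : ℂ × ℂ).2 ^ 2 = x * (x - 1) * (x + 1) := p.2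
  have hx1 : x ^ 2 - 1 ≠ 0 := by
    intro h
    refine pow_ne_zero 2 hy ?_
    rw [hp]
    linear_combination x * h
  have hg2 : gaussCG p ^ 2 = x / (rhoCG ^ 2 * (x ^ 2 - 1)) := by
    have : gaussCG p ^ 2 * (rhoCG ^ 2 * (p : ℂ × ℂ).2 ^ 2) = x ^ 2 := by rw [← hgy]; ring
    rw [hp] at this
    field_simp
    refine mul_left_cancel₀ hx0 ?_
    linear_combination this
  set q := (x ^ 2 + 1) / (x ^ 2 - 1) with hq
  have hdisc : 1 + 4 * (rhoCG : ℂ) ^ 4 * gaussCG p ^ 4 = q ^ 2 := by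
    rw [show gaussCG p ^ 4 = (gaussCG p ^ 2) ^ 2 by ring, hg2, hq]
    field_simp
    ring
  have hqre : q.re = (‖x‖ ^ 4 - 1) / normSq (x ^ 2 - 1) := by
    rw [hq, div_re, ← add_div, show ‖x‖ ^ 4 = (‖x‖ ^ 2) ^ 2 by ring, ← normSq_eq_norm_sq,
      normSq_apply]
    congr 1
    simp [pow_two, normSq_apply]
    ring
  have hN : 0 < normSq (x ^ 2 - 1) := normSq_pos.2 hx1
  have hsq : 0 < s.re * q.re := by
    rw [hqre, ← mul_div_assoc]
    refine div_pos ?_ hN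
    have h1 : 0 < s.re * (‖x‖ - 1) := hx
    have h2 : s.re * (‖x‖ ^ 4 - 1) = s.re * (‖x‖ - 1) * ((‖x‖ + 1) * (‖x‖ ^ 2 + 1)) := by ring
    rw [h2]
    positivity
  have hqne : q.re ≠ 0 := fun h => by simp [h] at hsq
  have hD : gaussCG p ∈ sheetDom := by
    refine ⟨hg0, ?_⟩
    rw [hdisc]
    exact sq_mem_slitPlane hqne
  refine ⟨hD, ?_⟩
  have hR : sheetRoot (gaussCG p) = s * q := by
    have h1 : sheetRoot (gaussCG p) ^ 2 = (s * q) ^ 2 := by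
      rw [sheetRoot_sq, hdisc, mul_pow, sq_eq_one_of_sign hs, one_mul]
    rcases sq_eq_sq_iff_eq_or_eq_neg.1 h1 with h | h
    · exact h
    · exfalso
      have h2 := sheetRoot_re_pos hD
      have h3 : (s * q).re = s.re * q.re := by rcases hs with rfl | rfl <;> simp
      rw [h, neg_re, h3] at h2
      linarith
  have hX : sheetX s (gaussCG p) = x := by
    rw [sheetX, hR, ← mul_assoc, ← pow_two, sq_eq_one_of_sign hs, mul_assoc, hg2, hq]
    field_simp
    ring
  refine Subtype.ext (Prod.ext ?_ ?_)
  · rw [coe_sheet hs hD]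
    exact hX
  · rw [coe_sheet hs hD]
    simp only
    rw [hX, ← hgy]
    field_simp

/-! ### Null sets -/

/-- The preimage of a null set under a holomorphic map is a null set, outside the critical
points. -/
lemma volume_preimage_null {h : ℂ → ℂ} {S N : Set ℂ} (hN : volume N = 0)
    (hS : ∀ w ∈ S, AnalyticAt ℂ h w ∧ deriv h w ≠ 0 ∧ h w ∈ N) : volume S = 0 := by
  refine measure_null_of_locally_null S fun w hw => ?_
  obtain ⟨ha, hd, -⟩ := hS w hw
  have hst : HasStrictDerivAt h (deriv h w) w := ha.hasStrictDerivAt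
  set k := hst.localInverse _ _ _ hd with hk
  have hka : AnalyticAt ℂ k (h w) := ha.analyticAt_localInverse hd
  have hleft : ∀ᶠ u in 𝓝 w, k (h u) = u := hst.eventually_left_inverse hd
  obtain ⟨V, hV, hVo, hwV⟩ := eventually_nhds_iff.1 hka.eventually_analyticAt
  have hdV : DifferentiableOn ℝ k V := fun z hz =>
    ((hV z hz).differentiableAt.restrictScalars ℝ).differentiableWithinAt
  have hnull : volume (k '' (N ∩ V)) = 0 :=
    addHaar_image_eq_zero_of_differentiableOn_of_addHaar_eq_zero volume
      (hdV.mono Set.inter_subset_right) (measure_mono_null Set.inter_subset_left hN)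
  refine ⟨k '' (N ∩ V), ?_, hnull⟩
  have hVn : ∀ᶠ u in 𝓝 w, h u ∈ V := ha.continuousAt.eventually (hVo.mem_nhds hwV)
  filter_upwards [nhdsWithin_le_nhds hleft, nhdsWithin_le_nhds hVn, self_mem_nhdsWithin]
    with u h1 h2 h3
  exact ⟨h u, ⟨(hS u h3).2.2, h2⟩, h1⟩

lemma volume_compl_sheetDom : volume sheetDomᶜ = 0 := by
  have hline : volume {z : ℂ | z.im = 0} = 0 := by
    have := Measure.addHaar_submodule volume (LinearMap.ker imLm) (fun h => by
      have h1 : I ∈ LinearMap.ker imLm := by rw [h]; trivial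
      simp at h1)
    exact this
  have h1 : volume {g : ℂ | g ≠ 0 ∧ (1 + 4 * (rhoCG : ℂ) ^ 4 * g ^ 4).im = 0} = 0 := by
    refine volume_preimage_null (h := fun g => 1 + 4 * (rhoCG : ℂ) ^ 4 * g ^ 4) hline
      fun g hg => ⟨by fun_prop, ?_, hg.2⟩
    have : HasDerivAt (fun g => 1 + 4 * (rhoCG : ℂ) ^ 4 * g ^ 4)
        (4 * (rhoCG : ℂ) ^ 4 * (4 * g ^ 3)) g := by
      have := ((hasDerivAt_pow 4 g).const_mul (4 * (rhoCG : ℂ) ^ 4)).const_add 1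
      simpa using this
    rw [this.deriv]
    have hr := rhoCG_ne_zero
    have hg0 := hg.1
    simp [hr, hg0]
  refine measure_mono_null ?_ (measure_union_null h1 (measure_singleton (0 : ℂ)))
  intro g hg
  by_cases h0 : g = 0
  · exact Or.inr h0
  · refine Or.inl ⟨h0, ?_⟩
    by_contra him
    exact hg ⟨h0, mem_slitPlane_iff.2 (Or.inr him)⟩

end ChenGackstatter

end

noncomputable section

namespace ChenGackstatter

open Complex PeriodPair

/-! ### The area measure -/

/-- The area density of the deformation in the coordinate `g` of a sheet. -/
def sheetDens (ζ s g : ℂ) : ℝ := eForm ζ g g⁻¹ 1 * ‖deriv (sheetX s) g‖ ^ 2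

lemma measurable_sheetDens (ζ s : ℂ) : Measurable (sheetDens ζ s) := by
  have := measurable_deriv (sheetX s)
  unfold sheetDens eForm
  fun_prop

/-- The area measure of one sheet. -/
def sheetArea (ζ s : ℂ) : Measure CGCurve :=
  ((volume.restrict sheetDom).withDensity fun g => ((sheetDens ζ s g).toNNReal : ENNReal)).map
    (sheet s)

/-- The area measure of the deformation: the curves `|x| = 1` separating the sheets are null. -/
def areaMeasure (ζ : ℂ) : Measure CGCurve := sheetArea ζ 1 + sheetArea ζ (-1)

lemma sheetArea_apply (ζ : ℂ) {s : ℂ} (hs : s = 1 ∨ s = -1) {B : Set CGCurve}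
    (hB : MeasurableSet B) : sheetArea ζ s B =
      ∫⁻ g in sheet s ⁻¹' B ∩ sheetDom, ENNReal.ofReal (sheetDens ζ s g) := by
  have hm := measurable_sheet hs hB
  rw [sheetArea, Measure.map_apply (measurable_sheet hs) hB, withDensity_apply _ hm,
    Measure.restrict_restrict hm]
  rfl

lemma det_mul (c : ℂ) : (ContinuousLinearMap.mul ℝ ℂ c).det = ‖c‖ ^ 2 := by
  rw [← normSq_eq_norm_sq, ← Algebra.norm_complex_apply, Algebra.norm_apply]
  rfl

section

variable {ζ : ℂ} {X : CGCurve → R41} {v₀ : R41} {γ : ℂ → CGCurve} {U : Set ℂ}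

lemma deriv_x_ne_zero (hγ : IsParam γ U) {w : ℂ} (hw : w ∈ U) (hy : (γ w : ℂ × ℂ).2 ≠ 0) :
    deriv (fun w => (γ w : ℂ × ℂ).1) w ≠ 0 := by
  intro h0
  have h1 : (1 : ℂ).re ≠ 0 := by simp
  have h2 := ((isStationarySurface h1 (X := Xstd 1) (v₀ := 0) (by simp)).1 γ U hγ).2 w hw 1
    one_ne_zero
  rw [firstFF_eq_of_y h1 (v₀ := 0) (by simp) hγ hw hy, h0] at h2
  simp at h2

/-- The part of the domain of a parametrization that is mapped to a sheet. -/
def sheetPart (γ : ℂ → CGCurve) (U : Set ℂ) (s : ℂ) : Set ℂ :=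
  {w ∈ U | (γ w : ℂ × ℂ).2 ≠ 0 ∧ (γ w : ℂ × ℂ).1 ∈ sheetRange s}

lemma isOpen_sheetPart (hγ : IsParam γ U) (s : ℂ) : IsOpen (sheetPart γ U s) := by
  have h1 : IsOpen {p : ℂ × ℂ | p.2 ≠ 0 ∧ p.1 ∈ sheetRange s} :=
    (isOpen_ne.preimage continuous_snd).inter ((isOpen_sheetRange s).preimage continuous_fst)
  exact hγ.holo.continuousOn.isOpen_inter_preimage hγ.isOpen h1

lemma hasDerivAt_gauss (hγ : IsParam γ U) {w : ℂ} (hw : w ∈ U) (hy : (γ w : ℂ × ℂ).2 ≠ 0) :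
    HasDerivAt (fun w => gaussCG (γ w)) (deriv (fun w => gaussCG (γ w)) w) w :=
  have h : DifferentiableAt ℂ (fun w => gaussCG (γ w)) w :=
    DifferentiableAt.comp w (g := fun p : ℂ × ℂ => p.1 / (rhoCG * p.2))
      (differentiableAt_gauss hy) (IsParam.hasDerivAt hγ hw).differentiableAt
  h.hasDerivAt

/-- The change of variables formula between a parametrization and a sheet. -/
lemma lintegral_sheet (hζ : ζ.re ≠ 0) (hX : ∀ p, X p = Xstd ζ p + v₀) (hγ : IsParam γ U) {s : ℂ}
    (hs : s = 1 ∨ s = -1) {A : Set ℂ} (hA : MeasurableSet A) (hAU : A ⊆ U) :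
    sheetArea ζ s (γ '' A) = ∫⁻ w in A ∩ sheetPart γ U s, ENNReal.ofReal (Real.sqrt
      (firstFF (X ∘ γ) w 1 1 * firstFF (X ∘ γ) w Complex.I Complex.I
        - firstFF (X ∘ γ) w 1 Complex.I ^ 2)) := by
  set T := A ∩ sheetPart γ U s with hT
  have hTm : MeasurableSet T := hA.inter (isOpen_sheetPart hγ s).measurableSet
  have hcont : ContinuousOn γ U :=
    Topology.IsInducing.subtypeVal.continuousOn_iff.2 hγ.holo.continuousOn
  have hBm : MeasurableSet (γ '' A) :=
    hA.image_of_continuousOn_injOn (hcont.mono hAU) (hγ.inj.mono hAU)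
  have himg : sheet s ⁻¹' (γ '' A) ∩ sheetDom = (fun w => gaussCG (γ w)) '' T := by
    ext g
    constructor
    · rintro ⟨⟨w, hw, hwg⟩, hg⟩
      refine ⟨w, ⟨hw, hAU hw, ?_, ?_⟩, ?_⟩
      · rw [hwg]
        exact sheet_snd_ne_zero hs hg
      · rw [hwg, coe_sheet hs hg]
        exact sheetX_mem_sheetRange hs hg
      · simp only
        rw [hwg, gaussCG_sheet hs hg]
    · rintro ⟨w, ⟨hw, -, hy, hx⟩, rfl⟩
      obtain ⟨h1, h2⟩ := sheet_gaussCG hs hy hx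
      exact ⟨⟨w, hw, h2.symm⟩, h1⟩
  have hinj : Set.InjOn (fun w => gaussCG (γ w)) T := by
    rintro w ⟨-, hw, hy, hx⟩ w' ⟨-, hw', hy', hx'⟩ h
    refine hγ.inj hw hw' ?_
    rw [← (sheet_gaussCG hs hy hx).2, ← (sheet_gaussCG hs hy' hx').2]
    exact congrArg _ h
  rw [sheetArea_apply ζ hs hBm, himg,
    lintegral_image_eq_lintegral_abs_det_fderiv_mul volume hTm
      (fun w hw => (hasFDerivAt_mul_of_hasDerivAt
        (hasDerivAt_gauss hγ hw.2.1 hw.2.2.1)).hasFDerivWithinAt) hinj]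
  refine setLIntegral_congr_fun hTm fun w hw => ?_
  obtain ⟨-, hw⟩ := hw
  obtain ⟨hwU, hy, hx⟩ := hw
  have hgD := (sheet_gaussCG hs hy hx).1
  -- the coordinate `x` as a function of the parameter
  have hder : deriv (fun w => (γ w : ℂ × ℂ).1) w =
      deriv (sheetX s) (gaussCG (γ w)) * deriv (fun w => gaussCG (γ w)) w := by
    have h1 : HasDerivAt (sheetX s ∘ fun w => gaussCG (γ w)) _ w :=
      ((differentiableOn_sheetX s).differentiableAt
        (isOpen_sheetDom.mem_nhds hgD)).hasDerivAt.comp w (hasDerivAt_gauss hγ hwU hy)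
    refine (h1.congr_of_eventuallyEq ?_).deriv
    filter_upwards [(isOpen_sheetPart hγ s).mem_nhds ⟨hwU, hy, hx⟩] with u hu
    have h2 := sheet_gaussCG hs hu.2.1 hu.2.2
    conv_lhs => rw [← h2.2, coe_sheet hs h2.1]
    rfl
  have he := eForm_pos (ζ := ζ) (a := gaussCG (γ w)) (b := (gaussCG (γ w))⁻¹) (c := 1) hζ
    (by rw [mul_inv_cancel₀ hgD.1, one_pow]) (Or.inl hgD.1)
  have hff := firstFF_eq_of_y hζ hX hγ hwU hy
  have e1 : ((1 : ℂ) * conj I).re = 0 := by simp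
  have e2 : ((1 : ℂ) * conj 1).re = 1 := by simp
  have e3 : ((I : ℂ) * conj I).re = 1 := by simp
  simp only [hff, e1, e2, e3, hder]
  rw [det_mul, abs_of_nonneg (by positivity), ← ENNReal.ofReal_mul (by positivity)]
  congr 1
  rw [sheetDens, mul_zero, zero_pow two_ne_zero, sub_zero, Real.sqrt_mul_self (by positivity),
    norm_mul]
  ring

lemma volume_diff_sheetParts (hγ : IsParam γ U) :
    volume (U \ (sheetPart γ U 1 ∪ sheetPart γ U (-1))) = 0 := by
  -- the preimage of the circle `|x| = 1` is null, and `y` has finitely many zeros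
  have h1 : volume {w ∈ U | (γ w : ℂ × ℂ).2 ≠ 0 ∧ (γ w : ℂ × ℂ).1 ∈ Metric.sphere (0 : ℂ) 1} = 0 :=
    volume_preimage_null (h := fun w => (γ w : ℂ × ℂ).1) (Measure.addHaar_sphere volume _ _)
      fun w hw => ⟨analyticAt_fst.comp (IsParam.analyticAt hγ hw.1),
        deriv_x_ne_zero hγ hw.1 hw.2.1, hw.2.2⟩
  have h2 : {w ∈ U | (γ w : ℂ × ℂ).2 = 0}.Finite := by
    refine Set.Finite.of_injOn (f := fun w => (γ w : ℂ × ℂ).1) (t := {0, 1, -1}) ?_ ?_ (by simp)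
    · rintro w ⟨-, hy⟩
      have h3 := (γ w).2
      rw [hy] at h3
      have : (γ w : ℂ × ℂ).1 * ((γ w : ℂ × ℂ).1 - 1) * ((γ w : ℂ × ℂ).1 + 1) = 0 := by
        rw [← h3]
        ring
      rcases mul_eq_zero.1 this with h | h
      · rcases mul_eq_zero.1 h with h | h
        · exact Or.inl h
        · exact Or.inr (Or.inl (sub_eq_zero.1 h))
      · exact Or.inr (Or.inr (eq_neg_of_add_eq_zero_left h))
    · rintro w ⟨hw, hy⟩ w' ⟨hw', hy'⟩ h
      exact hγ.inj hw hw' (Subtype.ext (Prod.ext h (hy.trans hy'.symm)))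
  refine measure_mono_null ?_ (measure_union_null h1 (h2.measure_zero volume))
  rintro w ⟨hw, hn⟩
  by_cases hy : (γ w : ℂ × ℂ).2 = 0
  · exact Or.inr ⟨hw, hy⟩
  · refine Or.inl ⟨hw, hy, ?_⟩
    by_contra hx
    rw [mem_sphere_zero_iff_norm] at hx
    rcases lt_or_gt_of_ne hx with h | h
    · exact hn (Or.inr ⟨hw, hy, by simpa [sheetRange] using h⟩)
    · exact hn (Or.inl ⟨hw, hy, by simpa [sheetRange] using h⟩)

theorem isAreaMeasure (hζ : ζ.re ≠ 0) (hX : ∀ p, X p = Xstd ζ p + v₀) :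
    IsAreaMeasure X (areaMeasure ζ) := by
  intro γ U hγ A hA hAU
  rw [areaMeasure, Measure.add_apply, lintegral_sheet hζ hX hγ (Or.inl rfl) hA hAU,
    lintegral_sheet hζ hX hγ (Or.inr rfl) hA hAU,
    ← lintegral_union (hA.inter (isOpen_sheetPart hγ _).measurableSet) ?_]
  · refine setLIntegral_congr ?_
    rw [← Set.inter_union_distrib_left]
    refine (Set.inter_subset_left.eventuallyLE).antisymm ?_
    rw [ae_le_set]
    refine measure_mono_null ?_ (volume_diff_sheetParts hγ)
    rintro w ⟨hw, hn⟩
    exact ⟨hAU hw, fun h => hn ⟨hw, h⟩⟩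
  · rw [Set.disjoint_left]
    rintro w ⟨-, -, -, h1⟩ ⟨-, -, -, h2⟩
    simp only [sheetRange, Set.mem_ofPred_eq, one_re, neg_re] at h1 h2
    linarith

/-! ### The Gauss curvature -/

/-- The Gauss curvature of the deformation, computed in the coordinate of the universal cover. -/
def gaussK (ζ : ℂ) (p : CGCurve) : ℝ :=
  - (Δ (fun z => Real.log (eFac ζ z))) (qC_surjective p).choose /
    (2 * eFac ζ (qC_surjective p).choose)

lemma analyticAt_of_forall_hasDerivAt {f f' : ℂ → ℂ}
    (h : ∀ z, z ∉ sqL.lattice → HasDerivAt f (f' z) z) {z : ℂ} (hz : z ∉ sqL.lattice) :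
    AnalyticAt ℂ f z := by
  rw [Complex.analyticAt_iff_eventually_differentiableAt]
  filter_upwards [isOpen_compl_lattice.mem_nhds hz] with u hu
  exact (h u hu).differentiableAt

lemma contDiffAt_eFac (ζ : ℂ) {z : ℂ} (hz : z ∉ sqL.lattice) : ContDiffAt ℝ 2 (eFac ζ) z := by
  have hx : ContDiffAt ℝ 2 xq z :=
    (analyticAt_of_forall_hasDerivAt (fun z hz => hasDerivAt_xq hz) hz).contDiffAt.restrict_scalars ℝ
  have hy : ContDiffAt ℝ 2 yq z :=
    (analyticAt_of_forall_hasDerivAt (fun z hz => hasDerivAt_yq hz) hz).contDiffAt.restrict_scalars ℝ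
  have ha : ContDiffAt ℝ 2 (fun z => kC * xq z / rhoCG) z := by
    simp only [div_eq_mul_inv]
    exact (contDiffAt_const.mul hx).mul contDiffAt_const
  have hb : ContDiffAt ℝ 2 (fun z => rhoCG * kC * (xq z ^ 2 - 1)) z :=
    contDiffAt_const.mul ((hx.pow 2).sub contDiffAt_const)
  have hc : ContDiffAt ℝ 2 (fun z => kC * yq z) z := contDiffAt_const.mul hy
  exact (contDiffAt_const.mul ((ha.norm_sq ℝ).add (hb.norm_sq ℝ))).add
    (contDiffAt_const.mul (hc.norm_sq ℝ))

theorem isGaussCurvature (hζ : ζ.re ≠ 0) (hX : ∀ p, X p = Xstd ζ p + v₀) :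
    IsGaussCurvature X (gaussK ζ) := by
  intro γ U hγ w hw
  obtain ⟨hz, hzw⟩ := (qC_surjective (γ w)).choose_spec
  rw [gaussK]
  set z := (qC_surjective (γ w)).choose with hzd
  obtain ⟨τ, hτ, hτ0, hτ', hτq⟩ := exists_transition hγ hw hz hzw
  have hff := firstFF_eq hζ hX hτ hτq
  have hff0 := hff.self_of_nhds 1 1
  have e2 : ((1 : ℂ) * conj 1).re = 1 := by simp
  rw [e2, mul_one, hτ0] at hff0
  have hlog : (fun u => Real.log (firstFF (X ∘ γ) u 1 1)) =ᶠ[𝓝 w]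
      (fun u => Real.log (eFac ζ (τ u))) + (2 : ℝ) • fun u => Real.log ‖deriv τ u‖ := by
    filter_upwards [hff, hτ.deriv.continuousAt.eventually_ne hτ'] with u hu hu'
    have h1 := norm_pos_iff.2 hu'
    rw [hu, e2, mul_one, Real.log_mul (eFac_pos hζ _).ne' (by positivity), Real.log_pow]
    simp
  have hc : ContDiffAt ℝ 2 (fun z => Real.log (eFac ζ z)) z :=
    (contDiffAt_eFac ζ hz).log (eFac_pos hζ z).ne'
  have hharm := hτ.deriv.harmonicAt_log_norm hτ'
  have hcτ : ContDiffAt ℝ 2 (fun u => Real.log (eFac ζ (τ u))) w := by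
    rw [← hτ0] at hc
    exact hc.comp w (hτ.contDiffAt.restrict_scalars ℝ)
  rw [(InnerProductSpace.laplacian_congr_nhds hlog).eq_of_nhds,
    hcτ.laplacian_add (hharm.const_smul (c := (2 : ℝ))).1,
    (hharm.const_smul (c := (2 : ℝ))).2.eq_of_nhds,
    laplacian_comp (f := fun z => Real.log (eFac ζ z)) (by rw [hτ0]; exact hc) hτ, hτ0, hff0]
  have h1 := norm_pos_iff.2 hτ'
  have h2 := eFac_pos hζ z
  simp only [Pi.zero_apply]
  field_simp
  ring

/-- The curvature on a sheet, in the coordinate given by the Gauss map. -/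
lemma gaussK_sheet (hζ : ζ.re ≠ 0) {s : ℂ} (hs : s = 1 ∨ s = -1) {g : ℂ} (hg : g ∈ sheetDom) :
    sheetDens ζ s g * gaussK ζ (sheet s g) = -curvDens (kap ζ) (‖g‖ ^ 2) ∧
      0 < sheetDens ζ s g := by
  have hX : ∀ p, Xstd ζ p = Xstd ζ p + 0 := by simp
  have hP := isParam_sheet hs
  have h0 := neg_one_lt_kap hζ
  have h1 := kap_le_one ζ
  have hff : ∀ u ∈ sheetDom, firstFF (Xstd ζ ∘ sheet s) u 1 1 = sheetDens ζ s u := by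
    intro u hu
    rw [firstFF_eq_of_y hζ hX hP hu (sheet_snd_ne_zero hs hu), gaussCG_sheet hs hu, sheetDens]
    have : deriv (fun w => (sheet s w : ℂ × ℂ).1) u = deriv (sheetX s) u := by
      refine Filter.EventuallyEq.deriv_eq ?_
      filter_upwards [isOpen_sheetDom.mem_nhds hu] with v hv
      rw [coe_sheet hs hv]
    rw [this]
    simp
  have hpos : 0 < sheetDens ζ s g := by
    rw [← hff g hg]
    exact ((isStationarySurface hζ hX).1 _ _ hP).2 g hg 1 one_ne_zero
  refine ⟨?_, hpos⟩
  have hd : deriv (sheetX s) g ≠ 0 := by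
    intro h
    rw [sheetDens, h] at hpos
    simp at hpos
  have ha : AnalyticAt ℂ (deriv (sheetX s)) g :=
    ((differentiableOn_sheetX s).analyticAt (isOpen_sheetDom.mem_nhds hg)).deriv
  have hh1 := ha.harmonicAt_log_norm hd
  have hh2 := (analyticAt_id (𝕜 := ℂ) (z := g)).harmonicAt_log_norm hg.1
  have hh : InnerProductSpace.HarmonicAt ((fun _ => Real.log 4) +
      (2 : ℝ) • ((fun u => Real.log ‖deriv (sheetX s) u‖) - fun u => Real.log ‖id u‖)) g :=
    (InnerProductSpace.harmonicAt_const (Real.log 4)).add ((hh1.sub hh2).const_smul (c := (2 : ℝ)))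
  have hlog : (fun u => Real.log (firstFF (Xstd ζ ∘ sheet s) u 1 1)) =ᶠ[𝓝 g]
      (fun u => Real.log ((‖u‖ ^ 2) ^ 2 + 2 * kap ζ * ‖u‖ ^ 2 + 1)) + ((fun _ => Real.log 4) +
      (2 : ℝ) • ((fun u => Real.log ‖deriv (sheetX s) u‖) - fun u => Real.log ‖id u‖)) := by
    filter_upwards [isOpen_sheetDom.mem_nhds hg, ha.continuousAt.eventually_ne hd] with u hu hu'
    have p1 := norm_pos_iff.2 hu'
    have p2 := norm_pos_iff.2 hu.1
    have p3 := metricPoly_pos h0 h1 (sq_nonneg ‖u‖)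
    have e : sheetDens ζ s u = ((‖u‖ ^ 2) ^ 2 + 2 * kap ζ * ‖u‖ ^ 2 + 1) *
        (4 * (‖deriv (sheetX s) u‖ / ‖u‖) ^ 2) := by
      rw [sheetDens, eForm, norm_inv, norm_one]
      field_simp
      ring
    rw [hff u hu, e, Real.log_mul p3.ne' (by positivity), Real.log_mul (by norm_num) (by positivity),
      Real.log_pow, Real.log_div p1.ne' p2.ne']
    simp
  have hcd : ContDiffAt ℝ 2
      (fun u : ℂ => Real.log ((‖u‖ ^ 2) ^ 2 + 2 * kap ζ * ‖u‖ ^ 2 + 1)) g := by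
    have hn : ContDiffAt ℝ 2 (fun u : ℂ => ‖u‖ ^ 2) g := contDiffAt_id.norm_sq ℝ
    exact (((hn.pow 2).add (contDiffAt_const.mul hn)).add contDiffAt_const).log
      (metricPoly_pos h0 h1 (sq_nonneg ‖g‖)).ne'
  rw [isGaussCurvature hζ hX _ _ hP g hg,
    (InnerProductSpace.laplacian_congr_nhds hlog).eq_of_nhds, hcd.laplacian_add hh.1,
    hh.2.eq_of_nhds, hff g hg, laplacian_log_metricPoly h0 h1]
  simp only [Pi.zero_apply]
  field_simp
  ring

lemma gaussK_eq (hζ : ζ.re ≠ 0) {s : ℂ} (hs : s = 1 ∨ s = -1) {p : CGCurve}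
    (hy : (p : ℂ × ℂ).2 ≠ 0) (hx : (p : ℂ × ℂ).1 ∈ sheetRange s) :
    gaussK ζ p = -curvDens (kap ζ) (‖gaussCG p‖ ^ 2) / sheetDens ζ s (gaussCG p) := by
  obtain ⟨h1, h2⟩ := sheet_gaussCG hs hy hx
  obtain ⟨h3, h4⟩ := gaussK_sheet hζ hs h1
  rw [h2] at h3
  rw [eq_div_iff h4.ne', mul_comm]
  exact h3

lemma measurable_gaussCG : Measurable gaussCG := by
  unfold gaussCG
  fun_prop

lemma aestronglyMeasurable_gaussK (hζ : ζ.re ≠ 0) {s : ℂ} (hs : s = 1 ∨ s = -1) :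
    AEStronglyMeasurable (gaussK ζ) (sheetArea ζ s) := by
  have hm : Measurable fun p : CGCurve =>
      -curvDens (kap ζ) (‖gaussCG p‖ ^ 2) / sheetDens ζ s (gaussCG p) := by
    have h1 := (continuous_curvDens (neg_one_lt_kap hζ) (kap_le_one ζ)).measurable
    exact ((h1.comp measurable_gaussCG).neg).div ((measurable_sheetDens ζ s).comp measurable_gaussCG)
  refine hm.aestronglyMeasurable.congr ?_
  have hset : MeasurableSet {p : CGCurve | (p : ℂ × ℂ).2 ≠ 0 ∧ (p : ℂ × ℂ).1 ∈ sheetRange s} := by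
    have h1 : IsOpen {p : ℂ × ℂ | p.2 ≠ 0 ∧ p.1 ∈ sheetRange s} :=
      (isOpen_ne.preimage continuous_snd).inter ((isOpen_sheetRange s).preimage continuous_fst)
    exact measurable_subtype_coe h1.measurableSet
  have hae : ∀ᵐ p : CGCurve ∂(sheetArea ζ s), (p : ℂ × ℂ).2 ≠ 0 ∧ (p : ℂ × ℂ).1 ∈ sheetRange s := by
    rw [sheetArea, ae_map_iff (measurable_sheet hs).aemeasurable hset]
    refine (withDensity_absolutelyContinuous _ _).ae_le ?_
    filter_upwards [ae_restrict_mem isOpen_sheetDom.measurableSet] with g hg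
    refine ⟨sheet_snd_ne_zero hs hg, ?_⟩
    rw [coe_sheet hs hg]
    exact sheetX_mem_sheetRange hs hg
  filter_upwards [hae] with p hp
  exact (gaussK_eq hζ hs hp.1 hp.2).symm

/-- Each sheet has total curvature `4 π`. -/
lemma integral_sheet (hζ : ζ.re ≠ 0) {s : ℂ} (hs : s = 1 ∨ s = -1) :
    Integrable (gaussK ζ) (sheetArea ζ s) ∧
      ∫ p, gaussK ζ p ∂(sheetArea ζ s) = -(4 * Real.pi) := by
  have h0 := neg_one_lt_kap hζ
  have h1 := kap_le_one ζ
  have hm := aestronglyMeasurable_gaussK hζ hs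
  have hd : Measurable fun g => (sheetDens ζ s g).toNNReal := (measurable_sheetDens ζ s).real_toNNReal
  have hcongr : (fun g => (sheetDens ζ s g).toNNReal • gaussK ζ (sheet s g))
      =ᵐ[volume.restrict sheetDom] fun g => -curvDens (kap ζ) (‖g‖ ^ 2) := by
    filter_upwards [ae_restrict_mem isOpen_sheetDom.measurableSet] with g hg
    obtain ⟨h2, h3⟩ := gaussK_sheet hζ hs hg
    rw [NNReal.smul_def, Real.coe_toNNReal _ h3.le, smul_eq_mul, h2]
  have hrestr : volume.restrict sheetDom = (volume : Measure ℂ) :=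
    Measure.restrict_eq_self_of_ae_mem (by
      rw [ae_iff]
      exact volume_compl_sheetDom)
  constructor
  · rw [sheetArea] at hm ⊢
    rw [integrable_map_measure hm (measurable_sheet hs).aemeasurable,
      integrable_withDensity_iff_integrable_smul hd]
    refine Integrable.congr ?_ hcongr.symm
    rw [hrestr]
    exact (integrable_curvDens h0 h1).neg
  · rw [sheetArea] at hm ⊢
    rw [integral_map (measurable_sheet hs).aemeasurable hm,
      integral_withDensity_eq_integral_smul hd, integral_congr_ae hcongr, hrestr, integral_neg,
      integral_curvDens h0 h1]

theorem hasTotalCurvature (hζ : ζ.re ≠ 0) (hX : ∀ p, X p = Xstd ζ p + v₀) :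
    HasTotalCurvature X (8 * Real.pi) := by
  obtain ⟨i1, e1⟩ := integral_sheet hζ (s := 1) (Or.inl rfl)
  obtain ⟨i2, e2⟩ := integral_sheet hζ (s := -1) (Or.inr rfl)
  refine ⟨gaussK ζ, areaMeasure ζ, isGaussCurvature hζ hX, isAreaMeasure hζ hX, i1.add_measure i2,
    ?_⟩
  rw [areaMeasure, integral_add_measure i1 i2, e1, e2]
  ring

end

end ChenGackstatter

end

noncomputable section

namespace ChenGackstatter

open Complex PeriodPair

/-! ### A branch of the curve over the closed quadrant -/

/-- The square root `exp (i π / 4)` of `i`. -/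
def omg : ℂ := ((√2)⁻¹ : ℝ) * (1 + I)

lemma omg_sq : omg ^ 2 = I := by
  have h : ((√2)⁻¹ : ℝ) ^ 2 = 1 / 2 := by
    rw [inv_pow, Real.sq_sqrt (by norm_num)]
    norm_num
  have h' : (((√2)⁻¹ : ℝ) : ℂ) ^ 2 = 1 / 2 := by
    rw [← ofReal_pow, h]
    norm_num
  rw [omg, mul_pow, h']
  linear_combination (1 / 2 : ℂ) * I_sq

lemma omg_re : omg.re = (√2)⁻¹ := by rw [omg, re_ofReal_mul]; simp

lemma omg_im : omg.im = (√2)⁻¹ := by rw [omg, im_ofReal_mul]; simp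

lemma conj_omg : conj omg = -I * omg := by
  rw [omg, map_mul, conj_ofReal, map_add, map_one, conj_I]
  linear_combination (((√2)⁻¹ : ℝ) : ℂ) * I_sq

lemma omg_mul_conj : omg * conj omg = 1 := by
  rw [conj_omg]
  linear_combination (-I) * omg_sq - I_sq

lemma omg_ne_zero : omg ≠ 0 := left_ne_zero_of_mul_eq_one omg_mul_conj

lemma conj_omg_sq : conj omg ^ 2 = -I := by rw [← map_pow, omg_sq, conj_I]

/-- The closed first quadrant. -/
def quad : Set ℂ := {x | 0 ≤ x.re ∧ 0 ≤ x.im}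

/-- A branch of `y = √(x (x - 1) (x + 1))`, continuous on the closed first quadrant. -/
def branchY (x : ℂ) : ℂ := omg * csqrt x * csqrt (-I * (x ^ 2 - 1))

/-- The corresponding branch of the curve. -/
def branch (x : ℂ) : CGCurve := ⟨(x, branchY x), by
  simp only [branchY, mul_pow, csqrt_sq, omg_sq]
  linear_combination (-x * (x ^ 2 - 1)) * I_sq⟩

@[simp] lemma branch_fst (x : ℂ) : (branch x : ℂ × ℂ).1 = x := rfl
@[simp] lemma branch_snd (x : ℂ) : (branch x : ℂ × ℂ).2 = branchY x := rfl

lemma csqrt_eq {w z : ℂ} (h : w ^ 2 = z) (hw : 0 < w.re) : csqrt z = w := by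
  have h1 := csqrt_re_pos (h ▸ sq_mem_slitPlane hw.ne')
  rcases sq_eq_sq_iff_eq_or_eq_neg.1 ((csqrt_sq z).trans h.symm) with h2 | h2
  · exact h2
  · rw [h2, neg_re] at h1
    linarith

lemma continuousAt_csqrt {z : ℂ} (h : 0 ≤ z.re) : ContinuousAt csqrt z := by
  refine continuousAt_cpow_const_of_re_pos (Or.inl h) ?_
  rw [show ((2 : ℕ) : ℂ)⁻¹ = ((2⁻¹ : ℝ) : ℂ) by push_cast; rfl, ofReal_re]
  norm_num

lemma re_neg_I_mul (x : ℂ) : (-I * (x ^ 2 - 1)).re = 2 * (x.re * x.im) := by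
  simp [pow_two]
  ring

lemma im_neg_I_mul (x : ℂ) : (-I * (x ^ 2 - 1)).im = 1 - x.re ^ 2 + x.im ^ 2 := by
  simp [pow_two]
  ring

lemma continuousOn_branch : ContinuousOn branch quad := by
  refine Topology.IsInducing.subtypeVal.continuousOn_iff.2 ?_
  intro x hx
  have h1 : ContinuousAt branchY x := by
    have a1 := continuousAt_csqrt hx.1
    have a2 : ContinuousAt (fun x => csqrt (-I * (x ^ 2 - 1))) x :=
      ContinuousAt.comp (g := csqrt) (f := fun x : ℂ => -I * (x ^ 2 - 1))
        (continuousAt_csqrt (by rw [re_neg_I_mul]; have := mul_nonneg hx.1 hx.2; linarith))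
        (by fun_prop)
    exact (continuousAt_const.mul a1).mul a2
  exact (continuousAt_id.prodMk h1).continuousWithinAt

lemma neg_I_mul_mem {x : ℂ} (hx : x ∈ quad) (h1 : x ≠ 1) : -I * (x ^ 2 - 1) ∈ slitPlane := by
  rw [mem_slitPlane_iff, re_neg_I_mul, im_neg_I_mul]
  obtain ⟨ha, hb⟩ := hx
  by_cases h : x.re * x.im = 0
  · right
    rcases mul_eq_zero.1 h with h | h
    · rw [h]
      positivity
    · rw [h]
      intro h2
      have : x.re = 1 := by nlinarith
      exact h1 (Complex.ext this h)
  · left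
    have := lt_of_le_of_ne (mul_nonneg ha hb) (Ne.symm h)
    linarith

lemma quad_mem_slitPlane {x : ℂ} (hx : x ∈ quad) (h0 : x ≠ 0) : x ∈ slitPlane := by
  rw [mem_slitPlane_iff]
  by_cases h : x.im = 0
  · left
    refine lt_of_le_of_ne hx.1 fun h1 => h0 (Complex.ext h1.symm h)
  · exact Or.inr h

lemma differentiableAt_branchY {x : ℂ} (hx : x ∈ quad) (h0 : x ≠ 0) (h1 : x ≠ 1) :
    DifferentiableAt ℂ branchY x := by
  have e1 : DifferentiableAt ℂ (fun x => csqrt x) x :=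
    DifferentiableAt.cpow differentiableAt_id (differentiableAt_const _) (quad_mem_slitPlane hx h0)
  have e2 : DifferentiableAt ℂ (fun x => csqrt (-I * (x ^ 2 - 1))) x :=
    DifferentiableAt.cpow (by fun_prop) (differentiableAt_const _) (neg_I_mul_mem hx h1)
  exact ((differentiableAt_const omg).mul e1).mul e2

lemma branchY_ne_zero {x : ℂ} (h0 : x ≠ 0) (h1 : x ≠ 1) (h2 : x ≠ -1) : branchY x ≠ 0 := by
  intro h
  have h3 := (branch x).2
  rw [branch_snd, h, branch_fst] at h3
  have h4 : x * ((x - 1) * (x + 1)) = 0 := by linear_combination -h3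
  exact mul_ne_zero h0 (mul_ne_zero (sub_ne_zero.2 h1) fun h => h2 (eq_neg_of_add_eq_zero_left h)) h4

lemma ne_neg_one_of_quad {x : ℂ} (hx : x ∈ quad) : x ≠ -1 := by
  rintro rfl
  have := hx.1
  norm_num at this

/-- The function `Φ = X₁ + i X₂` on the branch. -/
def PhiB (x : ℂ) : ℂ := PhiC (branch x)

lemma continuousOn_PhiB : ContinuousOn PhiB quad :=
  continuous_PhiC.comp_continuousOn continuousOn_branch

lemma hasDerivAt_PhiB {l : ℝ → ℂ} {e : ℂ} {t : ℝ} (hl : HasDerivAt l e t) (hQ : l t ∈ quad)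
    (h0 : l t ≠ 0) (h1 : l t ≠ 1) : HasDerivAt (fun t => PhiB (l t))
      (2 * (gaussCG (branch (l t)) * e - conj (e / gaussCG (branch (l t))))) t := by
  have hY : HasDerivAt (fun t => branchY (l t)) (e • deriv branchY (l t)) t :=
    HasDerivAt.scomp t (differentiableAt_branchY hQ h0 h1).hasDerivAt hl
  have hc : HasDerivAt (fun t => (branch (l t) : ℂ × ℂ)) (e, e • deriv branchY (l t)) t :=
    hl.prodMk hY
  have hy : (branch (l t) : ℂ × ℂ).2 ≠ 0 := branchY_ne_zero h0 h1 (ne_neg_one_of_quad hQ)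
  have h := hasDerivAt_PhiC (c := fun t => branch (l t)) hc hy
  exact h

/-! ### The Gauss map in the open quadrant and on its boundary -/

lemma gaussCG_branch_re_pos {x : ℂ} (h1 : 0 < x.re) (h2 : 0 < x.im) :
    0 < (gaussCG (branch x)).re := by
  have hx : x ∈ quad := ⟨h1.le, h2.le⟩
  have hx0 : x ≠ 0 := fun h => by simp [h] at h1
  have hx1 : x ≠ 1 := fun h => by simp [h] at h2
  obtain ⟨a, ha⟩ : ∃ a, a = csqrt x := ⟨_, rfl⟩
  obtain ⟨b, hb⟩ : ∃ b, b = csqrt (-I * (x ^ 2 - 1)) := ⟨_, rfl⟩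
  have ha2 : a ^ 2 = x := by rw [ha, csqrt_sq]
  have hb2 : b ^ 2 = -I * (x ^ 2 - 1) := by rw [hb, csqrt_sq]
  have har : 0 < a.re := ha ▸ csqrt_re_pos (quad_mem_slitPlane hx hx0)
  have hbr : 0 < b.re := hb ▸ csqrt_re_pos (neg_I_mul_mem hx hx1)
  have hai : 0 < a.im := by
    have h := congrArg Complex.im ha2
    simp only [pow_two, mul_im] at h
    nlinarith
  have hbi : b.im ^ 2 < b.re ^ 2 := by
    have h := congrArg Complex.re hb2
    rw [re_neg_I_mul] at h
    simp only [pow_two, mul_re] at h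
    nlinarith [mul_pos h1 h2]
  have hbi' := abs_lt.1 (abs_lt_of_sq_lt_sq hbi hbr.le)
  have ha0 : a ≠ 0 := fun h => by simp [h] at har
  have hb0 : b ≠ 0 := fun h => by simp [h] at hbr
  have hNb : 0 < normSq b := normSq_pos.2 hb0
  have hr := rhoCG_ne_zero
  have hG : gaussCG (branch x) = ((((√2)⁻¹ / (rhoCG * normSq b) : ℝ)) : ℂ) *
      ((1 - I) * (a * conj b)) := by
    rw [gaussCG, branch_fst, branch_snd, branchY, ← ha, ← hb]
    have e1 : conj omg = ((√2)⁻¹ : ℝ) * (1 - I) := by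
      rw [omg, map_mul, conj_ofReal, map_add, map_one, conj_I, sub_eq_add_neg]
    have e2 := omg_mul_conj
    have e3 : (normSq b : ℂ) = b * conj b := (mul_conj b).symm
    have hcb : conj b ≠ 0 := (map_ne_zero _).2 hb0
    have ho := omg_ne_zero
    rw [div_eq_iff (by simp [hr, ho, ha0, hb0]), ← ha2]
    push_cast
    rw [e3]
    have e4 : (((√2)⁻¹ : ℝ) : ℂ) * (1 - I) * omg = 1 := by rw [← e1, mul_comm, e2]
    push_cast at e4
    field_simp at e4 ⊢
    linear_combination -e4
  rw [hG, re_ofReal_mul]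
  refine mul_pos (div_pos (by positivity) (mul_pos rhoCG_pos hNb)) ?_
  simp
  nlinarith [mul_pos har (sub_pos.2 hbi'.2), mul_pos hai (neg_lt_iff_pos_add.1 hbi'.1)]

lemma branchY_of_lt_one {t : ℝ} (h0 : 0 < t) (h1 : t < 1) :
    branchY t = I * (t * √(t⁻¹ - t)) := by
  have hu : 0 < 1 - t ^ 2 := by nlinarith
  have e1 : csqrt t = √t := csqrt_eq (by rw [← ofReal_pow, Real.sq_sqrt h0.le])
    (by rw [ofReal_re]; positivity)
  have e2 : csqrt (-I * ((t : ℂ) ^ 2 - 1)) = √(1 - t ^ 2) * omg := by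
    refine csqrt_eq ?_ ?_
    · rw [mul_pow, omg_sq, ← ofReal_pow, Real.sq_sqrt hu.le]
      push_cast
      ring
    · rw [re_ofReal_mul, omg_re]
      positivity
  have e3 : √(1 - t ^ 2) = √t * √(t⁻¹ - t) := by
    rw [← Real.sqrt_mul h0.le]
    congr 1
    field_simp
  have e4 : (√t : ℂ) ^ 2 = t := by rw [← ofReal_pow, Real.sq_sqrt h0.le]
  rw [branchY, e1, e2, e3]
  push_cast
  linear_combination (omg ^ 2 * √(t⁻¹ - t)) * e4 + (t * √(t⁻¹ - t)) * omg_sq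

lemma branchY_of_one_lt {t : ℝ} (h1 : 1 < t) : branchY t = t * √(t - t⁻¹) := by
  have h0 : 0 < t := by linarith
  have hu : 0 < t ^ 2 - 1 := by nlinarith
  have e1 : csqrt t = √t := csqrt_eq (by rw [← ofReal_pow, Real.sq_sqrt h0.le])
    (by rw [ofReal_re]; positivity)
  have e2 : csqrt (-I * ((t : ℂ) ^ 2 - 1)) = √(t ^ 2 - 1) * conj omg := by
    refine csqrt_eq ?_ ?_
    · rw [mul_pow, conj_omg_sq, ← ofReal_pow, Real.sq_sqrt hu.le]
      push_cast
      ring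
    · rw [re_ofReal_mul, conj_re, omg_re]
      positivity
  have e3 : √(t ^ 2 - 1) = √t * √(t - t⁻¹) := by
    rw [← Real.sqrt_mul h0.le]
    congr 1
    field_simp
  have e4 : (√t : ℂ) ^ 2 = t := by rw [← ofReal_pow, Real.sq_sqrt h0.le]
  rw [branchY, e1, e2, e3]
  push_cast
  linear_combination (√(t - t⁻¹) * √t ^ 2) * omg_mul_conj + √(t - t⁻¹) * e4

lemma branchY_mul_I {t : ℝ} (h0 : 0 < t) : branchY (t * I) = omg * I * (t * √(t + t⁻¹)) := by
  have hu : 0 < t ^ 2 + 1 := by positivity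
  have e1 : csqrt (t * I) = √t * omg := by
    refine csqrt_eq ?_ ?_
    · rw [mul_pow, omg_sq, ← ofReal_pow, Real.sq_sqrt h0.le]
    · rw [re_ofReal_mul, omg_re]
      positivity
  have e2 : csqrt (-I * (((t : ℂ) * I) ^ 2 - 1)) = √(t ^ 2 + 1) * omg := by
    refine csqrt_eq ?_ ?_
    · rw [mul_pow, omg_sq, ← ofReal_pow, Real.sq_sqrt hu.le]
      push_cast
      linear_combination (I * t ^ 2) * I_sq
    · rw [re_ofReal_mul, omg_re]
      positivity
  have e3 : √(t ^ 2 + 1) = √t * √(t + t⁻¹) := by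
    rw [← Real.sqrt_mul h0.le]
    congr 1
    field_simp
  have e4 : (√t : ℂ) ^ 2 = t := by rw [← ofReal_pow, Real.sq_sqrt h0.le]
  rw [branchY, e1, e2, e3]
  push_cast
  linear_combination (omg ^ 3 * √(t + t⁻¹)) * e4 + (omg * t * √(t + t⁻¹)) * omg_sq

end ChenGackstatter

end

noncomputable section

namespace ChenGackstatter

open Complex PeriodPair

/-! ### The first two coordinates along the boundary of the quadrant -/

lemma PhiC_eq_zero_of_x {p : CGCurve}
    (h : (p : ℂ × ℂ).1 = 0 ∨ (p : ℂ × ℂ).1 = 1 ∨ (p : ℂ × ℂ).1 = -1) : PhiC p = 0 := by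
  refine PhiC_eq_zero_of_y ?_
  have h1 := p.2
  have h2 : (p : ℂ × ℂ).2 ^ 2 = 0 := by
    rcases h with h | h | h <;> rw [h1, h] <;> ring
  exact pow_eq_zero_iff two_ne_zero |>.1 h2

lemma PhiB_zero : PhiB 0 = 0 := PhiC_eq_zero_of_x (Or.inl rfl)

lemma PhiB_one : PhiB 1 = 0 := PhiC_eq_zero_of_x (Or.inr (Or.inl rfl))

lemma ofReal_mem_quad {t : ℝ} (h : 0 ≤ t) : (t : ℂ) ∈ quad := ⟨by simpa using h, by simp⟩

lemma mul_I_mem_quad {t : ℝ} (h : 0 ≤ t) : (t * I : ℂ) ∈ quad := ⟨by simp, by simpa using h⟩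

lemma PhiB_re_of_lt_one {t : ℝ} (h0 : 0 < t) (h1 : t < 1) : (PhiB t).re = 0 := by
  have h : conjC (branch t) = negC (branch t) := by
    refine Subtype.ext (Prod.ext (by simp) ?_)
    simp [branchY_of_lt_one h0 h1]
  have h2 := PhiC_conjC (branch t)
  rw [h, PhiC_negC] at h2
  have h3 := congrArg Complex.re h2
  rw [neg_re, conj_re] at h3
  change (PhiC (branch t)).re = 0
  linarith

lemma PhiB_im_of_one_lt {t : ℝ} (h1 : 1 < t) : (PhiB t).im = 0 := by
  have h : conjC (branch t) = branch t := by
    refine Subtype.ext (Prod.ext (by simp) ?_)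
    simp [branchY_of_one_lt h1]
  have h2 := PhiC_conjC (branch t)
  rw [h] at h2
  have h3 := congrArg Complex.im h2
  rw [conj_im] at h3
  change (PhiC (branch t)).im = 0
  linarith

lemma PhiB_mul_I {t : ℝ} (h0 : 0 ≤ t) :
    PhiB (t * I) = ((conj omg * PhiB (t * I)).re : ℝ) * omg := by
  rcases h0.eq_or_lt with rfl | h0
  · simp [PhiB_zero]
  have h : rotC (conjC (branch (t * I))) = negC (branch (t * I)) := by
    refine Subtype.ext (Prod.ext (by simp) ?_)
    simp only [rotC_snd, conjC_snd, negC_snd, branch_snd, branchY_mul_I h0, map_mul, conj_omg,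
      conj_I, conj_ofReal]
    linear_combination (I * omg * t * √(t + t⁻¹)) * I_sq
  have h2 := PhiC_conjC (branch (t * I))
  have h3 := PhiC_rotC (conjC (branch (t * I)))
  rw [h, PhiC_negC, h2] at h3
  change -PhiB _ = -I * conj (PhiB _) at h3
  set z := PhiB (t * I)
  have h4 : conj (conj omg * z) = conj omg * z := by
    rw [map_mul, conj_conj, conj_omg]
    have h5 : conj z = -I * z := by linear_combination -I * h3 + conj z * I_sq
    rw [h5]
    ring
  rw [conj_eq_iff_re.1 h4]
  linear_combination (-z) * omg_mul_conj

lemma gaussCG_branch_of_lt_one {t : ℝ} (h0 : 0 < t) (h1 : t < 1) :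
    gaussCG (branch t) = -I * ((rhoCG * √(t⁻¹ - t))⁻¹ : ℝ) := by
  have hu : 0 < √(t⁻¹ - t) := by
    refine Real.sqrt_pos.2 (sub_pos.2 ?_)
    exact h1.trans ((one_lt_inv₀ h0).2 h1)
  have hr := rhoCG_ne_zero
  have hu' : ((√(t⁻¹ - t) : ℝ) : ℂ) ≠ 0 := ofReal_ne_zero.2 hu.ne'
  have ht : (t : ℂ) ≠ 0 := ofReal_ne_zero.2 h0.ne'
  rw [gaussCG, branch_fst, branch_snd, branchY_of_lt_one h0 h1, div_eq_iff (by simp [hr, hu', ht])]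
  push_cast
  generalize ((√(t⁻¹ - t) : ℝ) : ℂ) = u at hu'
  field_simp
  linear_combination I_sq

lemma gaussCG_branch_of_one_lt {t : ℝ} (h1 : 1 < t) :
    gaussCG (branch t) = ((rhoCG * √(t - t⁻¹))⁻¹ : ℝ) := by
  have hu : 0 < √(t - t⁻¹) := Real.sqrt_pos.2 (sub_pos.2 ((inv_lt_one_of_one_lt₀ h1).trans h1))
  have hr := rhoCG_ne_zero
  have hu' : ((√(t - t⁻¹) : ℝ) : ℂ) ≠ 0 := ofReal_ne_zero.2 hu.ne'
  have ht : (t : ℂ) ≠ 0 := ofReal_ne_zero.2 (by linarith)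
  rw [gaussCG, branch_fst, branch_snd, branchY_of_one_lt h1]
  push_cast
  generalize ((√(t - t⁻¹) : ℝ) : ℂ) = u at hu'
  field_simp

lemma gaussCG_branch_mul_I {t : ℝ} (h0 : 0 < t) :
    gaussCG (branch (t * I)) = conj omg * ((rhoCG * √(t + t⁻¹))⁻¹ : ℝ) := by
  have hu : 0 < √(t + t⁻¹) := Real.sqrt_pos.2 (by positivity)
  have hr := rhoCG_ne_zero
  have hu' : ((√(t + t⁻¹) : ℝ) : ℂ) ≠ 0 := ofReal_ne_zero.2 hu.ne'
  have ht : (t : ℂ) ≠ 0 := ofReal_ne_zero.2 h0.ne'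
  have ho := omg_ne_zero
  rw [gaussCG, branch_fst, branch_snd, branchY_mul_I h0,
    div_eq_iff (by simp [hr, hu', ht, ho])]
  push_cast
  generalize ((√(t + t⁻¹) : ℝ) : ℂ) = u at hu'
  field_simp
  linear_combination -omg_mul_conj

lemma hasDerivAt_PhiB_of_lt_one {t : ℝ} (h0 : 0 < t) (h1 : t < 1) :
    HasDerivAt (fun t : ℝ => (PhiB t).im)
      (2 * (rhoCG * √(t⁻¹ - t) - (rhoCG * √(t⁻¹ - t))⁻¹)) t := by
  have h := imCLM.hasFDerivAt.comp_hasDerivAt t (hasDerivAt_PhiB (l := fun t : ℝ => (t : ℂ))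
    ofRealCLM.hasDerivAt (ofReal_mem_quad h0.le) (ofReal_ne_zero.2 h0.ne')
    (by simpa using h1.ne))
  refine h.congr_deriv ?_
  rw [gaussCG_branch_of_lt_one h0 h1]
  have hk : rhoCG * √(t⁻¹ - t) ≠ 0 := by
    refine (mul_pos rhoCG_pos (Real.sqrt_pos.2 (sub_pos.2 ?_))).ne'
    exact h1.trans ((one_lt_inv₀ h0).2 h1)
  set k := rhoCG * √(t⁻¹ - t)
  have hk2 : k * (k⁻¹ * k⁻¹) = k⁻¹ := by rw [← mul_assoc, mul_inv_cancel₀ hk, one_mul]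
  simp [div_eq_mul_inv]
  linarith

lemma hasDerivAt_PhiB_of_one_lt {t : ℝ} (h1 : 1 < t) :
    HasDerivAt (fun t : ℝ => (PhiB t).re)
      (2 * ((rhoCG * √(t - t⁻¹))⁻¹ - rhoCG * √(t - t⁻¹))) t := by
  have h := reCLM.hasFDerivAt.comp_hasDerivAt t (hasDerivAt_PhiB (l := fun t : ℝ => (t : ℂ))
    ofRealCLM.hasDerivAt (ofReal_mem_quad (by linarith)) (ofReal_ne_zero.2 (by linarith))
    (by simpa using h1.ne'))
  refine h.congr_deriv ?_
  rw [gaussCG_branch_of_one_lt h1]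
  set k := rhoCG * √(t - t⁻¹)
  simp

lemma hasDerivAt_PhiB_mul_I {t : ℝ} (h0 : 0 < t) :
    HasDerivAt (fun t : ℝ => (conj omg * PhiB (t * I)).re)
      (2 * ((rhoCG * √(t + t⁻¹))⁻¹ + rhoCG * √(t + t⁻¹))) t := by
  have hl : HasDerivAt (fun t : ℝ => (t * I : ℂ)) I t := by
    simpa using ofRealCLM.hasDerivAt.mul_const I
  have h := reCLM.hasFDerivAt.comp_hasDerivAt t ((hasDerivAt_PhiB hl (mul_I_mem_quad h0.le)
    (by simp [h0.ne']) (fun h => by simpa using congrArg Complex.re h)).const_mul (conj omg))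
  refine h.congr_deriv ?_
  rw [gaussCG_branch_mul_I h0]
  set k := rhoCG * √(t + t⁻¹)
  have e : conj omg * (2 * (conj omg * ((k⁻¹ : ℝ) : ℂ) * I -
      conj (I / (conj omg * ((k⁻¹ : ℝ) : ℂ))))) = ((2 * (k⁻¹ + k) : ℝ) : ℂ) := by
    have e1 : I / (conj omg * ((k⁻¹ : ℝ) : ℂ)) = I * omg * k := by
      have : (conj omg)⁻¹ = omg := inv_eq_of_mul_eq_one_left omg_mul_conj
      rw [div_eq_mul_inv, mul_inv, this]
      push_cast
      rw [inv_inv]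
      ring
    rw [e1]
    simp only [map_mul, conj_I, conj_ofReal]
    push_cast
    linear_combination (2 * I * (k : ℂ)⁻¹ + 2 * I * k) * conj_omg_sq -
      (2 * (k : ℂ)⁻¹ + 2 * k) * I_sq
  rw [e]
  simp

lemma sub_inv_lt_sub_inv {a b : ℝ} (ha : 0 < a) (h : a < b) : a - a⁻¹ < b - b⁻¹ := by
  have : b⁻¹ < a⁻¹ := inv_strictAnti₀ ha h
  linarith

lemma continuousOn_PhiB_ofReal : ContinuousOn (fun t : ℝ => PhiB t) (Set.Ici 0) :=
  continuousOn_PhiB.comp (by fun_prop) fun _ ht => ofReal_mem_quad ht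

/-- Over `(0, 1)` the function `Φ / i` is positive: it is strictly concave and vanishes at both
ends. -/
lemma PhiB_im_pos {t : ℝ} (h0 : 0 < t) (h1 : t < 1) : 0 < (PhiB t).im := by
  have hconc : StrictConcaveOn ℝ (Set.Icc (0 : ℝ) 1) fun t : ℝ => (PhiB t).im := by
    refine StrictAntiOn.strictConcaveOn_of_deriv (convex_Icc 0 1)
      ((continuous_im.comp_continuousOn continuousOn_PhiB_ofReal).mono Set.Icc_subset_Ici_self) ?_
    rw [interior_Icc]
    rintro a ⟨ha0, ha1⟩ b ⟨hb0, hb1⟩ hab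
    rw [(hasDerivAt_PhiB_of_lt_one ha0 ha1).deriv, (hasDerivAt_PhiB_of_lt_one hb0 hb1).deriv]
    have hb : b < b⁻¹ := hb1.trans ((one_lt_inv₀ hb0).2 hb1)
    have hs : √(b⁻¹ - b) < √(a⁻¹ - a) := by
      refine Real.sqrt_lt_sqrt (sub_nonneg.2 hb.le) ?_
      have := inv_strictAnti₀ ha0 hab
      linarith
    have := sub_inv_lt_sub_inv (mul_pos rhoCG_pos (Real.sqrt_pos.2 (sub_pos.2 hb)))
      (mul_lt_mul_of_pos_left hs rhoCG_pos)
    linarith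
  have h := hconc.2 (show (0 : ℝ) ∈ Set.Icc (0 : ℝ) 1 by simp)
    (show (1 : ℝ) ∈ Set.Icc (0 : ℝ) 1 by simp) zero_ne_one (show 0 < 1 - t by linarith) h0 (by ring)
  simpa [PhiB_zero, PhiB_one] using h

lemma strictConcaveOn_PhiB_re : StrictConcaveOn ℝ (Set.Ici (1 : ℝ)) fun t : ℝ => (PhiB t).re := by
  refine StrictAntiOn.strictConcaveOn_of_deriv (convex_Ici 1)
    ((continuous_re.comp_continuousOn continuousOn_PhiB_ofReal).mono
      (Set.Ici_subset_Ici.2 zero_le_one)) ?_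
  rw [interior_Ici]
  intro a ha b hb hab
  have ha1 : 1 < a := ha
  rw [(hasDerivAt_PhiB_of_one_lt ha).deriv, (hasDerivAt_PhiB_of_one_lt hb).deriv]
  have ha' : a⁻¹ < a := (inv_lt_one_of_one_lt₀ ha).trans ha
  have hs : √(a - a⁻¹) < √(b - b⁻¹) :=
    Real.sqrt_lt_sqrt (sub_nonneg.2 ha'.le) (sub_inv_lt_sub_inv (by linarith) hab)
  have := sub_inv_lt_sub_inv (mul_pos rhoCG_pos (Real.sqrt_pos.2 (sub_pos.2 ha')))
    (mul_lt_mul_of_pos_left hs rhoCG_pos)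
  linarith

/-- Over `(1, ∞)` the real function `Φ` has exactly one zero: it is strictly concave, increasing
near `1` and eventually decreasing. -/
lemma exists_zero_PhiB : ∃ s : ℝ, 1 < s ∧ ∀ t : ℝ, 1 < t → (PhiB t = 0 ↔ t = s) := by
  have hr := rhoCG_pos
  have hcont : ContinuousOn (fun t : ℝ => (PhiB t).re) (Set.Ici 1) :=
    (continuous_re.comp_continuousOn continuousOn_PhiB_ofReal).mono
      (Set.Ici_subset_Ici.2 zero_le_one)
  have hiff : ∀ t : ℝ, 1 < t → (PhiB t = 0 ↔ (PhiB t).re = 0) := fun t ht =>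
    ⟨fun h => by rw [h, zero_re], fun h => Complex.ext h (PhiB_im_of_one_lt ht)⟩
  -- `Φ` is positive at some `a > 1`
  obtain ⟨a, ha1, ha⟩ : ∃ a : ℝ, 1 < a ∧ rhoCG * √(a - a⁻¹) < 1 := by
    have hc : ContinuousAt (fun a : ℝ => rhoCG * √(a - a⁻¹)) 1 := by
      refine continuousAt_const.mul (ContinuousAt.sqrt ?_)
      exact continuousAt_id.sub (continuousAt_inv₀ one_ne_zero)
    have he : ∀ᶠ a in 𝓝[>] (1 : ℝ), rhoCG * √(a - a⁻¹) < 1 :=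
      nhdsWithin_le_nhds (hc.eventually_lt_const (by simp))
    obtain ⟨a, h1, h2⟩ := (he.and self_mem_nhdsWithin).exists
    exact ⟨a, h2, h1⟩
  have hapos : 0 < (PhiB a).re := by
    have hm : StrictMonoOn (fun t : ℝ => (PhiB t).re) (Set.Icc 1 a) := by
      refine strictMonoOn_of_deriv_pos (convex_Icc 1 a) (hcont.mono Set.Icc_subset_Ici_self) ?_
      rw [interior_Icc]
      rintro t ⟨ht1, hta⟩
      rw [(hasDerivAt_PhiB_of_one_lt ht1).deriv]
      have ht' : t⁻¹ < t := (inv_lt_one_of_one_lt₀ ht1).trans ht1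
      have hs : √(t - t⁻¹) < √(a - a⁻¹) :=
        Real.sqrt_lt_sqrt (sub_nonneg.2 ht'.le) (sub_inv_lt_sub_inv (by linarith) hta)
      have hk : 0 < rhoCG * √(t - t⁻¹) := mul_pos hr (Real.sqrt_pos.2 (sub_pos.2 ht'))
      have hk1 : rhoCG * √(t - t⁻¹) < 1 := (mul_lt_mul_of_pos_left hs hr).trans ha
      have := (one_lt_inv₀ hk).2 hk1
      linarith
    have h := hm (Set.left_mem_Icc.2 ha1.le) (Set.right_mem_Icc.2 ha1.le) ha1
    simpa [PhiB_one] using h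
  -- `Φ` is negative at some `b > a`
  obtain ⟨b, hab, hb⟩ : ∃ b : ℝ, a < b ∧ (PhiB b).re ≤ 0 := by
    set c : ℝ := 1 + 4 / rhoCG ^ 2 with hc
    have hc1 : 1 < c := by
      have : 0 < 4 / rhoCG ^ 2 := by positivity
      linarith
    have hslope : ∀ x ∈ interior (Set.Ici c), deriv (fun t : ℝ => (PhiB t).re) x ≤ -3 := by
      rw [interior_Ici]
      intro t ht
      have ht1 : 1 < t := hc1.trans ht
      rw [(hasDerivAt_PhiB_of_one_lt ht1).deriv]
      have hk : 2 ≤ rhoCG * √(t - t⁻¹) := by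
        have h1 : 4 / rhoCG ^ 2 ≤ t - t⁻¹ := by
          have := inv_lt_one_of_one_lt₀ ht1
          have : c < t := ht
          linarith
        have h2 : √(4 / rhoCG ^ 2) ≤ √(t - t⁻¹) := Real.sqrt_le_sqrt h1
        rw [Real.sqrt_div (by norm_num), Real.sqrt_sq hr.le, show (4 : ℝ) = 2 ^ 2 by norm_num,
          Real.sqrt_sq (by norm_num), div_le_iff₀ hr] at h2
        linarith
      have := inv_anti₀ two_pos hk
      linarith
    have hd : DifferentiableOn ℝ (fun t : ℝ => (PhiB t).re) (interior (Set.Ici c)) := by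
      rw [interior_Ici]
      exact fun t ht =>
        (hasDerivAt_PhiB_of_one_lt (hc1.trans ht)).differentiableAt.differentiableWithinAt
    have hlin := Convex.image_sub_le_mul_sub_of_deriv_le (convex_Ici c)
      (hcont.mono (Set.Ici_subset_Ici.2 hc1.le)) hd hslope
    refine ⟨max (a + 1) (c + |(PhiB c).re|), lt_of_lt_of_le (by linarith) (le_max_left _ _), ?_⟩
    set b := max (a + 1) (c + |(PhiB c).re|)
    have hbc : c + |(PhiB c).re| ≤ b := le_max_right _ _
    have habs := abs_nonneg (PhiB c).re
    have h := hlin c Set.self_mem_Ici b (show c ≤ b by linarith) (by linarith)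
    have := le_abs_self (PhiB c).re
    linarith
  obtain ⟨s, ⟨has, hsb⟩, hs⟩ := intermediate_value_Icc' hab.le
    (hcont.mono (Set.Icc_subset_Ici_self.trans (Set.Ici_subset_Ici.2 ha1.le))) ⟨hb, hapos.le⟩
  have hs1 : 1 < s := lt_of_lt_of_le ha1 has
  simp only at hs
  -- a strictly concave function vanishing at `1` has at most one further zero
  have huniq : ∀ u v : ℝ, 1 < u → u < v → (PhiB u).re = 0 → (PhiB v).re = 0 → False := by
    intro u v hu huv h1 h2
    have hv : 0 < v - 1 := by linarith
    have h := strictConcaveOn_PhiB_re.2 (Set.self_mem_Ici (a := (1 : ℝ)))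
      (show v ∈ Set.Ici (1 : ℝ) by rw [Set.mem_Ici]; linarith) (by linarith)
      (show 0 < (v - u) / (v - 1) from div_pos (by linarith) hv)
      (show 0 < (u - 1) / (v - 1) from div_pos (by linarith) hv) (by field_simp; ring)
    have e : ((v - u) / (v - 1)) • (1 : ℝ) + ((u - 1) / (v - 1)) • v = u := by
      simp only [smul_eq_mul]
      field_simp
      ring
    simp only [e, h1, h2, ofReal_one, PhiB_one] at h
    simp at h
  refine ⟨s, hs1, fun t ht => ?_⟩
  rw [hiff t ht]
  constructor
  · intro h
    rcases lt_trichotomy t s with h1 | h1 | h1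
    · exact (huniq t s ht h1 h hs).elim
    · exact h1
    · exact (huniq s t hs1 h1 hs h).elim
  · rintro rfl
    exact hs

/-- The imaginary part of `Φ` is strictly increasing along vertical half lines. -/
lemma PhiB_im_lt {σ t : ℝ} (hσ : 0 < σ) (ht : 0 < t) :
    (PhiB σ).im < (PhiB (σ + t * I)).im := by
  have hQ : ∀ t : ℝ, 0 ≤ t → (σ + t * I : ℂ) ∈ quad := fun t ht =>
    ⟨by simpa using hσ.le, by simpa using ht⟩
  have hm : StrictMonoOn (fun t : ℝ => (PhiB (σ + t * I)).im) (Set.Ici 0) := by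
    refine strictMonoOn_of_deriv_pos (convex_Ici 0) ?_ ?_
    · exact continuous_im.comp_continuousOn
        (continuousOn_PhiB.comp (by fun_prop) fun t ht => hQ t ht)
    · rw [interior_Ici]
      intro t ht
      have ht' : 0 < t := ht
      have hl : HasDerivAt (fun t : ℝ => (σ + t * I : ℂ)) I t := by
        simpa using (ofRealCLM.hasDerivAt.mul_const I).const_add (σ : ℂ)
      have h := imCLM.hasFDerivAt.comp_hasDerivAt t (hasDerivAt_PhiB hl (hQ t ht'.le)
        (fun h => by simpa [hσ.ne'] using congrArg Complex.re h)
        (fun h => by simpa [ht'.ne'] using congrArg Complex.im h))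
      have hG := gaussCG_branch_re_pos (x := σ + t * I) (by simpa using hσ) (by simpa using ht')
      have hd : 0 < imCLM (2 * (gaussCG (branch (σ + t * I)) * I -
          conj (I / gaussCG (branch (σ + t * I))))) := by
        set G := gaussCG (branch (σ + t * I))
        have hG2 : 0 < (G⁻¹).re := by
          rw [inv_re]
          exact div_pos hG (normSq_pos.2 fun h => by simp [h] at hG)
        have : imCLM (2 * (G * I - conj (I / G))) = 2 * (G.re + (G⁻¹).re) := by
          rw [div_eq_mul_inv]
          simp
        rw [this]
        linarith
      have h2 : deriv (fun t : ℝ => (PhiB (σ + t * I)).im) t = _ := h.deriv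
      rw [h2]
      exact hd
  have h := hm Set.self_mem_Ici ht.le ht
  simpa using h

/-- Along the imaginary axis, `Φ / exp (i π / 4)` increases from `0` to `∞`. -/
lemma PhiB_mul_I_growth {t : ℝ} (ht : 0 ≤ t) : 4 * t ≤ (conj omg * PhiB (t * I)).re := by
  have hc : ContinuousOn (fun t : ℝ => (conj omg * PhiB (t * I)).re) (Set.Ici 0) :=
    continuous_re.comp_continuousOn (continuousOn_const.mul
      (continuousOn_PhiB.comp (by fun_prop) fun t ht => mul_I_mem_quad ht))
  have hd : DifferentiableOn ℝ (fun t : ℝ => (conj omg * PhiB (t * I)).re)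
      (interior (Set.Ici 0)) := by
    rw [interior_Ici]
    exact fun t ht => (hasDerivAt_PhiB_mul_I ht).differentiableAt.differentiableWithinAt
  -- the derivative is `2 (k⁻¹ + k)` with `k = ρ √(t + 1 / t) > 0`, which is at least `4`
  have h := Convex.mul_sub_le_image_sub_of_le_deriv (convex_Ici 0) hc hd (C := 4) (by
    rw [interior_Ici]
    intro t ht
    have ht' : 0 < t := ht
    rw [(hasDerivAt_PhiB_mul_I ht).deriv]
    have hk : 0 < rhoCG * √(t + t⁻¹) := mul_pos rhoCG_pos (Real.sqrt_pos.2 (by positivity))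
    set k := rhoCG * √(t + t⁻¹)
    have : k⁻¹ * k = 1 := inv_mul_cancel₀ hk.ne'
    have hk' : 0 < k⁻¹ := by positivity
    nlinarith [sq_nonneg (k⁻¹ - k), sq_nonneg (k⁻¹ + k - 2)]) 0 Set.self_mem_Ici t ht ht
  simpa [PhiB_zero] using h

lemma exists_PhiB_mul_I {r : ℝ} (hr : 0 ≤ r) : ∃ t : ℝ, 0 ≤ t ∧ PhiB (t * I) = r * omg := by
  have hc : ContinuousOn (fun t : ℝ => (conj omg * PhiB (t * I)).re) (Set.Icc 0 r) :=
    (continuous_re.comp_continuousOn (continuousOn_const.mul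
      (continuousOn_PhiB.comp (by fun_prop) fun t ht => mul_I_mem_quad ht))).mono
      Set.Icc_subset_Ici_self
  obtain ⟨t, ⟨ht, -⟩, h⟩ := intermediate_value_Icc hr hc
    ⟨by simpa [PhiB_zero] using hr, by linarith [PhiB_mul_I_growth hr]⟩
  refine ⟨t, ht, ?_⟩
  simp only at h
  rw [PhiB_mul_I ht, h]

/-! ### Zeros and level sets -/

lemma eq_or_eq_negC {p q : CGCurve} (h : (p : ℂ × ℂ).1 = (q : ℂ × ℂ).1) : p = q ∨ p = negC q := by
  have h1 : (p : ℂ × ℂ).2 ^ 2 = (q : ℂ × ℂ).2 ^ 2 := by rw [p.2, q.2, h]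
  rcases sq_eq_sq_iff_eq_or_eq_neg.1 h1 with h2 | h2
  · exact Or.inl (Subtype.ext (Prod.ext h h2))
  · exact Or.inr (Subtype.ext (Prod.ext h h2))

lemma negC_negC (p : CGCurve) : negC (negC p) = p := Subtype.ext (Prod.ext rfl (by simp))

lemma rotC_rotC (p : CGCurve) : rotC (rotC p) = negC p := by
  refine Subtype.ext (Prod.ext (by simp) ?_)
  simp only [rotC_snd, negC_snd]
  linear_combination (p : ℂ × ℂ).2 * I_sq

/-- A property of points of the curve with `Re x ≥ 0` that is invariant under `y ↦ -y` and complex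
conjugation can be checked on the branch over the closed first quadrant. -/
lemma curve_induction_right {P : CGCurve → Prop} (hn : ∀ p, P p → P (negC p))
    (hc : ∀ p, P p → P (conjC p)) (hb : ∀ x ∈ quad, P (branch x)) (p : CGCurve)
    (hp : 0 ≤ (p : ℂ × ℂ).1.re) : P p := by
  have key : ∀ p : CGCurve, (p : ℂ × ℂ).1 ∈ quad → P p := by
    intro p hp
    rcases eq_or_eq_negC (p := p) (q := branch (p : ℂ × ℂ).1) rfl with h | h
    · rw [h]
      exact hb _ hp
    · rw [h]
      exact hn _ (hb _ hp)
  rcases le_total 0 (p : ℂ × ℂ).1.im with h | h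
  · exact key p ⟨hp, h⟩
  · rw [← conjC_conjC p]
    exact hc _ (key _ ⟨by simpa using hp, by simpa using h⟩)

lemma curve_induction {P : CGCurve → Prop} (hn : ∀ p, P p → P (negC p))
    (hr : ∀ p, P p → P (rotC p)) (hc : ∀ p, P p → P (conjC p)) (hb : ∀ x ∈ quad, P (branch x))
    (p : CGCurve) : P p := by
  rcases le_total 0 (p : ℂ × ℂ).1.re with h | h
  · exact curve_induction_right hn hc hb p h
  · have h1 : P (rotC p) := curve_induction_right hn hc hb _ (by simpa using h)
    have h2 := hn _ (hr _ h1)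
    rwa [rotC_rotC, negC_negC] at h2

/-- The zeros of `Φ`: besides the branch points `x = 0, ±1` these are the points over `x = ±s` for a
real number `s > 1`. -/
theorem exists_zeros_PhiC : ∃ s : ℝ, 1 < s ∧ ∀ p : CGCurve, PhiC p = 0 ↔
    (p : ℂ × ℂ).1 = 0 ∨ (p : ℂ × ℂ).1 = 1 ∨ (p : ℂ × ℂ).1 = -1 ∨ (p : ℂ × ℂ).1 = s ∨
      (p : ℂ × ℂ).1 = -s := by
  obtain ⟨s, hs1, hs⟩ := exists_zero_PhiB
  refine ⟨s, hs1, fun p => ⟨?_, ?_⟩⟩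
  · refine curve_induction (P := fun p => PhiC p = 0 → (p : ℂ × ℂ).1 = 0 ∨ (p : ℂ × ℂ).1 = 1 ∨
      (p : ℂ × ℂ).1 = -1 ∨ (p : ℂ × ℂ).1 = s ∨ (p : ℂ × ℂ).1 = -s) ?_ ?_ ?_ ?_ p
    · intro p h h0
      rw [PhiC_negC, neg_eq_zero] at h0
      exact h h0
    · intro p h h0
      rw [PhiC_rotC] at h0
      have h1 := h ((mul_eq_zero.1 h0).resolve_left (neg_ne_zero.2 I_ne_zero))
      rw [rotC_fst, neg_eq_zero, neg_inj, neg_eq_iff_eq_neg, neg_eq_iff_eq_neg]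
      tauto
    · intro p h h0
      rw [PhiC_conjC, map_eq_zero] at h0
      rw [conjC_fst]
      rcases h h0 with h | h | h | h | h <;> rw [h] <;> simp
    · intro x hx h0
      rw [branch_fst]
      change PhiB x = 0 at h0
      have ex : x = (x.re : ℂ) + (x.im : ℝ) * I := (re_add_im x).symm
      rcases hx.1.eq_or_lt with h1 | h1
      · -- the imaginary axis
        left
        have hxI : x = (x.im : ℝ) * I := by
          rw [← h1] at ex
          simpa using ex
        have h2 := PhiB_mul_I_growth hx.2
        rw [← hxI, h0] at h2
        simp at h2
        exact Complex.ext h1.symm (le_antisymm (by rw [zero_im]; linarith) hx.2)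
      · rcases hx.2.eq_or_lt with h2 | h2
        · -- the real axis
          have hxr : x = (x.re : ℂ) := by
            rw [← h2] at ex
            simpa using ex
          rcases lt_trichotomy x.re 1 with h3 | h3 | h3
          · have h4 := PhiB_im_pos h1 h3
            rw [← hxr, h0] at h4
            simp at h4
          · right
            left
            rw [hxr, h3, ofReal_one]
          · right
            right
            right
            left
            rw [hxr] at h0 ⊢
            rw [(hs _ h3).1 h0]
        · -- the interior
          have h3 := PhiB_im_lt h1 h2
          rw [← ex, h0, zero_im] at h3
          rcases lt_trichotomy x.re 1 with h4 | h4 | h4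
          · linarith [PhiB_im_pos h1 h4]
          · rw [h4, ofReal_one, PhiB_one] at h3
            simp at h3
          · rw [PhiB_im_of_one_lt h4] at h3
            exact (lt_irrefl _ h3).elim
  · have key : ∀ p : CGCurve, (p : ℂ × ℂ).1 = s → PhiC p = 0 := by
      intro p hp
      have h0 : PhiC (branch s) = 0 := (hs s hs1).2 rfl
      rcases eq_or_eq_negC (p := p) (q := branch s) hp with h | h
      · rw [h, h0]
      · rw [h, PhiC_negC, h0, neg_zero]
    rintro (h | h | h | h | h)
    · exact PhiC_eq_zero_of_x (Or.inl h)
    · exact PhiC_eq_zero_of_x (Or.inr (Or.inl h))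
    · exact PhiC_eq_zero_of_x (Or.inr (Or.inr h))
    · exact key p h
    · have h1 := key (rotC p) (by rw [rotC_fst, h, neg_neg])
      rw [PhiC_rotC] at h1
      exact (mul_eq_zero.1 h1).resolve_left (neg_ne_zero.2 I_ne_zero)

/-- Over the imaginary axis, `Φ` takes values in two orthogonal lines. -/
lemma PhiC_of_re_eq_zero (p : CGCurve) (hp : (p : ℂ × ℂ).1.re = 0) :
    ∃ r : ℝ, PhiC p = r * omg ∨ PhiC p = r * conj omg := by
  refine curve_induction_right (P := fun p => (p : ℂ × ℂ).1.re = 0 →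
    ∃ r : ℝ, PhiC p = r * omg ∨ PhiC p = r * conj omg) ?_ ?_ ?_ p hp.ge hp
  · rintro p h h0
    obtain ⟨r, hr⟩ := h h0
    refine ⟨-r, ?_⟩
    rw [PhiC_negC]
    push_cast
    rcases hr with hr | hr
    · left
      rw [hr]
      ring
    · right
      rw [hr]
      ring
  · rintro p h h0
    obtain ⟨r, hr⟩ := h (by simpa using h0)
    refine ⟨r, ?_⟩
    rw [PhiC_conjC]
    rcases hr with hr | hr
    · right
      rw [hr]
      simp
    · left
      rw [hr]
      simp
  · intro x hx h0
    refine ⟨(conj omg * PhiB (x.im * I)).re, Or.inl ?_⟩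
    have hxI : x = (x.im : ℝ) * I := by
      rw [branch_fst] at h0
      have ex := (re_add_im x).symm
      rw [h0] at ex
      simpa using ex
    change PhiB x = _
    conv_lhs => rw [hxI]
    exact PhiB_mul_I hx.2

/-- Over the imaginary axis, `Φ` takes all values in these two lines. -/
lemma exists_PhiC_of_re_eq_zero (r : ℝ) :
    (∃ p : CGCurve, (p : ℂ × ℂ).1.re = 0 ∧ PhiC p = r * omg) ∧
      ∃ p : CGCurve, (p : ℂ × ℂ).1.re = 0 ∧ PhiC p = r * conj omg := by
  have key : ∃ p : CGCurve, (p : ℂ × ℂ).1.re = 0 ∧ PhiC p = r * omg := by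
    rcases le_total 0 r with h | h
    · obtain ⟨t, -, h2⟩ := exists_PhiB_mul_I h
      exact ⟨branch (t * I), by simp, h2⟩
    · obtain ⟨t, -, h2⟩ := exists_PhiB_mul_I (neg_nonneg.2 h)
      refine ⟨negC (branch (t * I)), by simp, ?_⟩
      rw [PhiC_negC]
      change -PhiB _ = _
      rw [h2]
      push_cast
      ring
  refine ⟨key, ?_⟩
  obtain ⟨p, h1, h2⟩ := key
  exact ⟨conjC p, by simpa using h1, by rw [PhiC_conjC, h2]; simp⟩

lemma exists_PhiC_of_re_eq_half : ∃ p : CGCurve, (p : ℂ × ℂ).1 = (1 / 2 : ℝ) ∧ (PhiC p).re = 0 :=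
  ⟨branch ((1 / 2 : ℝ)), rfl, PhiB_re_of_lt_one (by norm_num) (by norm_num)⟩

/-- Over the line `Re x = 1 / 2`, the function `Φ` is never real. -/
lemma PhiC_im_ne_zero_of_re_eq_half (p : CGCurve) (hp : (p : ℂ × ℂ).1.re = 1 / 2) :
    (PhiC p).im ≠ 0 := by
  refine curve_induction_right (P := fun p => (p : ℂ × ℂ).1.re = 1 / 2 → (PhiC p).im ≠ 0)
    ?_ ?_ ?_ p (by rw [hp]; norm_num) hp
  · intro p h h0
    rw [PhiC_negC, neg_im]
    exact neg_ne_zero.2 (h h0)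
  · intro p h h0
    rw [PhiC_conjC, conj_im]
    exact neg_ne_zero.2 (h (by simpa using h0))
  · intro x hx h0
    rw [branch_fst] at h0
    change (PhiB x).im ≠ 0
    have ex : x = (x.re : ℂ) + (x.im : ℝ) * I := (re_add_im x).symm
    have h1 : 0 < (PhiB (x.re : ℂ)).im := PhiB_im_pos (by rw [h0]; norm_num) (by rw [h0]; norm_num)
    rcases hx.2.eq_or_lt with h2 | h2
    · rw [ex, ← h2]
      simpa using h1.ne'
    · have h3 := PhiB_im_lt (σ := x.re) (by rw [h0]; norm_num) h2
      rw [← ex] at h3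
      linarith

end ChenGackstatter

end

noncomputable section

namespace ChenGackstatter

open Complex PeriodPair

/-! ### Lorentz transformations preserving the surface: block structure -/

/-- The identification of `ℂ × ℂ` with `ℝ⁴₁`. -/
def emb (z w : ℂ) : R41 := ![z.re, z.im, w.re, w.im]

lemma emb_add (z w z' w' : ℂ) : emb z w + emb z' w' = emb (z + z') (w + w') := by
  ext k
  fin_cases k <;> simp [emb]

lemma smul_emb (r : ℝ) (z w : ℂ) : r • emb z w = emb (r * z) (r * w) := by
  ext k
  fin_cases k <;> simp [emb]

lemma emb_eta (P : R41) : emb ⟨P 0, P 1⟩ ⟨P 2, P 3⟩ = P := by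
  ext k
  fin_cases k <;> simp [emb]

lemma emb_inj {z w z' w' : ℂ} : emb z w = emb z' w' ↔ z = z' ∧ w = w' := by
  constructor
  · intro h
    have h0 := congrFun h 0
    have h1 := congrFun h 1
    have h2 := congrFun h 2
    have h3 := congrFun h 3
    simp only [emb, Matrix.cons_val] at h0 h1 h2 h3
    exact ⟨Complex.ext h0 h1, Complex.ext h2 h3⟩
  · rintro ⟨rfl, rfl⟩
    rfl

lemma lor_emb (z w z' w' : ℂ) :
    lor (emb z w) (emb z' w') = (z * conj z').re + (w.re * w'.re - w.im * w'.im) := by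
  simp [lor, emb]
  ring

lemma continuous_emb : Continuous fun q : ℂ × ℂ => emb q.1 q.2 := by
  refine continuous_pi fun k => ?_
  fin_cases k
  · exact continuous_re.comp continuous_fst
  · exact continuous_im.comp continuous_fst
  · exact continuous_re.comp continuous_snd
  · exact continuous_im.comp continuous_snd

lemma lor_add (u v : R41) : lor (u + v) (u + v) = lor u u + 2 * lor u v + lor v v := by
  simp [lor]
  ring

/-- The last two coordinates of the surface, as a function of `x`. -/
def xi (ζ : ℂ) : ℂ →ₗ[ℝ] ℂ where
  toFun x := ⟨2 * ((ζ + ζ⁻¹) * x).re, 2 * ((ζ - ζ⁻¹) * x).re⟩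
  map_add' x y := by
    apply Complex.ext <;> simp <;> ring
  map_smul' r x := by
    apply Complex.ext <;> simp <;> ring

lemma xi_apply (ζ x : ℂ) : xi ζ x = ⟨2 * ((ζ + ζ⁻¹) * x).re, 2 * ((ζ - ζ⁻¹) * x).re⟩ := rfl

lemma Xstd_eq_emb (ζ : ℂ) (p : CGCurve) : Xstd ζ p = emb (PhiC p) (xi ζ (p : ℂ × ℂ).1) := rfl

lemma xi_form {ζ : ℂ} (hζ : ζ ≠ 0) (x : ℂ) :
    (xi ζ x).re ^ 2 - (xi ζ x).im ^ 2 = 8 * ((x ^ 2).re + kap ζ * ‖x‖ ^ 2) := by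
  obtain ⟨j, hj⟩ : ∃ j, j = ζ⁻¹ := ⟨_, rfl⟩
  have hj1 : ζ * j = 1 := by rw [hj, mul_inv_cancel₀ hζ]
  have e1 := congrArg Complex.re hj1
  have e2 := congrArg Complex.im hj1
  rw [xi_apply, kap, ← hj, ← normSq_eq_norm_sq, normSq_apply]
  simp only [mul_re, mul_im, add_re, add_im, sub_re, sub_im, conj_re, conj_im, one_re, one_im,
    pow_two] at *
  linear_combination 8 * (x.re * x.re - x.im * x.im) * e1 - 16 * x.re * x.im * e2

/-- The real basis `e^{iπ/4}, e^{-iπ/4}` of `ℂ`. -/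
lemma eq_smul_omg (z : ℂ) : z = ((z.re + z.im) * (√2)⁻¹ : ℝ) • omg +
    ((z.re - z.im) * (√2)⁻¹ : ℝ) • conj omg := by
  have h : (√2)⁻¹ * (√2)⁻¹ = (1 / 2 : ℝ) := by
    rw [← mul_inv, Real.mul_self_sqrt (by norm_num)]
    norm_num
  apply Complex.ext <;>
    simp only [add_re, add_im, smul_re, smul_im, conj_re, conj_im, omg_re, omg_im, smul_eq_mul]
  · linear_combination -(2 * z.re) * h
  · linear_combination -(2 * z.im) * h

/-- The surface is asymptotically planar: if `Φ` grows linearly along a sequence, the height is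
negligible. -/
lemma tendsto_Xstd {ζ a : ℂ} {p : ℕ → CGCurve}
    (h : Tendsto (fun n : ℕ => ((n : ℝ)⁻¹ : ℝ) * PhiC (p n)) atTop (𝓝 a)) :
    Tendsto (fun n : ℕ => (n : ℝ)⁻¹ • Xstd ζ (p n)) atTop (𝓝 (emb a 0)) := by
  have hx : Tendsto (fun n : ℕ => ((n : ℝ)⁻¹ : ℝ) • (p n : ℂ × ℂ).1) atTop (𝓝 0) := by
    rw [tendsto_zero_iff_norm_tendsto_zero]
    rw [Metric.tendsto_nhds]
    intro ε hε
    have ha : 0 < ‖a‖ + 1 := by positivity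
    obtain ⟨C, -, hb⟩ := exists_norm_x_le (δ := ε / (‖a‖ + 1)) (by positivity)
    have hlim : Tendsto (fun n : ℕ => ε / (‖a‖ + 1) * ‖((n : ℝ)⁻¹ : ℝ) * PhiC (p n)‖
        + C * (n : ℝ)⁻¹) atTop (𝓝 (ε / (‖a‖ + 1) * ‖a‖ + C * 0)) :=
      (h.norm.const_mul _).add (tendsto_inv_atTop_nhds_zero_nat.const_mul C)
    have hlt : ε / (‖a‖ + 1) * ‖a‖ + C * 0 < ε := by
      rw [mul_zero, add_zero, div_mul_eq_mul_div, div_lt_iff₀ ha]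
      linarith
    filter_upwards [hlim.eventually (gt_mem_nhds hlt)] with n hn
    rw [Real.dist_eq, sub_zero, abs_of_nonneg (norm_nonneg _), norm_smul, norm_inv,
      RCLike.norm_natCast]
    refine lt_of_le_of_lt ?_ hn
    rw [norm_mul, norm_real, norm_inv, RCLike.norm_natCast]
    have := mul_le_mul_of_nonneg_left (hb (p n)) (by positivity : 0 ≤ (n : ℝ)⁻¹)
    linarith
  have h2 : Tendsto (fun n : ℕ => xi ζ (((n : ℝ)⁻¹ : ℝ) • (p n : ℂ × ℂ).1)) atTop (𝓝 (xi ζ 0)) :=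
    ((LinearMap.continuous_of_finiteDimensional (xi ζ)).tendsto 0).comp hx
  rw [map_zero] at h2
  refine ((continuous_emb.tendsto (a, 0)).comp (h.prodMk_nhds h2)).congr fun n => ?_
  simp only [Function.comp, Xstd_eq_emb, smul_emb, map_smul]
  rw [real_smul]

/-- A Lorentz transformation mapping the surface into itself preserves the asymptotic plane
`ℂ × 0` and its orthogonal complement. -/
theorem block_structure {ζ : ℂ} {L : R41 →ₗ[ℝ] R41} (hL : ∀ u, lor (L u) (L u) = lor u u) {v : R41}
    (h : ∀ p, ∃ p', L (Xstd ζ p) + v = Xstd ζ p') :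
    ∃ (l : ℂ ≃ₗᵢ[ℝ] ℂ) (m : ℂ →ₗ[ℝ] ℂ), (∀ z w, L (emb z w) = emb (l z) (m w)) ∧
      ∀ w, (m w).re ^ 2 - (m w).im ^ 2 = w.re ^ 2 - w.im ^ 2 := by
  have hL2 : ∀ u w, lor (L u) (L w) = lor u w := by
    intro u w
    have h1 := hL (u + w)
    rw [map_add, lor_add, lor_add, hL, hL] at h1
    linarith
  have hLc : Continuous L := LinearMap.continuous_of_finiteDimensional L
  have key : ∀ z : ℂ, (∀ n : ℕ, ∃ p, PhiC p = (n : ℝ) * z) → ∃ a, L (emb z 0) = emb a 0 := by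
    intro z hz
    choose p hp using hz
    choose p' hp' using fun n => h (p n)
    have t1 : Tendsto (fun n : ℕ => ((n : ℝ)⁻¹ : ℝ) * PhiC (p n)) atTop (𝓝 z) := by
      refine tendsto_const_nhds.congr' ?_
      filter_upwards [eventually_gt_atTop 0] with n hn
      rw [hp, ofReal_inv, inv_mul_cancel_left₀]
      exact_mod_cast hn.ne'
    have t2 : Tendsto (fun n : ℕ => (n : ℝ)⁻¹ • Xstd ζ (p' n)) atTop (𝓝 (L (emb z 0))) := by
      have := ((hLc.tendsto _).comp (tendsto_Xstd (ζ := ζ) t1)).add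
        ((tendsto_inv_atTop_nhds_zero_nat (𝕜 := ℝ)).smul_const v)
      rw [zero_smul, add_zero] at this
      refine this.congr fun n => ?_
      rw [← hp', smul_add]
      simp
    set u := L (emb z 0)
    refine ⟨⟨u 0, u 1⟩, ?_⟩
    have c0 := ((continuous_apply 0).tendsto u).comp t2
    have c1 := ((continuous_apply 1).tendsto u).comp t2
    have t3 : Tendsto (fun n : ℕ => ((n : ℝ)⁻¹ : ℝ) * PhiC (p' n)) atTop (𝓝 ⟨u 0, u 1⟩) := by
      have e : (⟨u 0, u 1⟩ : ℂ) = (u 0 : ℂ) + (u 1 : ℂ) * I := (mk_eq_add_mul_I _ _)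
      rw [e]
      refine (((continuous_ofReal.tendsto _).comp c0).add
        (((continuous_ofReal.tendsto _).comp c1).mul_const I)).congr fun n => ?_
      simp only [Function.comp, Pi.smul_apply, Xstd, Matrix.cons_val, smul_eq_mul]
      conv_rhs => rw [← re_add_im (PhiC (p' n))]
      push_cast
      ring
    exact tendsto_nhds_unique t2 (tendsto_Xstd t3)
  -- `Φ` takes all values on the lines through `omg` and `conj omg`, which span the plane
  obtain ⟨a, ha⟩ := key omg fun n => by
    obtain ⟨p, -, hp⟩ := (exists_PhiC_of_re_eq_zero n).1
    exact ⟨p, hp⟩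
  obtain ⟨b, hb⟩ := key (conj omg) fun n => by
    obtain ⟨p, -, hp⟩ := (exists_PhiC_of_re_eq_zero n).2
    exact ⟨p, hp⟩
  have hsp : ∀ r s : ℝ, emb (r • omg + s • conj omg) 0 = r • emb omg 0 + s • emb (conj omg) 0 := by
    intro r s
    rw [smul_emb, smul_emb, emb_add]
    simp
  have hz : ∀ z, ∃ c, L (emb z 0) = emb c 0 := by
    intro z
    rw [eq_smul_omg z, hsp, map_add, map_smul, map_smul, ha, hb, smul_emb, smul_emb, emb_add]
    simp only [mul_zero, add_zero]
    exact ⟨_, rfl⟩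
  choose f hf using hz
  have hnorm : ∀ z, ‖f z‖ = ‖z‖ := by
    intro z
    have h1 := hL (emb z 0)
    rw [hf, lor_emb, lor_emb, mul_conj, mul_conj, ofReal_re, ofReal_re, normSq_eq_norm_sq,
      normSq_eq_norm_sq] at h1
    simp only [zero_re, zero_im, mul_zero, sub_zero, add_zero] at h1
    exact (pow_left_inj₀ (norm_nonneg _) (norm_nonneg _) two_ne_zero).1 h1
  let l₀ : ℂ →ₗᵢ[ℝ] ℂ :=
    { toFun := f
      map_add' := fun z w => by
        have : L (emb (z + w) 0) = L (emb z 0) + L (emb w 0) := by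
          rw [← map_add, emb_add, add_zero]
        rw [hf, hf, hf, emb_add, emb_inj] at this
        exact this.1
      map_smul' := fun r z => by
        have : L (emb (r • z) 0) = r • L (emb z 0) := by
          rw [← map_smul, smul_emb, mul_zero, real_smul]
        rw [hf, hf, smul_emb, emb_inj] at this
        exact this.1
      norm_map' := hnorm }
  let l : ℂ ≃ₗᵢ[ℝ] ℂ := l₀.toLinearIsometryEquiv rfl
  have hl : ∀ z, l z = f z := fun z => rfl
  have hw : ∀ w, ∃ c, L (emb 0 w) = emb 0 c := by
    intro w
    refine ⟨⟨L (emb 0 w) 2, L (emb 0 w) 3⟩, ?_⟩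
    rw [← emb_eta (L (emb 0 w)), emb_inj]
    refine ⟨?_, by simp [emb]⟩
    set c : ℂ := ⟨L (emb 0 w) 0, L (emb 0 w) 1⟩ with hc
    have h1 := hL2 (emb 0 w) (emb (l.symm c) 0)
    rw [hf, ← hl, l.apply_symm_apply, ← emb_eta (L (emb 0 w)), ← hc, lor_emb, lor_emb, mul_conj] at h1
    simp at h1
    exact h1
  choose g hg using hw
  let m : ℂ →ₗ[ℝ] ℂ :=
    { toFun := g
      map_add' := fun z w => by
        have : L (emb 0 (z + w)) = L (emb 0 z) + L (emb 0 w) := by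
          rw [← map_add, emb_add, add_zero]
        rw [hg, hg, hg, emb_add, emb_inj] at this
        exact this.2
      map_smul' := fun r z => by
        have : L (emb 0 (r • z)) = r • L (emb 0 z) := by
          rw [← map_smul, smul_emb, mul_zero, real_smul]
        rw [hg, hg, smul_emb, emb_inj] at this
        exact this.2 }
  refine ⟨l, m, fun z w => ?_, fun w => ?_⟩
  · have : emb z w = emb z 0 + emb 0 w := by rw [emb_add, add_zero, zero_add]
    rw [this, map_add, hf, hg, emb_add, add_zero, zero_add]
    rfl
  · have h1 := hL (emb 0 w)
    rw [hg, lor_emb, lor_emb] at h1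
    simp only [map_zero, mul_zero, zero_re, zero_add] at h1
    change (g w).re ^ 2 - (g w).im ^ 2 = _
    linarith

end ChenGackstatter

end

noncomputable section

namespace ChenGackstatter

open Complex PeriodPair

/-! ### Classification of the symmetries -/

/-- The eight automorphisms and antiautomorphisms of the curve generated by `rotC` and `conjC`. -/
def IsSym (w : CGCurve → CGCurve) : Prop := ∃ k : ℕ, w = rotC^[k] ∨ w = conjC ∘ rotC^[k]

lemma rotC_conjC (p : CGCurve) : rotC (conjC p) = conjC (rotC (rotC (rotC p))) := by
  refine Subtype.ext (Prod.ext ?_ ?_)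
  · simp
  · simp only [rotC_snd, conjC_snd, map_mul, conj_I]
    linear_combination I * conj (p : ℂ × ℂ).2 * I_sq

lemma IsSym.rotC_comp {w : CGCurve → CGCurve} (h : IsSym w) : IsSym (rotC ∘ w) := by
  obtain ⟨k, rfl | rfl⟩ := h
  · exact ⟨k + 1, Or.inl (Function.iterate_succ' _ _).symm⟩
  · refine ⟨k + 3, Or.inr (funext fun p => ?_)⟩
    simp only [Function.comp, Function.iterate_succ_apply', rotC_conjC]

lemma IsSym.negC_comp {w : CGCurve → CGCurve} (h : IsSym w) : IsSym (negC ∘ w) := by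
  have := h.rotC_comp.rotC_comp
  convert this using 1
  exact funext fun p => (rotC_rotC _).symm

lemma isSym_id : IsSym id := ⟨0, Or.inl rfl⟩

lemma isSym_conjC : IsSym conjC := ⟨0, Or.inr rfl⟩

lemma exists_of_x (x : ℂ) : ∃ p : CGCurve, (p : ℂ × ℂ).1 = x := ⟨branch x, rfl⟩

lemma re_sq_eq_zero {p : CGCurve} (hp : (p : ℂ × ℂ).1.re = 0) : ((PhiC p) ^ 2).re = 0 := by
  obtain ⟨r, hr | hr⟩ := PhiC_of_re_eq_zero p hp <;> rw [hr, mul_pow]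
  · rw [omg_sq, ← ofReal_pow, re_ofReal_mul, I_re, mul_zero]
  · rw [conj_omg_sq, ← ofReal_pow, re_ofReal_mul, neg_re, I_re, neg_zero, mul_zero]

/-- The real part of `x` cannot be translated, since `x` grows slower than `Φ`. -/
lemma translation_eq_zero (l : ℂ ≃ₗᵢ[ℝ] ℂ) (v : ℂ) (r : ℝ)
    (h : ∀ p : CGCurve, ∃ p' : CGCurve, l (PhiC p) + v = PhiC p' ∧
      (p' : ℂ × ℂ).1.re = (p : ℂ × ℂ).1.re + r) : r = 0 := by
  choose f hf hfx using h
  obtain ⟨o, ho⟩ := exists_of_x 0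
  have ho' : PhiC o = 0 := PhiC_eq_zero_of_x (Or.inl ho)
  have h1 : ∀ n : ℕ, ‖PhiC (f^[n] o)‖ ≤ n * ‖v‖ ∧ ((f^[n] o : CGCurve) : ℂ × ℂ).1.re = n * r := by
    intro n
    induction n with
    | zero => simp [ho, ho']
    | succ n ih =>
      rw [Function.iterate_succ_apply', ← hf, hfx, ih.2]
      push_cast
      refine ⟨(norm_add_le _ _).trans ?_, by ring⟩
      rw [l.norm_map]
      linarith [ih.1]
  by_contra hne
  have hr : 0 < |r| := abs_pos.2 hne
  have hv : 0 < ‖v‖ + 1 := by positivity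
  obtain ⟨C, hC, hb⟩ := exists_norm_x_le (δ := |r| / (2 * (‖v‖ + 1))) (by positivity)
  obtain ⟨n, hn⟩ := exists_nat_gt (2 * C / |r|)
  rw [div_lt_iff₀ hr] at hn
  have h2 := (abs_re_le_norm _).trans (hb (f^[n] o))
  rw [(h1 n).2, abs_mul, Nat.abs_cast] at h2
  have h3 : |r| / (2 * (‖v‖ + 1)) * ‖PhiC (f^[n] o)‖ ≤
      |r| / (2 * (‖v‖ + 1)) * (n * (‖v‖ + 1)) := by
    gcongr
    exact (h1 n).1.trans (by gcongr; linarith)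
  have h4 : |r| / (2 * (‖v‖ + 1)) * (n * (‖v‖ + 1)) = n * |r| / 2 := by
    field_simp
  linarith

/-- Isometries of the plane `Φ` which are compatible with a translation of `Re x`. The image under
`Φ` of the curve `Re x = 0` is a pair of orthogonal lines, which has to be preserved. -/
lemma classify_translation (l : ℂ ≃ₗᵢ[ℝ] ℂ) (v : ℂ) (r : ℝ)
    (h : ∀ p : CGCurve, ∃ p' : CGCurve, l (PhiC p) + v = PhiC p' ∧
      (p' : ℂ × ℂ).1.re = (p : ℂ × ℂ).1.re + r) :
    ∃ w, IsSym w ∧ ∀ p, l (PhiC p) + v = PhiC (w p) ∧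
      ((w p : CGCurve) : ℂ × ℂ).1.re = (p : ℂ × ℂ).1.re := by
  obtain rfl := translation_eq_zero l v r h
  choose f hf hfx using h
  simp only [add_zero] at hfx
  have hsq : ∀ p : CGCurve, (p : ℂ × ℂ).1.re = 0 → ((l (PhiC p) + v) ^ 2).re = 0 := fun p hp => by
    rw [hf]
    exact re_sq_eq_zero (by rw [hfx, hp])
  have hline : ∀ z : ℂ, (∀ r : ℝ, ∃ p : CGCurve, (p : ℂ × ℂ).1.re = 0 ∧ PhiC p = r * z) →
      (l z ^ 2).re = 0 ∧ (l z * v).re = 0 := by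
    intro z hz
    have e : ∀ r : ℝ, ((r * l z + v) ^ 2).re = 0 := by
      intro r
      obtain ⟨p, hp, hp'⟩ := hz r
      have := hsq p hp
      rwa [hp', ← real_smul, map_smul, real_smul] at this
    have e0 := e 0
    have e1 := e 1
    have e2 := e (-1)
    simp only [pow_two, mul_re, add_re, add_im, ofReal_re, ofReal_im, mul_im] at *
    constructor <;> linarith
  obtain ⟨s1, o1⟩ := hline omg fun r => (exists_PhiC_of_re_eq_zero r).1
  obtain ⟨-, o2⟩ := hline (conj omg) fun r => (exists_PhiC_of_re_eq_zero r).2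
  have hv : v = 0 := by
    have e : (l (l.symm (conj v)) * v).re = 0 := by
      rw [eq_smul_omg (l.symm (conj v)), map_add, map_smul, map_smul, add_mul, add_re, smul_mul_assoc,
        smul_mul_assoc, smul_re, smul_re, o1, o2, smul_zero, smul_zero, add_zero]
    rw [l.apply_symm_apply, mul_comm, mul_conj, ofReal_re] at e
    exact normSq_eq_zero.1 e
  subst hv
  simp only [add_zero] at hf ⊢
  obtain ⟨q, hq, hq0⟩ := exists_PhiC_of_re_eq_half
  have hq' : (q : ℂ × ℂ).1.re = 1 / 2 := by rw [hq, ofReal_re]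
  have hqi := PhiC_im_ne_zero_of_re_eq_half (f q) (by rw [hfx, hq'])
  rw [← hf] at hqi
  obtain ⟨a, ha⟩ := linear_isometry_complex l
  have hn : (a : ℂ).re ^ 2 + (a : ℂ).im ^ 2 = 1 := by
    have := normSq_eq_norm_sq (a : ℂ)
    rw [Circle.norm_coe, normSq_apply] at this
    linarith
  have hprod : (a : ℂ).re * (a : ℂ).im = 0 := by
    rcases ha with rfl | rfl
    · rw [rotation_apply, mul_pow, omg_sq] at s1
      simp [pow_two] at s1
      linarith
    · rw [LinearIsometryEquiv.trans_apply, conjLIE_apply, rotation_apply, mul_pow, conj_omg_sq] at s1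
      simp [pow_two] at s1
      linarith
  have him : (a : ℂ).re ≠ 0 := by
    intro h0
    rcases ha with rfl | rfl
    · rw [rotation_apply, mul_im, h0, hq0] at hqi
      simp at hqi
    · rw [LinearIsometryEquiv.trans_apply, conjLIE_apply, rotation_apply, mul_im, h0, conj_re, hq0]
        at hqi
      simp at hqi
  have him0 : (a : ℂ).im = 0 := (mul_eq_zero.1 hprod).resolve_left him
  have ha1 : (a : ℂ) = 1 ∨ (a : ℂ) = -1 := by
    rw [him0] at hn
    rcases sq_eq_one_iff.1 (by linarith : (a : ℂ).re ^ 2 = 1) with h | h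
    · exact Or.inl (Complex.ext h him0)
    · exact Or.inr (Complex.ext (by simpa using h) (by simpa using him0))
  rcases ha with rfl | rfl <;> rcases ha1 with h1 | h1 <;>
    simp only [LinearIsometryEquiv.trans_apply, conjLIE_apply, rotation_apply, h1, one_mul, neg_mul]
  · exact ⟨id, isSym_id, fun p => ⟨rfl, rfl⟩⟩
  · exact ⟨negC ∘ id, isSym_id.negC_comp, fun p => ⟨(PhiC_negC p).symm, rfl⟩⟩
  · exact ⟨conjC, isSym_conjC, fun p => ⟨(PhiC_conjC p).symm, rfl⟩⟩
  · exact ⟨negC ∘ conjC, isSym_conjC.negC_comp,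
      fun p => ⟨by rw [Function.comp, PhiC_negC, PhiC_conjC], rfl⟩⟩

/-- An isometry of the plane `Φ` which agrees with a symmetry up to signs agrees with a symmetry. -/
lemma classify_sign {l l₀ : ℂ ≃ₗᵢ[ℝ] ℂ} {w₀ : CGCurve → CGCurve} (hw₀ : IsSym w₀)
    (h₀ : ∀ p, PhiC (w₀ p) = l₀ (PhiC p))
    (h : ∀ p, l (PhiC p) = PhiC (w₀ p) ∨ l (PhiC p) = -PhiC (w₀ p)) :
    ∃ w, IsSym w ∧ ∀ p, PhiC (w p) = l (PhiC p) ∧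
      ((w p : CGCurve) : ℂ × ℂ).1 = ((w₀ p : CGCurve) : ℂ × ℂ).1 := by
  obtain ⟨p, -, hp⟩ := (exists_PhiC_of_re_eq_zero 1).1
  obtain ⟨p', -, hp'⟩ := (exists_PhiC_of_re_eq_zero 1).2
  obtain ⟨q, hq, hq0⟩ := exists_PhiC_of_re_eq_half
  have hqi := PhiC_im_ne_zero_of_re_eq_half q (by rw [hq, ofReal_re])
  rw [ofReal_one, one_mul] at hp hp'
  have e1 := h p
  have e2 := h p'
  have e3 := h q
  simp only [h₀, hp, hp'] at e1 e2 e3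
  have hex : ∀ z, l z = ((z.re + z.im) * (√2)⁻¹ : ℝ) • l omg +
      ((z.re - z.im) * (√2)⁻¹ : ℝ) • l (conj omg) := fun z => by
    conv_lhs => rw [eq_smul_omg z, map_add, map_smul, map_smul]
  have hex₀ : ∀ z, l₀ z = ((z.re + z.im) * (√2)⁻¹ : ℝ) • l₀ omg +
      ((z.re - z.im) * (√2)⁻¹ : ℝ) • l₀ (conj omg) := fun z => by
    conv_lhs => rw [eq_smul_omg z, map_add, map_smul, map_smul]
  -- at the point with `x = 1 / 2`, different signs on the two lines would exchange `1` and `i`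
  have hbad : ∀ t : ℂ, l₀ (PhiC q) = l₀ t → t.im ≠ (PhiC q).im → False := fun t ht h1 =>
    h1 (by rw [l₀.injective ht])
  rcases e1 with e1 | e1 <;> rcases e2 with e2 | e2
  · refine ⟨w₀, hw₀, fun p => ⟨?_, rfl⟩⟩
    rw [h₀, hex, e1, e2, ← hex₀]
  · exfalso
    have e4 : l (PhiC q) = l₀ (PhiC q).im := by
      rw [hex, hex₀ ((PhiC q).im : ℂ), e1, e2, hq0, ofReal_re, ofReal_im]
      module
    rcases e3 with e3 | e3
    · refine hbad (PhiC q).im (by rw [← e4, e3]) ?_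
      rw [ofReal_im]
      exact hqi.symm
    · refine hbad (-(PhiC q).im) (by rw [map_neg, ← e4, e3, neg_neg]) ?_
      rw [neg_im, ofReal_im, neg_zero]
      exact hqi.symm
  · exfalso
    have e4 : l (PhiC q) = -l₀ (PhiC q).im := by
      rw [hex, hex₀ ((PhiC q).im : ℂ), e1, e2, hq0, ofReal_re, ofReal_im]
      module
    rcases e3 with e3 | e3
    · refine hbad (-(PhiC q).im) (by rw [map_neg, ← e4, e3]) ?_
      rw [neg_im, ofReal_im, neg_zero]
      exact hqi.symm
    · refine hbad (PhiC q).im (by rw [← neg_inj, ← e4, e3]) ?_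
      rw [ofReal_im]
      exact hqi.symm
  · refine ⟨negC ∘ w₀, hw₀.negC_comp, fun p => ⟨?_, rfl⟩⟩
    rw [Function.comp, PhiC_negC, h₀, hex, e1, e2, hex₀]
    module

/-- The rotation of `Φ` by `-π / 2`. -/
def rotP : ℂ ≃ₗᵢ[ℝ] ℂ := rotation ⟨-I, by simp [Submonoid.unitSphere]⟩

lemma rotP_apply (z : ℂ) : rotP z = -I * z := rfl

/-- A real linear map of the `x`-plane which, together with an isometry of the plane `Φ`, maps the
surface into itself. The fibres of `x` show that there is no translation of `Φ`, the zeros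
`0, ±1, ±s` of `Φ` that there is none of `x` either. -/
lemma classify_of_form {κ : ℝ} (hκ : -1 < κ) (hκ' : κ < 1) (l : ℂ ≃ₗᵢ[ℝ] ℂ) (n : ℂ →ₗ[ℝ] ℂ) (v d : ℂ)
    (hform : ∀ x, ((n x) ^ 2).re + κ * ‖n x‖ ^ 2 = (x ^ 2).re + κ * ‖x‖ ^ 2)
    (h : ∀ p : CGCurve, ∃ p' : CGCurve, l (PhiC p) + v = PhiC p' ∧
      n (p : ℂ × ℂ).1 + d = (p' : ℂ × ℂ).1) :
    ∃ w, IsSym w ∧ ∀ p, l (PhiC p) + v = PhiC (w p) ∧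
      n (p : ℂ × ℂ).1 + d = ((w p : CGCurve) : ℂ × ℂ).1 := by
  have hv : v = 0 := by
    -- the images of the two points of a fibre of `x` lie in one fibre, in which `Φ` is odd
    obtain ⟨p, -, hp⟩ := (exists_PhiC_of_re_eq_zero 1).1
    rw [ofReal_one, one_mul] at hp
    obtain ⟨a, ha, hax⟩ := h p
    obtain ⟨b, hb, hbx⟩ := h (negC p)
    rw [PhiC_negC, map_neg] at hb
    rcases eq_or_eq_negC (hax.symm.trans hbx) with e | e
    · rw [← e, ← ha] at hb
      have h0 : l (PhiC p) = 0 := by linear_combination -(1 / 2) * hb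
      rw [map_eq_zero_iff l l.injective, hp] at h0
      exact (omg_ne_zero h0).elim
    · rw [e, PhiC_negC, ← hb] at ha
      linear_combination (1 / 2) * ha
  subst hv
  simp only [add_zero] at h ⊢
  obtain ⟨s, hs1, hs⟩ := exists_zeros_PhiC
  have hZ : ∀ z : ℂ, (z = 0 ∨ z = 1 ∨ z = -1 ∨ z = s ∨ z = -s) →
      (n z + d = 0 ∨ n z + d = 1 ∨ n z + d = -1 ∨ n z + d = s ∨ n z + d = -s) := by
    intro z hz
    obtain ⟨p, rfl⟩ := exists_of_x z
    obtain ⟨p', h1, h2⟩ := h p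
    rw [h2]
    rw [← hs] at hz ⊢
    rw [← h1, hz, map_zero]
  have hreal : ∀ r : ℝ, n r = r * n 1 := fun r => by
    have e : (r : ℂ) = r • (1 : ℂ) := by simp
    rw [e, map_smul, real_smul, real_smul, mul_one]
  have hzr : ∀ r : ℝ, (r = 0 ∨ r = 1 ∨ r = -1 ∨ r = s ∨ r = -s) →
      (r * n 1 + d).im = 0 ∧ ((r * n 1 + d).re = 0 ∨ (r * n 1 + d).re = 1 ∨ (r * n 1 + d).re = -1 ∨
        (r * n 1 + d).re = s ∨ (r * n 1 + d).re = -s) := by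
    intro r hr
    have := hZ r (by rcases hr with rfl | rfl | rfl | rfl | rfl <;> simp)
    rw [hreal] at this
    rcases this with e | e | e | e | e <;> rw [e] <;> simp
  -- `n` maps the real zeros of `Φ` into the real axis, so `n 1` is real; the form evaluated at `1`,
  -- `i` and `1 + i` then gives `n 1 = ± 1` and `n i = ± i`
  have f1 := hform 1
  have fI := hform I
  have f1I := hform (1 + I)
  rw [map_add] at f1I
  simp only [← normSq_eq_norm_sq] at f1 fI f1I
  simp only [normSq_apply, pow_two, mul_re, add_re, add_im, one_re, one_im, I_re,
    I_im] at f1 fI f1I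
  obtain ⟨i0, z0⟩ := hzr 0 (by simp)
  obtain ⟨i1, -⟩ := hzr 1 (by simp)
  obtain ⟨-, z2⟩ := hzr s (by simp)
  obtain ⟨-, z3⟩ := hzr (-s) (by simp)
  simp only [ofReal_zero, ofReal_one, ofReal_neg, zero_mul, one_mul, neg_mul, zero_add, add_re, add_im,
    neg_re, re_ofReal_mul] at i0 z0 i1 z2 z3
  have hn1 : (n 1).im = 0 := by linarith
  rw [hn1] at f1 f1I
  have hre : (n 1).re ^ 2 = 1 := by
    have h1 : (1 + κ) * ((n 1).re ^ 2 - 1) = 0 := by linarith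
    rcases mul_eq_zero.1 h1 with h1 | h1 <;> linarith
  have hI : (n I).re = 0 := by
    have h1 : (1 + κ) * ((n 1).re * (n I).re) = 0 := by linarith
    rcases mul_eq_zero.1 h1 with h1 | h1
    · linarith
    · refine (mul_eq_zero.1 h1).resolve_left fun h0 => ?_
      rw [h0] at hre
      norm_num at hre
  have hIim : (n I).im ^ 2 = 1 := by
    rw [hI] at fI
    have h1 : (κ - 1) * ((n I).im ^ 2 - 1) = 0 := by linarith
    rcases mul_eq_zero.1 h1 with h1 | h1 <;> linarith
  -- `d ± s` both lie in `{0, ±1, ±s}`, hence in `[-s, s]`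
  have hd : d = 0 := by
    have hb : ∀ t : ℝ, (t = 0 ∨ t = 1 ∨ t = -1 ∨ t = s ∨ t = -s) → -s ≤ t ∧ t ≤ s := by
      rintro t (rfl | rfl | rfl | rfl | rfl) <;> constructor <;> linarith
    have b2 := hb _ z2
    have b3 := hb _ z3
    refine Complex.ext ?_ i0
    rw [zero_re]
    rcases sq_eq_one_iff.1 hre with e | e <;> rw [e] at b2 b3 <;> linarith
  subst hd
  simp only [add_zero] at h ⊢
  have hn : ∀ x : ℂ, n x = ⟨(n 1).re * x.re, (n I).im * x.im⟩ := by
    intro x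
    have e : x = x.re • 1 + x.im • I := by simp
    conv_lhs => rw [e]
    rw [map_add, map_smul, map_smul]
    apply Complex.ext <;> simp [hn1, hI] <;> ring
  have key : ∀ (l₀ : ℂ ≃ₗᵢ[ℝ] ℂ) (w₀ : CGCurve → CGCurve), IsSym w₀ →
      (∀ p, PhiC (w₀ p) = l₀ (PhiC p)) →
      (∀ p : CGCurve, n (p : ℂ × ℂ).1 = ((w₀ p : CGCurve) : ℂ × ℂ).1) →
      ∃ w, IsSym w ∧ ∀ p, l (PhiC p) = PhiC (w p) ∧
        n (p : ℂ × ℂ).1 = ((w p : CGCurve) : ℂ × ℂ).1 := by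
    intro l₀ w₀ hw₀ h₀ hx
    obtain ⟨w, hw, hw'⟩ := classify_sign (l := l) hw₀ h₀ fun p => by
      obtain ⟨p', h1, h2⟩ := h p
      rw [h1]
      rcases eq_or_eq_negC (h2.symm.trans (hx p)) with e | e
      · exact Or.inl (by rw [e])
      · exact Or.inr (by rw [e, PhiC_negC])
    exact ⟨w, hw, fun p => ⟨(hw' p).1.symm, (hx p).trans (hw' p).2.symm⟩⟩
  rcases sq_eq_one_iff.1 hre with e1 | e1 <;>
    rcases sq_eq_one_iff.1 hIim with e2 | e2 <;> rw [e1, e2] at hn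
  · exact key (.refl ℝ ℂ) id isSym_id (fun p => rfl) fun p => by
      rw [hn]
      apply Complex.ext <;> simp
  · exact key conjLIE conjC isSym_conjC (fun p => PhiC_conjC p) fun p => by
      rw [hn]
      apply Complex.ext <;> simp
  · exact key (conjLIE.trans rotP) (rotC ∘ conjC) isSym_conjC.rotC_comp
      (fun p => by rw [Function.comp, PhiC_rotC, PhiC_conjC]; rfl) fun p => by
      rw [hn]
      apply Complex.ext <;> simp
  · exact key rotP (rotC ∘ id) isSym_id.rotC_comp (fun p => PhiC_rotC p) fun p => by
      rw [hn]
      apply Complex.ext <;> simp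

lemma kap_lt_one {ζ : ℂ} (h : ζ.im ≠ 0) : kap ζ < 1 := by
  have hn : 0 < normSq ζ := normSq_pos.2 fun h0 => h (by simp [h0])
  have h1 : 0 < ζ.im ^ 2 := by positivity
  have : kap ζ = (ζ.re ^ 2 - ζ.im ^ 2) / normSq ζ := by
    rw [kap, inv_def]
    simp
    field_simp
  rw [this, div_lt_iff₀ hn, normSq_apply]
  nlinarith

lemma xi_injective {ζ : ℂ} (hre : ζ.re ≠ 0) (him : ζ.im ≠ 0) : Function.Injective (xi ζ) := by
  rw [injective_iff_map_eq_zero]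
  intro x hx
  have h0 : ζ ≠ 0 := fun h => hre (by simp [h])
  rw [xi_apply, Complex.ext_iff] at hx
  simp only [zero_re, zero_im] at hx
  have h1 : (ζ * x).re = 0 := by
    have e : ζ * x = ((ζ + ζ⁻¹) * x + (ζ - ζ⁻¹) * x) / 2 := by ring
    rw [e, div_ofNat_re, add_re]
    linarith
  have h2 : (ζ⁻¹ * x).re = 0 := by
    have e : ζ⁻¹ * x = ((ζ + ζ⁻¹) * x - (ζ - ζ⁻¹) * x) / 2 := by ring
    rw [e, div_ofNat_re, sub_re]
    linarith
  have h3 : (conj ζ * x).re = 0 := by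
    have e : conj ζ * x = (normSq ζ : ℂ) * (ζ⁻¹ * x) := by
      rw [← mul_conj]
      field_simp
    rw [e, re_ofReal_mul, h2, mul_zero]
  simp only [mul_re, conj_re, conj_im] at h1 h3
  have h4 : ζ.re * x.re = 0 := by linarith
  have h5 : ζ.im * x.im = 0 := by linarith
  exact Complex.ext ((mul_eq_zero.1 h4).resolve_left hre) ((mul_eq_zero.1 h5).resolve_left him)

/-- For real `ζ` the last two coordinates depend only on the real part of `x`. -/
lemma xi_of_real {ζ : ℂ} (him : ζ.im = 0) (x : ℂ) : xi ζ x = x.re • xi ζ 1 := by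
  have e : ζ = (ζ.re : ℂ) := Complex.ext rfl him
  rw [e]
  simp only [xi_apply, ← ofReal_inv, ← ofReal_add, ← ofReal_sub, re_ofReal_mul, one_re]
  apply Complex.ext <;> simp <;> ring

/-- Every affine Lorentz transformation which maps the surface into itself permutes it by one of the
eight symmetries of the curve. -/
theorem classify {ζ : ℂ} (hζ : ζ.re ≠ 0) {L : R41 →ₗ[ℝ] R41} (hL : ∀ u, lor (L u) (L u) = lor u u)
    {v : R41} (h : ∀ p, ∃ p', L (Xstd ζ p) + v = Xstd ζ p') :
    ∃ w, IsSym w ∧ ∀ p, L (Xstd ζ p) + v = Xstd ζ (w p) := by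
  have h0 : ζ ≠ 0 := fun h => hζ (by simp [h])
  obtain ⟨l, m, hlm, hm⟩ := block_structure hL h
  obtain ⟨a, c, rfl⟩ : ∃ a c, emb a c = v := ⟨_, _, emb_eta v⟩
  simp only [Xstd_eq_emb, hlm, emb_add, emb_inj] at h ⊢
  by_cases him : ζ.im = 0
  · set f := xi ζ 1 with hf
    have hx := fun x => xi_of_real him x
    rw [← hf] at hx
    have hff : f.re ^ 2 - f.im ^ 2 = 16 := by
      rw [hf, xi_form h0]
      have e : kap ζ = 1 := by
        have e : ζ = (ζ.re : ℂ) := Complex.ext rfl him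
        rw [kap, e, ← ofReal_inv, conj_ofReal, ← ofReal_mul, ofReal_re, mul_inv_cancel₀ hζ]
      rw [e]
      norm_num
    have hf0 : f ≠ 0 := fun h => by simp [h] at hff
    simp only [hx] at h ⊢
    obtain ⟨r, hr⟩ : ∃ r : ℝ, c = r • f := by
      obtain ⟨p, hp⟩ := exists_of_x 0
      obtain ⟨p', -, h2⟩ := h p
      rw [hp, zero_re, zero_smul, map_zero, zero_add] at h2
      exact ⟨_, h2⟩
    subst hr
    obtain ⟨ε, hε⟩ : ∃ ε : ℝ, m f = ε • f := by
      obtain ⟨p, hp⟩ := exists_of_x 1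
      obtain ⟨p', -, h2⟩ := h p
      rw [hp, one_re, one_smul] at h2
      exact ⟨(p' : ℂ × ℂ).1.re - r, by rw [sub_smul, ← h2, add_sub_cancel_right]⟩
    have hε2 : ε ^ 2 = 1 := by
      have := hm f
      rw [hε, smul_re, smul_im, smul_eq_mul, smul_eq_mul] at this
      have h2 : (ε ^ 2 - 1) * (f.re ^ 2 - f.im ^ 2) = 0 := by linear_combination this
      rw [hff] at h2
      linarith
    have hsm : ∀ s t : ℝ, m (s • f) + r • f = t • f ↔ t = ε * s + r := by
      intro s t
      rw [map_smul, hε, smul_smul, ← add_smul, (smul_left_injective ℝ hf0).eq_iff]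
      constructor <;> intro h <;> linarith
    simp only [hsm] at h ⊢
    rcases sq_eq_one_iff.1 hε2 with rfl | rfl
    · have hh := classify_translation l a r fun p => by
        obtain ⟨p', h1, h2⟩ := h p
        exact ⟨p', h1, by rw [h2, one_mul]⟩
      have hr0 : r = 0 := translation_eq_zero l a r fun p => by
        obtain ⟨p', h1, h2⟩ := h p
        exact ⟨p', h1, by rw [h2, one_mul]⟩
      obtain ⟨w, hw, hw'⟩ := hh
      exact ⟨w, hw, fun p => ⟨(hw' p).1, by rw [(hw' p).2, hr0]; ring⟩⟩
    · -- composing with `rotC` reduces this case to the previous one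
      have hyp : ∀ p : CGCurve, ∃ p' : CGCurve, (l.trans rotP) (PhiC p) + -I * a = PhiC p' ∧
          (p' : ℂ × ℂ).1.re = (p : ℂ × ℂ).1.re + -r := fun p => by
        obtain ⟨p', h1, h2⟩ := h p
        refine ⟨rotC p', ?_, ?_⟩
        · rw [PhiC_rotC, ← h1, LinearIsometryEquiv.trans_apply, rotP_apply]
          ring
        · rw [rotC_fst, neg_re, h2]
          ring
      have hr0 := translation_eq_zero _ _ _ hyp
      obtain ⟨w, hw, hw'⟩ := classify_translation _ _ _ hyp
      refine ⟨_, hw.rotC_comp.negC_comp, fun p => ⟨?_, ?_⟩⟩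
      · rw [Function.comp, PhiC_negC, Function.comp, PhiC_rotC, ← (hw' p).1,
          LinearIsometryEquiv.trans_apply, rotP_apply]
        linear_combination (l (PhiC p) + a) * I_sq
      · rw [Function.comp, negC_fst, Function.comp, rotC_fst, neg_re, (hw' p).2]
        linarith
  · let e : ℂ ≃ₗ[ℝ] ℂ := LinearEquiv.ofInjectiveEndo (xi ζ) (xi_injective hζ him)
    have he : ∀ x, e x = xi ζ x := fun x => rfl
    let n : ℂ →ₗ[ℝ] ℂ := e.symm.toLinearMap ∘ₗ m ∘ₗ xi ζ
    have hn : ∀ x, xi ζ (n x) = m (xi ζ x) := fun x => e.apply_symm_apply _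
    obtain ⟨d, rfl⟩ : ∃ d, xi ζ d = c := ⟨e.symm c, e.apply_symm_apply c⟩
    simp only [← hn, ← map_add, (xi_injective hζ him).eq_iff] at h ⊢
    refine classify_of_form (neg_one_lt_kap hζ) (kap_lt_one him) l n a d (fun x => ?_) h
    have := hm (xi ζ x)
    rw [← hn, xi_form h0, xi_form h0] at this
    linarith

end ChenGackstatter

end

noncomputable section

namespace ChenGackstatter

open Complex PeriodPair

/-! ### A presentation of the dihedral group of order eight -/

/-- A group generated by `a` and `b` with the relations of the dihedral group of order eight, in which
`a ^ 2 ≠ 1` and `b` is not a power of `a`, is isomorphic to this group. -/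
theorem nonempty_mulEquiv_dihedral {G : Type*} [Group G] {a b : G} (ha : a ^ 4 = 1) (hb : b * b = 1)
    (hab : b * a * b = a⁻¹) (hgen : ∀ g, ∃ k : ℕ, g = a ^ k ∨ g = b * a ^ k) (ha2 : a ^ 2 ≠ 1)
    (hba : ∀ k : ℕ, b ≠ a ^ k) : Nonempty (G ≃* DihedralGroup 4) := by
  have hn : ∀ n : ℕ, a ^ (n : ZMod 4).val = a ^ n := fun n => by
    rw [ZMod.val_natCast, ← pow_eq_pow_mod n ha]
  have hadd : ∀ i j : ZMod 4, a ^ (i + j).val = a ^ i.val * a ^ j.val := fun i j => by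
    rw [← pow_add, ← hn (i.val + j.val)]
    simp
  have hsub : ∀ i j : ZMod 4, a ^ (j - i).val = (a ^ i.val)⁻¹ * a ^ j.val := fun i j => by
    rw [eq_inv_mul_iff_mul_eq, ← hadd, add_sub_cancel]
  have hs : SemiconjBy b a⁻¹ a := by
    rw [SemiconjBy, ← hab, ← mul_assoc, ← mul_assoc, hb, one_mul]
  have hs' : ∀ k : ℕ, a ^ k * b = b * (a ^ k)⁻¹ := fun k => by
    have := (hs.pow_right k).eq
    rw [inv_pow] at this
    exact this.symm
  let f : DihedralGroup 4 →* G := MonoidHom.mk'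
    (fun x => match x with
      | .r i => a ^ i.val
      | .sr i => b * a ^ i.val) (by
    rintro (i | i) (j | j)
    · exact hadd i j
    · change b * a ^ (j - i).val = a ^ i.val * (b * a ^ j.val)
      rw [hsub, ← mul_assoc, ← mul_assoc, hs']
    · change b * a ^ (i + j).val = b * a ^ i.val * a ^ j.val
      rw [hadd, mul_assoc]
    · change a ^ (j - i).val = b * a ^ i.val * (b * a ^ j.val)
      rw [hsub, mul_assoc, ← mul_assoc (a ^ i.val), hs', ← mul_assoc, ← mul_assoc, hb, one_mul])
  have hinj : Function.Injective f := by
    rw [injective_iff_map_eq_one]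
    rintro (i | i) h
    · change a ^ i.val = 1 at h
      rw [DihedralGroup.one_def]
      congr 1
      fin_cases i
      · rfl
      · exact (ha2 (by change a ^ 1 = 1 at h; rw [pow_one] at h; rw [h, one_pow])).elim
      · exact (ha2 h).elim
      · change a ^ 3 = 1 at h
        rw [pow_succ, h, one_mul] at ha
        exact (ha2 (by rw [ha, one_pow])).elim
    · change b * a ^ i.val = 1 at h
      refine (hba (3 * i.val) ?_).elim
      rw [eq_inv_of_mul_eq_one_left h, inv_eq_iff_mul_eq_one, ← pow_add,
        show i.val + 3 * i.val = 4 * i.val by ring, pow_mul, ha, one_pow]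
  refine ⟨(MulEquiv.ofBijective f ⟨hinj, fun g => ?_⟩).symm⟩
  obtain ⟨k, rfl | rfl⟩ := hgen g
  · exact ⟨.r k, hn k⟩
  · exact ⟨.sr k, congrArg (b * ·) (hn k)⟩

/-! ### The symmetries as Lorentz transformations -/

/-- The Lorentz transformation inducing `rotC`. -/
def rotM : R41 ≃ₗ[ℝ] R41 where
  toFun w := ![w 1, -w 0, -w 2, -w 3]
  invFun w := ![-w 1, w 0, -w 2, -w 3]
  map_add' u w := by
    ext k
    fin_cases k <;> simp <;> ring
  map_smul' r w := by
    ext k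
    fin_cases k <;> simp
  left_inv w := by
    ext k
    fin_cases k <;> simp
  right_inv w := by
    ext k
    fin_cases k <;> simp

lemma rotM_apply (w : R41) : rotM w = ![w 1, -w 0, -w 2, -w 3] := rfl

/-- The underlying linear map of the Lorentz transformation inducing `conjC`, for `m = 1 / |ζ| ^ 2`. -/
def conjLin (m : ℝ) : R41 →ₗ[ℝ] R41 where
  toFun w := ![w 0, -w 1, ((w 2 - w 3) / m + m * (w 2 + w 3)) / 2,
    ((w 2 - w 3) / m - m * (w 2 + w 3)) / 2]
  map_add' u w := by
    ext k
    fin_cases k <;> simp <;> ring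
  map_smul' r w := by
    ext k
    fin_cases k <;> simp <;> ring

lemma conjLin_apply (m : ℝ) (w : R41) : conjLin m w =
    ![w 0, -w 1, ((w 2 - w 3) / m + m * (w 2 + w 3)) / 2,
    ((w 2 - w 3) / m - m * (w 2 + w 3)) / 2] := rfl

lemma conjLin_conjLin {m : ℝ} (hm : m ≠ 0) (w : R41) : conjLin m (conjLin m w) = w := by
  ext k
  fin_cases k <;> simp [conjLin_apply] <;> field_simp <;> ring

/-- The Lorentz transformation inducing `conjC`, for `m = 1 / |ζ| ^ 2`. -/
def conjM {m : ℝ} (hm : m ≠ 0) : R41 ≃ₗ[ℝ] R41 :=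
  LinearEquiv.ofInvolutive (conjLin m) (conjLin_conjLin hm)

lemma conjM_apply {m : ℝ} (hm : m ≠ 0) (w : R41) : conjM hm w =
    ![w 0, -w 1, ((w 2 - w 3) / m + m * (w 2 + w 3)) / 2,
    ((w 2 - w 3) / m - m * (w 2 + w 3)) / 2] := rfl

lemma lor_rotM (w : R41) : lor (rotM w) (rotM w) = lor w w := by
  simp [lor, rotM_apply]
  ring

lemma lor_conjM {m : ℝ} (hm : m ≠ 0) (w : R41) : lor (conjM hm w) (conjM hm w) = lor w w := by
  simp [lor, conjM_apply]
  field_simp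
  ring

lemma Xstd_rotC (ζ : ℂ) (p : CGCurve) : Xstd ζ (rotC p) = rotM (Xstd ζ p) := by
  ext k
  fin_cases k <;> simp [Xstd, rotM_apply, PhiC_rotC] <;> ring

lemma inv_normSq_ne_zero {ζ : ℂ} (hζ : ζ ≠ 0) : (normSq ζ)⁻¹ ≠ 0 :=
  inv_ne_zero (normSq_pos.2 hζ).ne'

lemma Xstd_conjC {ζ : ℂ} (hζ : ζ ≠ 0) (p : CGCurve) :
    Xstd ζ (conjC p) = conjM (inv_normSq_ne_zero hζ) (Xstd ζ p) := by
  have hn := (normSq_pos.2 hζ).ne'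
  have e1 : ζ⁻¹.re = ζ.re * (normSq ζ)⁻¹ := by rw [inv_re]; rfl
  have e2 : ζ⁻¹.im = -ζ.im * (normSq ζ)⁻¹ := by rw [inv_im]; rfl
  ext k
  fin_cases k
  · simp [Xstd, conjM_apply, PhiC_conjC]
  · simp [Xstd, conjM_apply, PhiC_conjC]
  · simp only [Xstd, conjM_apply, Fin.reduceFinMk, Matrix.cons_val, mul_re, add_re, add_im, sub_re,
      sub_im, conjC_fst, conj_re, conj_im, e1, e2]
    field_simp
    ring
  · simp only [Xstd, conjM_apply, Fin.reduceFinMk, Matrix.cons_val, mul_re, add_re, add_im, sub_re,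
      sub_im, conjC_fst, conj_re, conj_im, e1, e2]
    field_simp
    ring

/-- The affine transformation with linear part `M` and fixed point `v₀`. -/
def affAt (v₀ : R41) (M : R41 ≃ₗ[ℝ] R41) : R41 ≃ᵃ[ℝ] R41 where
  toFun P := M (P - v₀) + v₀
  invFun P := M.symm (P - v₀) + v₀
  left_inv P := by simp
  right_inv P := by simp
  linear := M
  map_vadd' P u := by
    simp only [Equiv.coe_fn_mk, vadd_eq_add, ← map_add, ← add_assoc]
    rw [add_sub_assoc, map_add]

lemma affAt_apply (v₀ : R41) (M : R41 ≃ₗ[ℝ] R41) (P : R41) : affAt v₀ M P = M (P - v₀) + v₀ := rfl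

lemma affAt_mem {X : CGCurve → R41} {v₀ : R41} {M : R41 ≃ₗ[ℝ] R41}
    (hM : ∀ w, lor (M w) (M w) = lor w w) {w : CGCurve → CGCurve} (hw : Function.Surjective w)
    (hX : ∀ p, affAt v₀ M (X p) = X (w p)) : affAt v₀ M ∈ symmetryGroup X := by
  refine ⟨fun P Q => ?_, ?_⟩
  · rw [affAt_apply, affAt_apply, add_sub_add_right_eq_sub, ← map_sub, hM, sub_sub_sub_cancel_right]
  · rw [← Set.range_comp]
    have : (affAt v₀ M) ∘ X = X ∘ w := funext hX
    rw [this, hw.range_comp]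

/-! ### Restriction of the symmetries to the surface -/

lemma apply_mem_range {X : CGCurve → R41} (T : symmetryGroup X) {P : R41} (hP : P ∈ Set.range X) :
    (T : R41 ≃ᵃ[ℝ] R41) P ∈ Set.range X := by
  have := Set.mem_image_of_mem (T : R41 ≃ᵃ[ℝ] R41) hP
  rwa [T.2.2] at this

/-- The restriction homomorphism from the symmetry group of a surface to the group of permutations of
the surface. -/
def resHom (X : CGCurve → R41) : symmetryGroup X →* surfaceSymmetryGroup X where
  toFun T := ⟨{
    toFun := fun P => ⟨(T : R41 ≃ᵃ[ℝ] R41) P, apply_mem_range T P.2⟩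
    invFun := fun P => ⟨((T⁻¹ : symmetryGroup X) : R41 ≃ᵃ[ℝ] R41) P, apply_mem_range (T⁻¹) P.2⟩
    left_inv := fun _ => Subtype.ext ((T : R41 ≃ᵃ[ℝ] R41).symm_apply_apply _)
    right_inv := fun _ => Subtype.ext ((T : R41 ≃ᵃ[ℝ] R41).apply_symm_apply _) },
    T, T.2, fun _ => rfl⟩
  map_one' := rfl
  map_mul' _ _ := rfl

lemma resHom_surjective (X : CGCurve → R41) : Function.Surjective (resHom X) := by
  rintro ⟨σ, T, hT, h⟩
  exact ⟨⟨T, hT⟩, Subtype.ext (Equiv.ext fun P => Subtype.ext (h P).symm)⟩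

lemma resHom_eq_iff {X : CGCurve → R41} {S T : symmetryGroup X} : resHom X S = resHom X T ↔
    ∀ p, (S : R41 ≃ᵃ[ℝ] R41) (X p) = (T : R41 ≃ᵃ[ℝ] R41) (X p) := by
  constructor
  · intro h p
    exact congrArg (fun σ : surfaceSymmetryGroup X =>
      (((σ : Equiv.Perm (Set.range X)) ⟨X p, p, rfl⟩ : Set.range X) : R41)) h
  · intro h
    refine Subtype.ext (Equiv.ext ?_)
    rintro ⟨_, p, rfl⟩
    exact Subtype.ext (h p)

lemma rotC_surjective : Function.Surjective rotC := fun p =>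
  ⟨rotC (negC p), by rw [rotC_rotC, negC_negC]⟩

lemma conjC_surjective : Function.Surjective conjC := fun p => ⟨conjC p, conjC_conjC p⟩

theorem surfaceSymmetryGroup_dihedral {ζ : ℂ} (hζ : ζ.re ≠ 0) {X : CGCurve → R41} {v₀ : R41}
    (hX : ∀ p, X p = Xstd ζ p + v₀) : Nonempty (surfaceSymmetryGroup X ≃* DihedralGroup 4) := by
  have h0 : ζ ≠ 0 := fun h => hζ (by simp [h])
  have hm := inv_normSq_ne_zero h0
  have hA : ∀ p, affAt v₀ rotM (X p) = X (rotC p) := fun p => by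
    rw [affAt_apply, hX, hX, add_sub_cancel_right, Xstd_rotC]
  have hB : ∀ p, affAt v₀ (conjM hm) (X p) = X (conjC p) := fun p => by
    rw [affAt_apply, hX, hX, add_sub_cancel_right, Xstd_conjC h0]
  let A : symmetryGroup X := ⟨_, affAt_mem lor_rotM rotC_surjective hA⟩
  let B : symmetryGroup X := ⟨_, affAt_mem (lor_conjM hm) conjC_surjective hB⟩
  have hAk : ∀ (k : ℕ) p, ((A ^ k : symmetryGroup X) : R41 ≃ᵃ[ℝ] R41) (X p) = X (rotC^[k] p) := by
    intro k
    induction k with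
    | zero => exact fun p => rfl
    | succ k ih =>
      intro p
      rw [pow_succ', Function.iterate_succ_apply', ← hA, ← ih]
      rfl
  have hPhi : ∀ p q, X p = X q → PhiC p = PhiC q := fun p q h => by
    rw [hX, hX, add_left_inj, Xstd_eq_emb, Xstd_eq_emb, emb_inj] at h
    exact h.1
  obtain ⟨p, -, hp⟩ := (exists_PhiC_of_re_eq_zero 1).1
  obtain ⟨p', -, hp'⟩ := (exists_PhiC_of_re_eq_zero 1).2
  rw [ofReal_one, one_mul] at hp hp'
  refine nonempty_mulEquiv_dihedral (a := resHom X A) (b := resHom X B) ?_ ?_ ?_ ?_ ?_ ?_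
  · rw [← map_pow, ← map_one (resHom X), resHom_eq_iff]
    intro p
    rw [hAk]
    simp only [Function.iterate_succ_apply', Function.iterate_zero, id, rotC_rotC, negC_negC]
    rfl
  · rw [← map_mul, ← map_one (resHom X), resHom_eq_iff]
    intro p
    change affAt v₀ (conjM hm) (affAt v₀ (conjM hm) (X p)) = X p
    rw [hB, hB, conjC_conjC]
  · rw [eq_inv_iff_mul_eq_one, ← map_mul, ← map_mul, ← map_mul, ← map_one (resHom X), resHom_eq_iff]
    intro p
    change affAt v₀ (conjM hm) (affAt v₀ rotM (affAt v₀ (conjM hm) (affAt v₀ rotM (X p)))) = X p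
    rw [hA, hB, hA, hB, rotC_conjC, conjC_conjC, rotC_rotC, rotC_rotC, negC_negC]
  · intro g
    obtain ⟨T, rfl⟩ := resHom_surjective X g
    set T' : R41 ≃ᵃ[ℝ] R41 := T.1 with hT'
    have hT : ∀ p, T' (X p) = T'.linear (Xstd ζ p) + T' v₀ := fun p => by
      rw [hX, ← vadd_eq_add, AffineEquiv.map_vadd, vadd_eq_add]
    obtain ⟨w, ⟨k, hk⟩, hw⟩ := classify hζ (L := T'.linear) (v := T' v₀ - v₀) (fun u => by
        have := T.2.1 (u + v₀) v₀
        rw [← hT', ← vadd_eq_add, AffineEquiv.map_vadd, vadd_eq_add, vadd_eq_add,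
          add_sub_cancel_right, add_sub_cancel_right] at this
        exact this) (fun p => by
        obtain ⟨p', hp'⟩ := apply_mem_range T ⟨p, rfl⟩
        refine ⟨p', ?_⟩
        rw [hT, hX] at hp'
        rw [← add_sub_assoc, sub_eq_iff_eq_add]
        exact hp'.symm)
    have hTw : ∀ p, T' (X p) = X (w p) := fun p => by
      rw [hT, hX, ← hw p, add_assoc, sub_add_cancel]
      rfl
    refine ⟨k, hk.imp ?_ ?_⟩
    · rintro rfl
      rw [← map_pow, resHom_eq_iff]
      exact fun p => by rw [← hT', hTw, hAk]
    · rintro rfl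
      rw [← map_pow, ← map_mul, resHom_eq_iff]
      intro p
      rw [← hT', hTw, Function.comp, ← hB, ← hAk]
      rfl
  · rw [← map_pow, ← map_one (resHom X), Ne, resHom_eq_iff]
    intro h
    have h1 := h p
    rw [hAk] at h1
    have h2 := hPhi _ _ h1
    simp only [Function.iterate_succ_apply', Function.iterate_zero, id, rotC_rotC, PhiC_negC, hp] at h2
    exact omg_ne_zero (neg_eq_self.1 h2)
  · intro k
    rw [← map_pow, Ne, resHom_eq_iff]
    intro h
    have hk : ∀ q, PhiC (rotC^[k] q) = (-I) ^ k * PhiC q := by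
      clear h
      induction k with
      | zero => simp
      | succ k ih =>
        intro q
        rw [Function.iterate_succ_apply', PhiC_rotC, ih]
        ring
    have key : ∀ q, conj (PhiC q) = (-I) ^ k * PhiC q := fun q => by
      rw [← PhiC_conjC, ← hk]
      exact hPhi _ _ (by rw [← hB, ← hAk]; exact h q)
    have k1 := key p
    have k2 := key p'
    rw [hp] at k1
    rw [hp', conj_conj, k1] at k2
    rw [conj_omg] at k1
    have k3 := mul_right_cancel₀ omg_ne_zero k1
    rw [← k3] at k2
    refine omg_ne_zero (self_eq_neg.1 ?_)
    linear_combination k2 + omg * I_sq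

lemma resHom_injective {ζ : ℂ} (hζ : ζ.re ≠ 0) (him : ζ.im ≠ 0) {X : CGCurve → R41} {v₀ : R41}
    (hX : ∀ p, X p = Xstd ζ p + v₀) : Function.Injective (resHom X) := by
  intro S T h
  rw [resHom_eq_iff] at h
  set S' : R41 ≃ᵃ[ℝ] R41 := S.1 with hS'
  set T' : R41 ≃ᵃ[ℝ] R41 := T.1 with hT'
  let D : R41 →ₗ[ℝ] R41 := S'.linear.toLinearMap - T'.linear.toLinearMap
  have hD : ∀ p q, D (Xstd ζ p - Xstd ζ q) = 0 := by
    intro p q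
    have e : Xstd ζ p - Xstd ζ q = X p -ᵥ X q := by
      rw [hX, hX, vsub_eq_sub, add_sub_add_right_eq_sub]
    have e1 : S'.linear (X p -ᵥ X q) = S' (X p) -ᵥ S' (X q) := S'.toAffineMap.linearMap_vsub _ _
    have e2 : T'.linear (X p -ᵥ X q) = T' (X p) -ᵥ T' (X q) := T'.toAffineMap.linearMap_vsub _ _
    rw [e]
    change S'.linear _ - T'.linear _ = 0
    rw [e1, e2, h, h, sub_self]
  obtain ⟨o, ho⟩ := exists_of_x 0
  have hPo : PhiC o = 0 := PhiC_eq_zero_of_x (Or.inl ho)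
  have hDo : ∀ p, D (Xstd ζ p) = 0 := fun p => by
    have := hD p o
    have ho' : Xstd ζ o = 0 := by
      rw [Xstd_eq_emb, hPo, ho, map_zero]
      ext k
      fin_cases k <;> rfl
    rwa [ho', sub_zero] at this
  have hPhi : ∀ p, D (emb (PhiC p) 0) = 0 := by
    intro p
    have e : emb (PhiC p) 0 = (1 / 2 : ℝ) • (Xstd ζ p - Xstd ζ (negC p)) := by
      rw [sub_eq_add_neg, ← neg_one_smul ℝ, Xstd_eq_emb, Xstd_eq_emb, smul_emb, emb_add, smul_emb,
        emb_inj, PhiC_negC, negC_fst]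
      push_cast
      constructor <;> ring
    rw [e, map_smul, hD, smul_zero]
  have hxi : ∀ w, D (emb 0 w) = 0 := by
    intro w
    obtain ⟨x, rfl⟩ := (LinearMap.injective_iff_surjective.1 (xi_injective hζ him)) w
    obtain ⟨p, rfl⟩ := exists_of_x x
    have h1 := hDo p
    have e : Xstd ζ p = emb (PhiC p) 0 + emb 0 (xi ζ (p : ℂ × ℂ).1) := by
      rw [Xstd_eq_emb, emb_add, add_zero, zero_add]
    rwa [e, map_add, hPhi, zero_add] at h1
  obtain ⟨p, -, hp⟩ := (exists_PhiC_of_re_eq_zero 1).1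
  obtain ⟨p', -, hp'⟩ := (exists_PhiC_of_re_eq_zero 1).2
  rw [ofReal_one, one_mul] at hp hp'
  have hz : ∀ z, D (emb z 0) = 0 := by
    intro z
    have e : ∀ r s : ℝ, emb (r • omg + s • conj omg) 0 = r • emb (PhiC p) 0 + s • emb (PhiC p') 0 := by
      intro r s
      rw [smul_emb, smul_emb, emb_add, hp, hp']
      simp
    rw [eq_smul_omg z, e, map_add, map_smul, map_smul, hPhi, hPhi, smul_zero, smul_zero, add_zero]
  have hD0 : ∀ P, D P = 0 := by
    intro P
    have e : P = emb ⟨P 0, P 1⟩ 0 + emb 0 ⟨P 2, P 3⟩ := by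
      rw [emb_add, add_zero, zero_add, emb_eta]
    rw [e, map_add, hz, hxi, add_zero]
  refine Subtype.ext (AffineEquiv.ext fun P => ?_)
  have e1 : S' P = S'.linear (P -ᵥ X o) +ᵥ S' (X o) := by
    rw [← AffineEquiv.map_vadd, vsub_vadd]
  have e2 : T' P = T'.linear (P -ᵥ X o) +ᵥ T' (X o) := by
    rw [← AffineEquiv.map_vadd, vsub_vadd]
  have e3 : S'.linear (P -ᵥ X o) = T'.linear (P -ᵥ X o) := sub_eq_zero.1 (hD0 _)
  rw [← hS', ← hT', e1, e2, h, e3]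

theorem symmetryGroup_dihedral {ζ : ℂ} (hζ : ζ.re ≠ 0) (him : ζ.im ≠ 0) {X : CGCurve → R41} {v₀ : R41}
    (hX : ∀ p, X p = Xstd ζ p + v₀) : Nonempty (symmetryGroup X ≃* DihedralGroup 4) := by
  obtain ⟨e⟩ := surfaceSymmetryGroup_dihedral hζ hX
  exact ⟨(MulEquiv.ofBijective (resHom X) ⟨resHom_injective hζ him hX, resHom_surjective X⟩).trans e⟩

/-! ### Self-intersections -/

/-- For nonreal `ζ` the last two coordinates determine `x`, so double points are points where the two
points over `x` have the same value of the odd function `Φ`. -/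
theorem ncard_selfIntersectionPoints {ζ : ℂ} (hζ : ζ.re ≠ 0) (him : ζ.im ≠ 0) {X : CGCurve → R41}
    {v₀ : R41} (hX : ∀ p, X p = Xstd ζ p + v₀) : (selfIntersectionPoints X).ncard = 2 := by
  obtain ⟨s, hs1, hs⟩ := exists_zeros_PhiC
  have hxi := xi_injective hζ him
  have hs0 : (s : ℂ) ≠ 0 := by
    rw [Ne, ofReal_eq_zero]
    linarith
  have e : selfIntersectionPoints X = {emb 0 (xi ζ s) + v₀, emb 0 (xi ζ (-s)) + v₀} := by
    ext P
    simp only [selfIntersectionPoints, Set.mem_ofPred_eq, Set.mem_insert_iff, Set.mem_singleton_iff]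
    constructor
    · rintro ⟨p, q, hpq, rfl, h⟩
      rw [hX, hX, add_left_inj, Xstd_eq_emb, Xstd_eq_emb, emb_inj, hxi.eq_iff] at h
      have hq := (eq_or_eq_negC h.2).resolve_left (Ne.symm hpq)
      have hP : PhiC p = 0 := by
        have h1 := h.1
        rw [hq, PhiC_negC] at h1
        exact neg_eq_self.1 h1
      have hy : (p : ℂ × ℂ).2 ≠ 0 := by
        intro hy
        refine hpq ?_
        rw [hq]
        exact Subtype.ext (Prod.ext rfl (by simp [hy]))
      have hx : (p : ℂ × ℂ).1 = s ∨ (p : ℂ × ℂ).1 = -s := by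
        have hc := p.2
        rcases (hs p).1 hP with h1 | h1 | h1 | h1 | h1
        · exact (hy (by simpa [h1] using hc)).elim
        · exact (hy (by simpa [h1] using hc)).elim
        · exact (hy (by simpa [h1] using hc)).elim
        · exact Or.inl h1
        · exact Or.inr h1
      rw [hX, Xstd_eq_emb, hP]
      exact hx.imp (fun h => by rw [h]) (fun h => by rw [h])
    · have key : ∀ x : ℂ, (x = s ∨ x = -s) →
          ∃ p q, p ≠ q ∧ X p = emb 0 (xi ζ x) + v₀ ∧ X q = emb 0 (xi ζ x) + v₀ := by
        intro x hx
        obtain ⟨p, rfl⟩ := exists_of_x x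
        have hP : PhiC p = 0 := (hs p).2 (by tauto)
        refine ⟨p, negC p, fun h => ?_, ?_, ?_⟩
        · have hy : (p : ℂ × ℂ).2 = 0 := by
            have h1 : (p : ℂ × ℂ).2 = -(p : ℂ × ℂ).2 := by
              conv_lhs => rw [h]
              rfl
            exact self_eq_neg.1 h1
          have hc := p.2
          have h2 : (s : ℂ) ^ 2 ≠ 1 := by
            rw [← ofReal_pow, Ne, ofReal_eq_one]
            nlinarith
          rw [hy] at hc
          rcases hx with h1 | h1 <;> rw [h1] at hc
          · refine h2 (mul_left_cancel₀ hs0 ?_)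
            linear_combination -hc
          · refine h2 (mul_left_cancel₀ hs0 ?_)
            linear_combination hc
        · rw [hX, Xstd_eq_emb, hP]
        · rw [hX, Xstd_eq_emb, PhiC_negC, hP, neg_zero, negC_fst]
      rintro (rfl | rfl)
      · exact key _ (Or.inl rfl)
      · exact key _ (Or.inr rfl)
  rw [e, Set.ncard_pair]
  rw [Ne, add_left_inj, emb_inj, hxi.eq_iff]
  rintro ⟨-, h⟩
  exact hs0 (self_eq_neg.1 h)

end ChenGackstatter

end

/-! ### Conclusion -/

theorem proposition4p5 :
    -- the surfaces are defined on a torus punctured at one point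
    CurveIsPuncturedTorus ∧
    -- they form a smooth real 2-parameter family (parameter `ζ`, not purely imaginary) through a
    -- surface in `ℝ³`
    (∃ F : ℂ → CGCurve → R41,
      (∀ ζ : ℂ, ζ.re ≠ 0 → IsLorentzDeformationCG ζ (F ζ)) ∧
      (∀ γ U, IsParam γ U →
        ContDiffOn ℝ ∞ (fun s : ℂ × ℂ => F s.1 (γ s.2)) ({ζ : ℂ | ζ.re ≠ 0} ×ˢ U)) ∧
      (∀ p, F 1 p 3 = 0)) ∧
    -- different parameters give different surfaces
    (∀ (ζ ζ' : ℂ) (X : CGCurve → R41), ζ.re ≠ 0 → ζ'.re ≠ 0 →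
      IsLorentzDeformationCG ζ X → IsLorentzDeformationCG ζ' X → ζ = ζ') ∧
    -- geometry of each member of the family
    (∀ (ζ : ℂ) (X : CGCurve → R41), ζ.re ≠ 0 → IsLorentzDeformationCG ζ X →
      IsStationarySurface X ∧
      IsCompleteSurface X ∧
      HasRegularEnd (phiCG ζ) (psiCG ζ) ∧
      HasTotalCurvature X (8 * Real.pi) ∧
      (ζ.im ≠ 0 → (selfIntersectionPoints X).ncard = 2) ∧
      Nonempty (surfaceSymmetryGroup X ≃* DihedralGroup 4) ∧
      (ζ.im ≠ 0 → Nonempty (symmetryGroup X ≃* DihedralGroup 4))) := by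
  refine ⟨ChenGackstatter.curveIsPuncturedTorus,
    ⟨ChenGackstatter.Xstd, fun ζ hζ => ChenGackstatter.isLorentzDeformation_Xstd hζ,
      fun γ U hγ => ChenGackstatter.contDiffOn_family hγ,
      fun p => by simp [ChenGackstatter.Xstd]⟩,
    fun ζ ζ' X hζ hζ' h h' => ChenGackstatter.parameter_unique hζ hζ' h h', fun ζ X hζ hX => ?_⟩
  obtain ⟨v, hv⟩ := ChenGackstatter.exists_translation hζ hX
  exact ⟨ChenGackstatter.isStationarySurface hζ hv, ChenGackstatter.isCompleteSurface hζ hv,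
    ChenGackstatter.hasRegularEnd hζ, ChenGackstatter.hasTotalCurvature hζ hv,
    fun him => ChenGackstatter.ncard_selfIntersectionPoints hζ him hv,
    ChenGackstatter.surfaceSymmetryGroup_dihedral hζ hv,
    fun him => ChenGackstatter.symmetryGroup_dihedral hζ him hv⟩
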